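/- Let $\Omega=(a,b)\times(c,d)$, $\alpha,\beta\in(1,2)$, $\alpha_1=2-\alpha$, $\alpha_2=2-\beta$, and $N\in\mathbb N$. Let $D^1,\dots,D^K$ be the triangles of a conforming triangulation of $\overline\Omega$, $h_k$ the diameter of $D^k$ and $\rho_k$ the diameter of its inscribed circle. Let $\Gamma_i$ be the set of internal edges and $\Gamma_b$ the set of external edges; put $h=\min(h_k,h_l)$ on an edge common to $D^k,D^l$, and $h=h_k$ on an external edge of $D^k$. Let $V_h$ be the space of all $v$ with $v|_{D^k}$ a polynomial of total degree at most $N$ for each $k$. On an internal edge, with outward unit normals $n^\pm$ of the two adjacent triangles, put $[\![v]\!]=n^+v^++n^-v^-$ for scalars, $[\![\pi]\!]=n^+\cdot\pi^++n^-\cdot\pi^-$ and $\{\pi\}=\tfrac12(\pi^++\pi^-)$ for vector fields. Let $\eta$ (with values in $\mathbb R^2$) and $\tilde\lambda$ (with values in $\mathbb R$) be constant on each edge, and $\lambda=\tilde\lambda/h$. The lifting $L(\theta)\in V_h\times V_h$ of $\theta\in V_h$ is defined by $$\int_\Omega L(\theta)\cdot\pi\,dx=\oint_{\Gamma_b}(n\cdot\pi)\,\theta\,ds+\oint_{\Gamma_i}\{\pi\}\cdot[\![\theta]\!]\,ds-\oint_{\Gamma_i}(\eta\cdot[\![\theta]\!])\,[\![\pi]\!]\,ds\qquad\text{for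 all }\pi\in V_h\times V_h .$$ Let ${}_LI(p^x,p^y)=({}_aI_x^{\alpha_1}p^x,\,{}_cI_y^{\alpha_2}p^y)$, where ${}_aI_x^{\mu}g(x)=\frac1{\Gamma(\mu)}\int_a^x (x-s)^{\mu-1}g(s)\,ds$ is the left Riemann--Liouville integral, and let $\nabla$ be the elementwise gradient. Define $$B_h(u,v)=\int_\Omega\bigl({}_LI(\nabla u)-{}_LI(L(u))\bigr)\cdot(\nabla v-L(v))\,dx+\oint_{\Gamma_i}\lambda[\![u]\!]\cdot[\![v]\!]\,ds+\oint_{\Gamma_b}\lambda uv\,ds,$$ $$|||v|||^2=\int_c^d\|v_x(\cdot,y)\|_{H^{-\alpha_1/2}}^2dy+\int_a^b\|v_y(x,\cdot)\|_{H^{-\alpha_2/2}}^2dx+\oint_{\Gamma_i}h^{-1}\bigl|[\![v]\!]\bigr|^2ds+\oint_{\Gamma_b}h^{-1}v^2ds,$$ where $v_x,v_y$ are the elementwise derivatives, extended by zero outside $\Omega$, and $\|g\|_{H^{-s}}=\bigl\|\,|\omega|^{-s}\hat g\,\bigr\|_{L^2(\mathbb R)}$ with the unitary Fourier transform $\hat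 g(\omega)=(2\pi)^{-1/2}\int_{\mathbb R} g(x)e^{-i\omega x}\,dx$. Theorem. Let $\sigma,M,\tilde\lambda_0,\tilde\lambda_1$ be real numbers with $\tilde\lambda_0>0$. There are constants $C_k,C_s>0$, depending only on $a,b,c,d,\alpha,\beta,N,\sigma,M,\tilde\lambda_0,\tilde\lambda_1$ (in particular not on the mesh sizes), such that for every conforming triangulation of $\overline\Omega$ with $h_k\le\sigma\rho_k$ for all $k$, every $\eta$ with $|\eta|\le M$ on the internal edges, and every $\tilde\lambda$ with $\tilde\lambda_0\le\tilde\lambda\le\tilde\lambda_1$ on all edges: (i) (boundedness) $B_h(u,v)\le C_k\,|||u|||\,|||v|||$ for all $u,v\in V_h$; (ii) (coercivity) $B_h(v,v)\ge C_s\,|||v|||^2$ for all $v\in V_h$. -/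

import Mathlib

open MeasureTheory Set
open scoped Classical

noncomputable section

namespace FracDG

/-- The Euclidean inner product of two vectors of the plane. -/
def dot (p q : ℝ × ℝ) : ℝ := p.1 * q.1 + p.2 * q.2

/-- The Euclidean length of a vector of the plane. -/
def len (p : ℝ × ℝ) : ℝ := Real.sqrt (dot p p)

/-- The signed area of the parallelogram spanned by two vectors of the plane. -/
def cross (p q : ℝ × ℝ) : ℝ := p.1 * q.2 - p.2 * q.1

/-- Value of a bivariate polynomial at a point of the plane. -/
def ev (p : MvPolynomial (Fin 2) ℝ) (x : ℝ × ℝ) : ℝ := MvPolynomial.eval ![x.1, x.2] p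

/-! ### One-dimensional fractional calculus -/

/-- The left Riemann–Liouville integral of order `μ` with base point `a`. -/
def rlIntegral (a μ : ℝ) (g : ℝ → ℝ) (x : ℝ) : ℝ :=
  (1 / Real.Gamma μ) * ∫ s in a..x, g s / (x - s) ^ (1 - μ)

/-- The square of the norm `‖ |ω|^(-s) ĝ ‖` in `L²(ℝ)`, the Fourier transform
`ĝ(ω) = (2π)^(-1/2) ∫ g(x) e^(-iωx) dx` being unitary; here `ω = 2πξ`. -/
def negSobolevSq (s : ℝ) (g : ℝ → ℝ) : ℝ :=
  ∫ ξ : ℝ, |2 * Real.pi * ξ| ^ (-(2 * s)) *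
    ‖FourierTransform.fourier (fun x : ℝ => (g x : ℂ)) ξ‖ ^ 2

/-- The left Riemann–Liouville integral in the first variable. -/
def fracX (a μ : ℝ) (g : ℝ × ℝ → ℝ) (x : ℝ × ℝ) : ℝ :=
  rlIntegral a μ (fun s => g (s, x.2)) x.1

/-- The left Riemann–Liouville integral in the second variable. -/
def fracY (c μ : ℝ) (g : ℝ × ℝ → ℝ) (x : ℝ × ℝ) : ℝ :=
  rlIntegral c μ (fun s => g (x.1, s)) x.2

/-! ### Triangles and triangulations -/

/-- The closed triangle with given vertices. -/
def cellOf (t : Affine.Triangle ℝ (ℝ × ℝ)) : Set (ℝ × ℝ) := convexHull ℝ (range t.points)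

/-- The length of the side opposite to the `i`-th vertex. -/
def sideLen (t : Affine.Triangle ℝ (ℝ × ℝ)) (i : Fin 3) : ℝ :=
  len (t.points (i + 2) - t.points (i + 1))

/-- The diameter of a triangle: the length of its longest side. -/
def diam (t : Affine.Triangle ℝ (ℝ × ℝ)) : ℝ := max (sideLen t 0) (max (sideLen t 1) (sideLen t 2))

/-- The diameter of the inscribed circle: `4 * area / perimeter`. -/
def inDiam (t : Affine.Triangle ℝ (ℝ × ℝ)) : ℝ :=
  2 * |cross (t.points 1 - t.points 0) (t.points 2 - t.points 0)| /
    (sideLen t 0 + sideLen t 1 + sideLen t 2)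

/-- The unit normal, pointing out of the triangle, of the side opposite to the `i`-th vertex. -/
def normal (t : Affine.Triangle ℝ (ℝ × ℝ)) (i : Fin 3) : ℝ × ℝ :=
  let p := t.points (i + 1)
  let e := t.points (i + 2) - p
  (Real.sign (cross e (t.points i - p)) / sideLen t i) • ((e.2, -e.1) : ℝ × ℝ)

/-- A conforming triangulation of the rectangle `[a, b] × [c, d]`. -/
structure Triangulation (a b c d : ℝ) where
  /-- number of elements -/
  K : ℕ
  /-- the elements -/
  elem : Fin K → Affine.Triangle ℝ (ℝ × ℝ)
  cover : ⋃ k, cellOf (elem k) = Icc a b ×ˢ Icc c d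
  nonoverlapping : ∀ k l, k ≠ l → Disjoint (interior (cellOf (elem k))) (interior (cellOf (elem l)))
  /-- two elements meet in nothing, in a common vertex, or in a common side -/
  conforming : ∀ k l, k ≠ l → cellOf (elem k) ∩ cellOf (elem l) =
    convexHull ℝ (range (elem k).points ∩ range (elem l).points)

variable {a b c d : ℝ}

namespace Triangulation

/-- Every element has diameter at most `σ` times the diameter of its inscribed circle. -/
def ShapeRegular (T : Triangulation a b c d) (σ : ℝ) : Prop :=
  ∀ k, diam (T.elem k) ≤ σ * inDiam (T.elem k)

/-- Piecewise polynomials: one polynomial on each element. -/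
abbrev PW (T : Triangulation a b c d) : Type := Fin T.K → MvPolynomial (Fin 2) ℝ

/-- The DG space `V_h`: on each element a polynomial of total degree at most `N`. -/
def V (T : Triangulation a b c d) (N : ℕ) : Submodule ℝ T.PW :=
  Submodule.pi univ (fun _ => MvPolynomial.restrictTotalDegree (Fin 2) ℝ N)

/-- The function on the plane that is given by the piecewise polynomial in the interior of each
element and is `0` elsewhere, in particular outside the rectangle. -/
def fn (T : Triangulation a b c d) (w : T.PW) (x : ℝ × ℝ) : ℝ :=
  ∑ k, (interior (cellOf (T.elem k))).indicator (ev (w k)) x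

/-- The elementwise gradient. -/
def grad (T : Triangulation a b c d) (w : T.PW) : T.PW × T.PW :=
  (fun k => MvPolynomial.pderiv 0 (w k), fun k => MvPolynomial.pderiv 1 (w k))

/-- A face `(k, i)`: the side of the element `k` opposite to its `i`-th vertex. -/
abbrev Face (T : Triangulation a b c d) : Type := Fin T.K × Fin 3

/-- The edge of the mesh which a face occupies, as the unordered pair of its end points. -/
def edge (T : Triangulation a b c d) (f : T.Face) : Sym2 (ℝ × ℝ) :=
  s((T.elem f.1).points (f.2 + 1), (T.elem f.1).points (f.2 + 2))

/-- The outward unit normal on a face. -/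
def nrm (T : Triangulation a b c d) (f : T.Face) : ℝ × ℝ := normal (T.elem f.1) f.2

/-- The internal edges: each is listed once, as the pair of the two faces that occupy it. -/
def internal (T : Triangulation a b c d) : Finset (T.Face × T.Face) :=
  Finset.univ.filter (fun e => e.1.1 < e.2.1 ∧ T.edge e.1 = T.edge e.2)

/-- The external edges: the faces of an element that are not shared with another element. -/
def external (T : Triangulation a b c d) : Finset T.Face :=
  Finset.univ.filter (fun f => ∀ g : T.Face, g.1 ≠ f.1 → T.edge g ≠ T.edge f)

/-- The integral over a face with respect to arc length. -/
def faceInt (T : Triangulation a b c d) (f : T.Face) (g : ℝ × ℝ → ℝ) : ℝ :=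
  sideLen (T.elem f.1) f.2 * ∫ t in (0 : ℝ)..1,
    g ((T.elem f.1).points (f.2 + 1) +
      t • ((T.elem f.1).points (f.2 + 2) - (T.elem f.1).points (f.2 + 1)))

/-- The local mesh size `min (h⁻, h⁺)` on an internal edge. -/
def hInt (T : Triangulation a b c d) (e : T.Face × T.Face) : ℝ :=
  min (diam (T.elem e.1.1)) (diam (T.elem e.2.1))

/-- The local mesh size on an external edge. -/
def hExt (T : Triangulation a b c d) (f : T.Face) : ℝ := diam (T.elem f.1)

/-- The jump `n⁻ v⁻ + n⁺ v⁺` of a scalar on an internal edge. -/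
def jump (T : Triangulation a b c d) (v : T.PW) (e : T.Face × T.Face) (x : ℝ × ℝ) : ℝ × ℝ :=
  ev (v e.1.1) x • T.nrm e.1 + ev (v e.2.1) x • T.nrm e.2

/-- The value on the element `k` of a piecewise polynomial vector field. -/
def evV (T : Triangulation a b c d) (π : T.PW × T.PW) (k : Fin T.K) (x : ℝ × ℝ) : ℝ × ℝ :=
  (ev (π.1 k) x, ev (π.2 k) x)

/-- The jump `n⁻ · π⁻ + n⁺ · π⁺` of a vector field on an internal edge. -/
def jumpV (T : Triangulation a b c d) (π : T.PW × T.PW) (e : T.Face × T.Face) (x : ℝ × ℝ) : ℝ :=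
  dot (T.nrm e.1) (T.evV π e.1.1 x) + dot (T.nrm e.2) (T.evV π e.2.1 x)

/-- The average of a vector field on an internal edge. -/
def avgV (T : Triangulation a b c d) (π : T.PW × T.PW) (e : T.Face × T.Face) (x : ℝ × ℝ) : ℝ × ℝ :=
  (1 / 2 : ℝ) • (T.evV π e.1.1 x + T.evV π e.2.1 x)

/-! ### The lifting operator -/

/-- The sum over the elements of the integrals of `σ · π`. -/
def innerV (T : Triangulation a b c d) (σ π : T.PW × T.PW) : ℝ :=
  ∑ k, ∫ x in cellOf (T.elem k), dot (T.evV σ k x) (T.evV π k x)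

/-- The right-hand side of the equation that defines the lifting of `θ`, tested with `π`. The flux
parameter `η` is a vector on each edge. -/
def liftRhs (T : Triangulation a b c d) (η : Sym2 (ℝ × ℝ) → ℝ × ℝ) (θ : T.PW)
    (π : T.PW × T.PW) : ℝ :=
  ∑ f ∈ T.external, T.faceInt f (fun x => dot (T.nrm f) (T.evV π f.1 x) * ev (θ f.1) x)
  + ∑ e ∈ T.internal, T.faceInt e.1 (fun x => dot (T.avgV π e x) (T.jump θ e x))
  - ∑ e ∈ T.internal, T.faceInt e.1
      (fun x => dot (η (T.edge e.1)) (T.jump θ e x) * T.jumpV π e x)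

theorem continuous_ev (p : MvPolynomial (Fin 2) ℝ) : Continuous (ev p) := by
  have h : Continuous (fun x : ℝ × ℝ => (![x.1, x.2] : Fin 2 → ℝ)) := by
    refine continuous_pi (fun i => ?_)
    fin_cases i
    · exact continuous_fst
    · exact continuous_snd
  exact (MvPolynomial.continuous_eval p).comp h

theorem isCompact_cellOf (t : Affine.Triangle ℝ (ℝ × ℝ)) : IsCompact (cellOf t) :=
  (finite_range _).isCompact_convexHull ℝ

theorem interior_cellOf_nonempty (t : Affine.Triangle ℝ (ℝ × ℝ)) :
    (interior (cellOf t)).Nonempty := by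
  rw [cellOf, interior_convexHull_nonempty_iff_affineSpan_eq_top,
    t.independent.affineSpan_eq_top_iff_card_eq_finrank_add_one]
  simp

theorem eq_zero_of_integral_sq (t : Affine.Triangle ℝ (ℝ × ℝ)) (p : MvPolynomial (Fin 2) ℝ)
    (h : ∫ x in cellOf t, ev p x ^ 2 = 0) : p = 0 := by
  have hc := continuous_ev p
  have hi : IntegrableOn (fun x => ev p x ^ 2) (cellOf t) :=
    (hc.pow 2).continuousOn.integrableOn_compact (isCompact_cellOf t)
  rw [setIntegral_eq_zero_iff_of_nonneg_ae (Filter.Eventually.of_forall fun x => sq_nonneg _) hi]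
    at h
  have h' := ae_restrict_of_ae_restrict_of_subset (interior_subset) h
  have h2 := Measure.eqOn_open_of_ae_eq h' isOpen_interior
    (hc.pow 2).continuousOn continuousOn_const
  obtain ⟨x, hx⟩ := interior_cellOf_nonempty t
  obtain ⟨ε, hε, hb⟩ := Metric.isOpen_iff.1 isOpen_interior x hx
  refine MvPolynomial.funext_set ![Metric.ball x.1 ε, Metric.ball x.2 ε] ?_ ?_
  · intro i
    fin_cases i
    · simpa [Real.ball_eq_Ioo] using Ioo_infinite (by linarith : x.1 - ε < x.1 + ε)
    · simpa [Real.ball_eq_Ioo] using Ioo_infinite (by linarith : x.2 - ε < x.2 + ε)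
  · intro y hy
    have h0 := hy 0 (mem_univ _)
    have h1 := hy 1 (mem_univ _)
    have hm : ((y 0, y 1) : ℝ × ℝ) ∈ Metric.ball x ε := by
      rw [← ball_prod_same]; exact ⟨h0, h1⟩
    have := h2 (hb hm)
    have e : (![y 0, y 1] : Fin 2 → ℝ) = y := by
      ext i; fin_cases i <;> rfl
    simpa [ev, e] using this

theorem dot_add_right (p q r : ℝ × ℝ) : dot p (q + r) = dot p q + dot p r := by
  simp [dot]; ring

theorem dot_smul_right (s : ℝ) (p q : ℝ × ℝ) : dot p (s • q) = s * dot p q := by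
  simp [dot]; ring

theorem dot_comm (p q : ℝ × ℝ) : dot p q = dot q p := by
  simp [dot]; ring

theorem continuous_dot {f g : ℝ × ℝ → ℝ × ℝ} (hf : Continuous f) (hg : Continuous g) :
    Continuous (fun x => dot (f x) (g x)) := by
  unfold dot; fun_prop

theorem continuous_evV (T : Triangulation a b c d) (π : T.PW × T.PW) (k : Fin T.K) :
    Continuous (T.evV π k) :=
  (continuous_ev _).prodMk (continuous_ev _)

theorem evV_add (T : Triangulation a b c d) (π ρ : T.PW × T.PW) (k : Fin T.K) (x : ℝ × ℝ) :
    T.evV (π + ρ) k x = T.evV π k x + T.evV ρ k x := by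
  simp [evV, ev]

theorem evV_smul (T : Triangulation a b c d) (s : ℝ) (π : T.PW × T.PW) (k : Fin T.K) (x : ℝ × ℝ) :
    T.evV (s • π) k x = s • T.evV π k x := by
  simp [evV, ev]

theorem continuous_jump (T : Triangulation a b c d) (v : T.PW) (e : T.Face × T.Face) :
    Continuous (T.jump v e) :=
  ((continuous_ev _).smul continuous_const).add ((continuous_ev _).smul continuous_const)

theorem faceInt_add (T : Triangulation a b c d) (f : T.Face) {g h : ℝ × ℝ → ℝ}
    (hg : Continuous g) (hh : Continuous h) :
    T.faceInt f (fun x => g x + h x) = T.faceInt f g + T.faceInt f h := by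
  unfold faceInt
  rw [intervalIntegral.integral_add, mul_add]
  · exact Continuous.intervalIntegrable (by fun_prop) _ _
  · exact Continuous.intervalIntegrable (by fun_prop) _ _

theorem faceInt_smul (T : Triangulation a b c d) (f : T.Face) (s : ℝ) (g : ℝ × ℝ → ℝ) :
    T.faceInt f (fun x => s * g x) = s * T.faceInt f g := by
  unfold faceInt
  rw [intervalIntegral.integral_const_mul]
  ring

theorem continuous_avgV (T : Triangulation a b c d) (π : T.PW × T.PW) (e : T.Face × T.Face) :
    Continuous (T.avgV π e) :=
  ((T.continuous_evV π _).add (T.continuous_evV π _)).const_smul (1 / 2 : ℝ)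

theorem continuous_jumpV (T : Triangulation a b c d) (π : T.PW × T.PW) (e : T.Face × T.Face) :
    Continuous (T.jumpV π e) :=
  (continuous_dot continuous_const (T.continuous_evV π _)).add
    (continuous_dot continuous_const (T.continuous_evV π _))

theorem liftRhs_add (T : Triangulation a b c d) (η : Sym2 (ℝ × ℝ) → ℝ × ℝ) (θ : T.PW)
    (π ρ : T.PW × T.PW) : T.liftRhs η θ (π + ρ) = T.liftRhs η θ π + T.liftRhs η θ ρ := by
  have h1 : ∀ f : T.Face, T.faceInt f (fun x => dot (T.nrm f) (T.evV (π + ρ) f.1 x) * ev (θ f.1) x)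
      = T.faceInt f (fun x => dot (T.nrm f) (T.evV π f.1 x) * ev (θ f.1) x)
        + T.faceInt f (fun x => dot (T.nrm f) (T.evV ρ f.1 x) * ev (θ f.1) x) := by
    intro f
    rw [← faceInt_add]
    · congr 1; ext x; rw [evV_add, dot_add_right]; ring
    · exact (continuous_dot continuous_const (T.continuous_evV π _)).mul (continuous_ev _)
    · exact (continuous_dot continuous_const (T.continuous_evV ρ _)).mul (continuous_ev _)
  have h2 : ∀ e : T.Face × T.Face,
      T.faceInt e.1 (fun x => dot (T.avgV (π + ρ) e x) (T.jump θ e x))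
      = T.faceInt e.1 (fun x => dot (T.avgV π e x) (T.jump θ e x))
        + T.faceInt e.1 (fun x => dot (T.avgV ρ e x) (T.jump θ e x)) := by
    intro e
    rw [← faceInt_add]
    · congr 1; ext x; simp only [avgV, evV_add, dot, Prod.fst_add, Prod.snd_add, Prod.smul_fst,
        Prod.smul_snd, smul_eq_mul]; ring
    · exact continuous_dot (T.continuous_avgV π _) (T.continuous_jump _ _)
    · exact continuous_dot (T.continuous_avgV ρ _) (T.continuous_jump _ _)
  have h3 : ∀ e : T.Face × T.Face,
      T.faceInt e.1 (fun x => dot (η (T.edge e.1)) (T.jump θ e x) * T.jumpV (π + ρ) e x)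
      = T.faceInt e.1 (fun x => dot (η (T.edge e.1)) (T.jump θ e x) * T.jumpV π e x)
        + T.faceInt e.1 (fun x => dot (η (T.edge e.1)) (T.jump θ e x) * T.jumpV ρ e x) := by
    intro e
    rw [← faceInt_add]
    · congr 1; ext x; simp only [jumpV, evV_add, dot_add_right]; ring
    · exact (continuous_dot continuous_const (T.continuous_jump _ _)).mul (T.continuous_jumpV _ _)
    · exact (continuous_dot continuous_const (T.continuous_jump _ _)).mul (T.continuous_jumpV _ _)
  simp only [liftRhs, h1, h2, h3, Finset.sum_add_distrib]
  ring

theorem liftRhs_smul (T : Triangulation a b c d) (η : Sym2 (ℝ × ℝ) → ℝ × ℝ) (θ : T.PW)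
    (s : ℝ) (π : T.PW × T.PW) : T.liftRhs η θ (s • π) = s * T.liftRhs η θ π := by
  have h1 : ∀ f : T.Face, T.faceInt f (fun x => dot (T.nrm f) (T.evV (s • π) f.1 x) * ev (θ f.1) x)
      = s * T.faceInt f (fun x => dot (T.nrm f) (T.evV π f.1 x) * ev (θ f.1) x) := by
    intro f
    rw [← faceInt_smul]
    congr 1; ext x; rw [evV_smul, dot_smul_right]; ring
  have h2 : ∀ e : T.Face × T.Face,
      T.faceInt e.1 (fun x => dot (T.avgV (s • π) e x) (T.jump θ e x))
      = s * T.faceInt e.1 (fun x => dot (T.avgV π e x) (T.jump θ e x)) := by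
    intro e
    rw [← faceInt_smul]
    congr 1; ext x; simp only [avgV, evV_smul, dot, Prod.fst_add, Prod.snd_add, Prod.smul_fst,
        Prod.smul_snd, smul_eq_mul]; ring
  have h3 : ∀ e : T.Face × T.Face,
      T.faceInt e.1 (fun x => dot (η (T.edge e.1)) (T.jump θ e x) * T.jumpV (s • π) e x)
      = s * T.faceInt e.1 (fun x => dot (η (T.edge e.1)) (T.jump θ e x) * T.jumpV π e x) := by
    intro e
    rw [← faceInt_smul]
    congr 1; ext x; simp only [jumpV, evV_smul, dot_smul_right]; ring
  simp only [liftRhs, h1, h2, h3, ← Finset.mul_sum]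
  ring

theorem innerV_comm (T : Triangulation a b c d) (σ π : T.PW × T.PW) :
    T.innerV σ π = T.innerV π σ := by
  simp only [innerV, dot_comm]

theorem innerV_add (T : Triangulation a b c d) (σ π ρ : T.PW × T.PW) :
    T.innerV σ (π + ρ) = T.innerV σ π + T.innerV σ ρ := by
  unfold innerV
  rw [← Finset.sum_add_distrib]
  refine Finset.sum_congr rfl (fun k _ => ?_)
  rw [← integral_add]
  · simp only [evV_add, dot_add_right]
  · exact (continuous_dot (T.continuous_evV σ k)
      (T.continuous_evV π k)).continuousOn.integrableOn_compact (isCompact_cellOf _)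
  · exact (continuous_dot (T.continuous_evV σ k)
      (T.continuous_evV ρ k)).continuousOn.integrableOn_compact (isCompact_cellOf _)

theorem innerV_smul (T : Triangulation a b c d) (s : ℝ) (σ π : T.PW × T.PW) :
    T.innerV σ (s • π) = s * T.innerV σ π := by
  simp only [innerV, evV_smul, dot_smul_right, integral_const_mul, Finset.mul_sum]

theorem eq_zero_of_innerV_self (T : Triangulation a b c d) (σ : T.PW × T.PW)
    (h : T.innerV σ σ = 0) : σ = 0 := by
  have hn : ∀ k, 0 ≤ ∫ x in cellOf (T.elem k), dot (T.evV σ k x) (T.evV σ k x) := fun k =>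
    integral_nonneg fun x => add_nonneg (mul_self_nonneg _) (mul_self_nonneg _)
  have hz := (Finset.sum_eq_zero_iff_of_nonneg (fun k _ => hn k)).1 h
  have hk : ∀ k, σ.1 k = 0 ∧ σ.2 k = 0 := by
    intro k
    have h1 := hz k (Finset.mem_univ k)
    have i1 : IntegrableOn (fun x => ev (σ.1 k) x ^ 2) (cellOf (T.elem k)) :=
      ((continuous_ev _).pow 2).continuousOn.integrableOn_compact (isCompact_cellOf _)
    have i2 : IntegrableOn (fun x => ev (σ.2 k) x ^ 2) (cellOf (T.elem k)) :=
      ((continuous_ev _).pow 2).continuousOn.integrableOn_compact (isCompact_cellOf _)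
    have e : ∫ x in cellOf (T.elem k), dot (T.evV σ k x) (T.evV σ k x)
        = (∫ x in cellOf (T.elem k), ev (σ.1 k) x ^ 2)
          + ∫ x in cellOf (T.elem k), ev (σ.2 k) x ^ 2 := by
      rw [← integral_add i1 i2]
      simp only [dot, evV, sq]
    have n1 : 0 ≤ ∫ x in cellOf (T.elem k), ev (σ.1 k) x ^ 2 :=
      integral_nonneg fun x => sq_nonneg _
    have n2 : 0 ≤ ∫ x in cellOf (T.elem k), ev (σ.2 k) x ^ 2 :=
      integral_nonneg fun x => sq_nonneg _
    exact ⟨eq_zero_of_integral_sq _ _ (by linarith), eq_zero_of_integral_sq _ _ (by linarith)⟩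
  exact Prod.ext (funext fun k => (hk k).1) (funext fun k => (hk k).2)

theorem surjective_of_injective_dual {W : Type*} [AddCommGroup W] [Module ℝ W] [Module.Finite ℝ W]
    (F : W →ₗ[ℝ] Module.Dual ℝ W) (h : Function.Injective F) : Function.Surjective F :=
  (LinearMap.injective_iff_surjective_of_finrank_eq_finrank Subspace.dual_finrank_eq.symm).1 h

theorem exists_unique_lifting (T : Triangulation a b c d) (N : ℕ)
    (η : Sym2 (ℝ × ℝ) → ℝ × ℝ) (θ : T.PW) :
    ∃! σ : T.PW × T.PW, (σ.1 ∈ T.V N ∧ σ.2 ∈ T.V N) ∧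
      ∀ π : T.PW × T.PW, π.1 ∈ T.V N → π.2 ∈ T.V N → T.innerV σ π = T.liftRhs η θ π := by
  let W : Submodule ℝ (T.PW × T.PW) := (T.V N).prod (T.V N)
  have : Module.Finite ℝ (T.V N) := by
    let φ : T.V N →ₗ[ℝ] (Fin T.K → MvPolynomial.restrictTotalDegree (Fin 2) ℝ N) :=
      { toFun := fun v k => ⟨v.1 k, v.2 k (mem_univ k)⟩
        map_add' := fun _ _ => rfl
        map_smul' := fun _ _ => rfl }
    refine Module.Finite.of_injective φ (fun u v h => ?_)
    apply Subtype.ext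
    funext k
    exact congrArg Subtype.val (congrFun h k)
  have : Module.Finite ℝ W := by
    let ψ : W →ₗ[ℝ] (T.V N) × (T.V N) :=
      { toFun := fun v => (⟨v.1.1, v.2.1⟩, ⟨v.1.2, v.2.2⟩)
        map_add' := fun _ _ => rfl
        map_smul' := fun _ _ => rfl }
    refine Module.Finite.of_injective ψ (fun u v h => ?_)
    exact Subtype.ext (Prod.ext (congrArg (fun z => z.1.1) h) (congrArg (fun z => z.2.1) h))
  let F : W →ₗ[ℝ] Module.Dual ℝ W :=
    LinearMap.mk₂ ℝ (fun σ π => T.innerV σ.1 π.1)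
      (fun x y z => by rw [T.innerV_comm, T.innerV_comm x.1, T.innerV_comm y.1]
                       exact T.innerV_add _ _ _)
      (fun s x z => by rw [T.innerV_comm, T.innerV_comm x.1]; exact T.innerV_smul _ _ _)
      (fun x y z => T.innerV_add _ _ _)
      (fun s x z => T.innerV_smul _ _ _)
  have hinj : Function.Injective F := by
    rw [← LinearMap.ker_eq_bot, LinearMap.ker_eq_bot']
    intro σ hσ
    exact Subtype.ext (T.eq_zero_of_innerV_self σ.1 (LinearMap.congr_fun hσ σ))
  have hsurj : Function.Surjective F := surjective_of_injective_dual F hinj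
  let ℓ : Module.Dual ℝ W :=
    { toFun := fun π => T.liftRhs η θ π.1
      map_add' := fun π ρ => T.liftRhs_add η θ π.1 ρ.1
      map_smul' := fun s π => T.liftRhs_smul η θ s π.1 }
  obtain ⟨σ, hσ⟩ := hsurj ℓ
  refine ⟨σ.1, ⟨σ.2, fun π h1 h2 => LinearMap.congr_fun hσ ⟨π, h1, h2⟩⟩, ?_⟩
  rintro τ ⟨hτ, hτ2⟩
  have : F ⟨τ, hτ⟩ = F σ := by
    rw [hσ]
    ext π
    exact hτ2 π.1 π.2.1 π.2.2
  exact congrArg Subtype.val (hinj this)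

/-- The lifting `L(θ) ∈ V_h × V_h`. -/
def lifting (T : Triangulation a b c d) (N : ℕ) (η : Sym2 (ℝ × ℝ) → ℝ × ℝ) (θ : T.PW) :
    T.PW × T.PW :=
  (T.exists_unique_lifting N η θ).choose

/-! ### The bilinear form and the energy norm -/

/-- The primal bilinear form `B_h`, for the fractional integrals of orders `α₁`, `α₂`, the flux
parameter `η` and the penalty `lam / h`, where `lam` is a number on each edge. -/
def B (T : Triangulation a b c d) (N : ℕ) (α₁ α₂ : ℝ) (η : Sym2 (ℝ × ℝ) → ℝ × ℝ)
    (lam : Sym2 (ℝ × ℝ) → ℝ) (u v : T.PW) : ℝ :=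
  (∫ x in Ioo a b ×ˢ Ioo c d,
    ((fracX a α₁ (T.fn (T.grad u).1) x - fracX a α₁ (T.fn (T.lifting N η u).1) x) *
        (T.fn (T.grad v).1 x - T.fn (T.lifting N η v).1 x)
      + (fracY c α₂ (T.fn (T.grad u).2) x - fracY c α₂ (T.fn (T.lifting N η u).2) x) *
        (T.fn (T.grad v).2 x - T.fn (T.lifting N η v).2 x)))
  + ∑ e ∈ T.internal, T.faceInt e.1
      (fun x => lam (T.edge e.1) / T.hInt e * dot (T.jump u e x) (T.jump v e x))
  + ∑ f ∈ T.external, T.faceInt f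
      (fun x => lam (T.edge f) / T.hExt f * (ev (u f.1) x * ev (v f.1) x))

/-- The energy norm `|||v|||`. -/
def energyNorm (T : Triangulation a b c d) (α₁ α₂ : ℝ) (v : T.PW) : ℝ :=
  Real.sqrt (
    (∫ y in c..d, negSobolevSq (α₁ / 2) (fun x => T.fn (T.grad v).1 (x, y)))
    + (∫ x in a..b, negSobolevSq (α₂ / 2) (fun y => T.fn (T.grad v).2 (x, y)))
    + ∑ e ∈ T.internal, T.faceInt e.1 (fun x => (T.hInt e)⁻¹ * dot (T.jump v e x) (T.jump v e x))
    + ∑ f ∈ T.external, T.faceInt f (fun x => (T.hExt f)⁻¹ * ev (v f.1) x ^ 2))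

end Triangulation

end FracDG

end

/-! Write `w = ∇v - L(v)` for the corrected gradient. Then `B_h(u, v)` is a fractional form in the
corrected gradients of `u` and `v` plus the penalty, and everything rests on two facts.

The fractional form is exactly as strong as the negative norm. On a slice, a piecewise polynomial is
bounded with compact support, and on the interval its left Riemann–Liouville integral is convolution
with `t_+^(μ-1) / Γ(μ)`, whose Fourier symbol is `(iω)^(-μ)`. By Parseval, `∫ f · I^μ g = ∫ conj(f̂)
(iω)^(-μ) ĝ`. The modulus `|ω|^(-μ)` of the symbol gives boundedness by the norms of order `-μ/2`
(`BddSupp.integral_mul_rlConv_le`); its real part `cos(πμ/2) |ω|^(-μ)`, with positive cosine because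
`0 < μ < 1`, gives an identity on the diagonal (`BddSupp.integral_mul_rlConv_self`). The kernel is
not integrable on the line, so the symbol is computed for `e^(-εt)` times the kernel and then `ε →
0`. Fubini carries both facts to the rectangle, and a reflection handles the second variable.

The lifting is controlled by the jumps. Since `μ < 1`, the weight `|ω|^(-μ)` is integrable at the
origin, so on a bounded interval the negative norm is dominated by the `L²` norm
(`integrable_sobolevRoot_sq`). The `L²` norm of `L(v)` is bounded by the jump part of the energy
norm (`Triangulation.exists_lifting_le`): test the defining equation with `L(v)` itself, apply
Young's inequality with weights `h` and `1/h` on each edge, and absorb the resulting traces by an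
inverse trace inequality for polynomials. The latter is finite-dimensional compactness on a
reference domain, affine scaling, and shape regularity, which makes the area comparable to the
squared diameter. Disjointness of the element interiors bounds how often an edge is counted.

Hence `∇v` and `w` differ in the negative norm by at most a multiple of the jumps. Boundedness
follows from Cauchy–Schwarz. Coercivity holds for every positive lower bound of the penalty
parameter, since the fractional form already controls `w` with no loss. -/

noncomputable section

namespace FracDG

/-! ### Laplace transform of a power, Parseval's identity, Cauchy–Schwarz -/

open Filter Topology FourierTransform Complex in
/-- The Laplace transform of `t ^ (μ - 1)` on the right half plane. -/
theorem integral_rpow_mul_cexp {μ : ℝ} (hμ : 0 < μ) {z : ℂ} (hz : 0 < z.re) :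
    ∫ t in Ioi (0 : ℝ), ((t ^ (μ - 1) : ℝ) : ℂ) * Complex.exp (-(z * t)) =
      z ^ (-(μ : ℂ)) * (Real.Gamma μ : ℂ) := by
  let U : Set ℂ := {w | 0 < w.re}
  have hU : IsOpen U := isOpen_lt continuous_const Complex.continuous_re
  have hint : ∀ (ν r : ℝ), 0 < ν → 0 < r →
      IntegrableOn (fun t : ℝ => t ^ (ν - 1) * Real.exp (-(r * t))) (Ioi 0) := by
    intro ν r hν hr
    have := integrableOn_rpow_mul_exp_neg_mul_rpow (p := 1) (s := ν - 1) (b := r)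
      (by linarith) (by norm_num) hr
    simpa using this
  have hmeas : ∀ (ν : ℝ) (w : ℂ), AEStronglyMeasurable
      (fun t : ℝ => ((t ^ (ν - 1) : ℝ) : ℂ) * Complex.exp (-(w * t)))
        (volume.restrict (Ioi 0)) := by
    intro ν w
    exact (by fun_prop : Measurable (fun t : ℝ => ((t ^ (ν - 1) : ℝ) : ℂ) *
      Complex.exp (-(w * t)))).aestronglyMeasurable
  have hnorm : ∀ (ν : ℝ) (w : ℂ) (t : ℝ), 0 < t →
      ‖((t ^ (ν - 1) : ℝ) : ℂ) * Complex.exp (-(w * t))‖ =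
        t ^ (ν - 1) * Real.exp (-(w.re * t)) := by
    intro ν w t ht
    rw [norm_mul, Complex.norm_real, Complex.norm_exp, Real.norm_of_nonneg (by positivity)]
    simp
  have hd : DifferentiableOn ℂ (fun w : ℂ => ∫ t in Ioi (0 : ℝ),
      ((t ^ (μ - 1) : ℝ) : ℂ) * Complex.exp (-(w * t))) U := by
    intro w hw
    have hw' : 0 < w.re := hw
    -- On this neighbourhood the real part stays above `w.re / 2`, so one integrable function
    -- dominates all the differentiated integrands.
    have hs : {x : ℂ | w.re / 2 < x.re} ∈ 𝓝 w :=
      (isOpen_lt continuous_const Complex.continuous_re).mem_nhds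
        (show w.re / 2 < w.re by linarith)
    have := hasDerivAt_integral_of_dominated_loc_of_deriv_le (𝕜 := ℂ)
      (μ := volume.restrict (Ioi (0 : ℝ)))
      (F := fun w t => ((t ^ (μ - 1) : ℝ) : ℂ) * Complex.exp (-(w * t)))
      (F' := fun w t => ((t ^ (μ - 1) : ℝ) : ℂ) * (Complex.exp (-(w * t)) * (-(t : ℂ))))
      (bound := fun t => t ^ ((μ + 1) - 1) * Real.exp (-(w.re / 2 * t)))
      (x₀ := w) hs (Eventually.of_forall fun x => hmeas μ x)
      ((hint μ w.re hμ hw').mono' (hmeas μ w)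
        ((ae_restrict_iff' measurableSet_Ioi).2 (Eventually.of_forall fun t ht =>
          (hnorm μ w t ht).le)))
      (by
        exact (by fun_prop : Measurable (fun t : ℝ => ((t ^ (μ - 1) : ℝ) : ℂ) *
          (Complex.exp (-(w * t)) * (-(t : ℂ))))).aestronglyMeasurable)
      ((ae_restrict_iff' measurableSet_Ioi).2 (Eventually.of_forall fun t ht x hx => by
        have ht' : 0 < t := ht
        have hx' : w.re / 2 < x.re := hx
        rw [← mul_assoc, norm_mul, hnorm μ x t ht, norm_neg, Complex.norm_real,
          Real.norm_of_nonneg ht'.le, mul_right_comm]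
        have : t ^ (μ - 1) * t = t ^ ((μ + 1) - 1) := by
          rw [← Real.rpow_add_one ht'.ne']; ring_nf
        rw [this]
        gcongr))
      (hint (μ + 1) (w.re / 2) (by linarith) (by linarith))
      (Eventually.of_forall fun t x _ => by
        refine HasDerivAt.const_mul _ ?_
        have h1 : HasDerivAt (fun y : ℂ => -(y * t)) (-(t : ℂ)) x := by
          simpa using ((hasDerivAt_id x).mul_const (t : ℂ)).fun_neg
        exact h1.cexp)
    exact this.2.differentiableAt.differentiableWithinAt
  have hd2 : DifferentiableOn ℂ (fun w : ℂ => w ^ (-(μ : ℂ)) * (Real.Gamma μ : ℂ)) U := by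
    intro w hw
    refine DifferentiableAt.differentiableWithinAt ?_
    refine DifferentiableAt.mul_const ?_ _
    exact DifferentiableAt.cpow differentiableAt_id (differentiableAt_const _) (Or.inl hw)
  have hUc : IsPreconnected U := (convex_halfSpace_re_gt 0).isPreconnected
  have h1 : (1 : ℂ) ∈ U := by simp [U]
  -- Identity theorem: both sides are holomorphic on the half plane and agree on the positive reals,
  -- in particular at the points `1 + 1/(n+1)`, which accumulate at `1`.
  have heq := (hd.analyticOnNhd hU).eqOn_of_preconnected_of_frequently_eq
    (hd2.analyticOnNhd hU) hUc h1 ?_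
  · exact heq hz
  have hreal : ∀ r : ℝ, 0 < r → (∫ t in Ioi (0 : ℝ),
      ((t ^ (μ - 1) : ℝ) : ℂ) * Complex.exp (-((r : ℂ) * t))) =
        (r : ℂ) ^ (-(μ : ℂ)) * (Real.Gamma μ : ℂ) := by
    intro r hr
    have h := Real.integral_rpow_mul_exp_neg_mul_Ioi hμ hr
    have h' := congrArg (fun x : ℝ => (x : ℂ)) h
    simp only [← integral_complex_ofReal] at h'
    rw [show (fun t : ℝ => ((t ^ (μ - 1) : ℝ) : ℂ) * Complex.exp (-((r : ℂ) * t))) =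
      fun t : ℝ => ((t ^ (μ - 1) * Real.exp (-(r * t)) : ℝ) : ℂ) by
        ext t; push_cast; rfl]
    rw [h']
    push_cast
    rw [Complex.ofReal_cpow (by positivity), Complex.cpow_neg]
    push_cast
    rw [one_div, Complex.inv_cpow]
    rw [Complex.arg_ofReal_of_nonneg hr.le]
    exact Real.pi_pos.ne
  have hseq : Tendsto (fun n : ℕ => ((1 + 1 / ((n : ℝ) + 1) : ℝ) : ℂ)) atTop (𝓝[≠] 1) := by
    refine tendsto_nhdsWithin_iff.2 ⟨?_, Eventually.of_forall fun n => ?_⟩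
    · have : Tendsto (fun n : ℕ => 1 + 1 / ((n : ℝ) + 1)) atTop (𝓝 (1 + 0)) :=
        tendsto_const_nhds.add tendsto_one_div_add_atTop_nhds_zero_nat
      rw [add_zero] at this
      exact (Complex.continuous_ofReal.tendsto 1).comp this
    · simp only [mem_compl_iff, mem_singleton_iff]
      intro h
      have : (1 + 1 / ((n : ℝ) + 1) : ℝ) = 1 := by exact_mod_cast h
      have h2 : (0 : ℝ) < 1 / ((n : ℝ) + 1) := by positivity
      linarith
  exact hseq.frequently (Eventually.of_forall fun n => hreal _ (by positivity)).frequently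

open Filter Topology FourierTransform SchwartzMap in
/-- On integrable square integrable functions the `L²` Fourier transform is the integral one. -/
theorem coeFn_fourier_toLp {f : ℝ → ℂ} (h1 : Integrable f) (h2 : MemLp f 2) :
    ((𝓕 (h2.toLp f) : Lp ℂ 2 (volume : Measure ℝ)) : ℝ → ℂ) =ᵐ[volume] 𝓕 f := by
  have hc : Continuous (𝓕 f) :=
    VectorFourier.fourierIntegral_continuous Real.continuous_fourierChar
      (by exact continuous_inner) h1
  -- Both transforms are tested against a smooth compactly supported function. The `L²` transform is
  -- moved onto the test function as a tempered distribution, the integral one by Fubini, and both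
  -- give the same pairing with `f`.
  refine ae_eq_of_integral_contDiff_smul_eq
    ((Lp.memLp _).locallyIntegrable (by norm_num)) hc.locallyIntegrable ?_
  intro g g_smooth g_cpt
  have hg₁ : HasCompactSupport (Complex.ofRealCLM ∘ g) := g_cpt.comp_left rfl
  have hg₂ : ContDiff ℝ (⊤ : ℕ∞) (Complex.ofRealCLM ∘ g) := by fun_prop
  let G : 𝓢(ℝ, ℂ) := hg₁.toSchwartzMap hg₂
  have e1 := congrArg (fun T => T G) (Lp.fourier_toTemperedDistribution_eq (h2.toLp f))
  simp only [TemperedDistribution.fourier_apply, Lp.toTemperedDistribution_apply] at e1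
  have e2 : ∫ x, (𝓕 G : 𝓢(ℝ, ℂ)) x • (h2.toLp f) x = ∫ x, (𝓕 G : 𝓢(ℝ, ℂ)) x • f x := by
    refine integral_congr_ae ?_
    filter_upwards [h2.coeFn_toLp] with x hx
    rw [hx]
  have e3 := VectorFourier.integral_fourierIntegral_smul_eq_flip (L := innerₗ ℝ)
    (μ := volume) (ν := volume) Real.continuous_fourierChar continuous_inner
    G.integrable h1
  rw [e2] at e1
  have e4 : ∫ x, (𝓕 G : 𝓢(ℝ, ℂ)) x • f x = ∫ x, G x • 𝓕 f x := by
    rw [SchwartzMap.fourier_coe]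
    simpa using! e3
  rw [e4] at e1
  have : ∀ F : ℝ → ℂ, (∫ x, g x • F x) = ∫ x, G x • F x := by
    intro F
    rfl
  rw [this, this, e1]

open FourierTransform in
/-- Parseval's identity. -/
theorem integral_conj_fourier_mul {f g : ℝ → ℂ} (hf : Integrable f) (hf2 : MemLp f 2)
    (hg : Integrable g) (hg2 : MemLp g 2) :
    ∫ ξ, (starRingEnd ℂ) (𝓕 f ξ) * 𝓕 g ξ = ∫ x, (starRingEnd ℂ) (f x) * g x := by
  have h := Lp.inner_fourier_eq (hf2.toLp f) (hg2.toLp g)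
  rw [L2.inner_def, L2.inner_def] at h
  simp only [RCLike.inner_apply] at h
  have e1 : ∫ x, (𝓕 (hg2.toLp g) : Lp ℂ 2 (volume : Measure ℝ)) x *
      (starRingEnd ℂ) ((𝓕 (hf2.toLp f) : Lp ℂ 2 (volume : Measure ℝ)) x) =
      ∫ ξ, (starRingEnd ℂ) (𝓕 f ξ) * 𝓕 g ξ := by
    refine integral_congr_ae ?_
    filter_upwards [coeFn_fourier_toLp hf hf2, coeFn_fourier_toLp hg hg2] with x h1 h2
    rw [h1, h2, mul_comm]
  have e2 : ∫ x, (hg2.toLp g) x * (starRingEnd ℂ) ((hf2.toLp f) x) =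
      ∫ x, (starRingEnd ℂ) (f x) * g x := by
    refine integral_congr_ae ?_
    filter_upwards [hf2.coeFn_toLp, hg2.coeFn_toLp] with x h1 h2
    rw [h1, h2, mul_comm]
  rw [← e1, ← e2, h]

/-- The Cauchy–Schwarz inequality for integrals. -/
theorem abs_integral_mul_le_sqrt {X : Type*} [MeasurableSpace X] {μ : Measure X} {u v : X → ℝ}
    (hu : AEStronglyMeasurable u μ) (hv : AEStronglyMeasurable v μ)
    (hu2 : Integrable (fun x => u x ^ 2) μ) (hv2 : Integrable (fun x => v x ^ 2) μ) :
    |∫ x, u x * v x ∂μ| ≤ Real.sqrt (∫ x, u x ^ 2 ∂μ) * Real.sqrt (∫ x, v x ^ 2 ∂μ) := by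
  have h := integral_mul_norm_le_Lp_mul_Lq (μ := μ) (f := u) (g := v) Real.HolderConjugate.two_two
    (by simpa using (memLp_two_iff_integrable_sq hu).2 hu2)
    (by simpa using (memLp_two_iff_integrable_sq hv).2 hv2)
  simp only [Real.norm_eq_abs, Real.rpow_two, sq_abs, ← Real.sqrt_eq_rpow] at h
  refine le_trans ?_ h
  refine (norm_integral_le_integral_norm (fun x => u x * v x)).trans (le_of_eq ?_)
  simp

/-! ### The Riemann–Liouville integral as a convolution -/

/-- Bounded measurable functions on the line that vanish outside `[a, b]`. -/
structure BddSupp (a b : ℝ) (g : ℝ → ℝ) : Prop where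
  meas : Measurable g
  bdd : ∃ C, ∀ x, |g x| ≤ C
  supp : ∀ x, x ∉ Icc a b → g x = 0

/-- The convolution kernel of the Riemann–Liouville integral. -/
def rlKernel (μ t : ℝ) : ℝ := if 0 < t then t ^ (μ - 1) / Real.Gamma μ else 0

/-- The exponentially damped kernel of the Riemann–Liouville integral. -/
def rlKernelDamped (μ ε t : ℝ) : ℝ := rlKernel μ t * Real.exp (-(ε * t))

/-- The Riemann–Liouville integral over a half line, as a convolution. -/
def rlConv (μ : ℝ) (g : ℝ → ℝ) (x : ℝ) : ℝ := ∫ t, rlKernel μ t * g (x - t)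

theorem measurable_rlKernel (μ : ℝ) : Measurable (rlKernel μ) :=
  Measurable.ite measurableSet_Ioi (by fun_prop) measurable_const

theorem rlKernel_nonneg {μ : ℝ} (hμ : 0 < μ) (t : ℝ) : 0 ≤ rlKernel μ t := by
  unfold rlKernel
  split_ifs
  · have := Real.Gamma_pos_of_pos hμ
    positivity
  · exact le_rfl

theorem rlKernel_eq_indicator (μ : ℝ) :
    rlKernel μ = (Ioi 0).indicator (fun t => t ^ (μ - 1) / Real.Gamma μ) := by
  ext t; simp [rlKernel, indicator_apply]

theorem integrableOn_rlKernel {μ : ℝ} (hμ : 0 < μ) (R : ℝ) :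
    IntegrableOn (rlKernel μ) (Iic R) := by
  have h : IntegrableOn (fun t : ℝ => t ^ (μ - 1) / Real.Gamma μ) (Ioc 0 R) := by
    rcases le_or_gt R 0 with h | h
    · simp [Ioc_eq_empty_of_le h]
    · have := (intervalIntegral.intervalIntegrable_rpow' (a := 0) (b := R) (r := μ - 1)
        (by linarith)).1
      exact this.div_const _
  rw [rlKernel_eq_indicator, IntegrableOn, integrable_indicator_iff measurableSet_Ioi,
    IntegrableOn, Measure.restrict_restrict measurableSet_Ioi]
  exact h

theorem abs_rlKernelDamped_le {μ ε : ℝ} (hε : 0 ≤ ε) (t : ℝ) :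
    |rlKernelDamped μ ε t| ≤ |rlKernel μ t| := by
  rw [rlKernelDamped, abs_mul, Real.abs_exp]
  by_cases ht : 0 < t
  · refine mul_le_of_le_one_right (abs_nonneg _) (Real.exp_le_one_iff.2 ?_)
    have : 0 ≤ ε * t := by positivity
    linarith
  · simp [rlKernel, ht]

theorem integrable_rlKernelDamped {μ ε : ℝ} (hμ : 0 < μ) (hε : 0 < ε) :
    Integrable (rlKernelDamped μ ε) := by
  have h : IntegrableOn (fun t : ℝ => t ^ (μ - 1) / Real.Gamma μ * Real.exp (-(ε * t)))
      (Ioi 0) := by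
    have := (integrableOn_rpow_mul_exp_neg_mul_rpow (p := 1) (s := μ - 1) (b := ε)
      (by linarith) (by norm_num) hε).div_const (Real.Gamma μ)
    refine this.congr (Filter.Eventually.of_forall fun t => ?_)
    simp
    ring
  rw [← integrable_indicator_iff measurableSet_Ioi] at h
  refine h.congr (Filter.Eventually.of_forall fun t => ?_)
  simp only [rlKernelDamped, rlKernel, indicator_apply, mem_Ioi]
  split_ifs <;> simp

-- The Fourier integral is the Laplace integral at `z = ε + 2πiξ`; the damping is what puts `z` in
-- the open right half plane.
open FourierTransform in
theorem fourier_rlKernelDamped {μ ε : ℝ} (hμ : 0 < μ) (hε : 0 < ε) (ξ : ℝ) :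
    𝓕 (fun t : ℝ => (rlKernelDamped μ ε t : ℂ)) ξ =
      ((ε : ℂ) + ((2 * Real.pi * ξ : ℝ) : ℂ) * Complex.I) ^ (-(μ : ℂ)) := by
  have hG := Real.Gamma_pos_of_pos hμ
  rw [Real.fourier_real_eq_integral_exp_smul]
  have h := integral_rpow_mul_cexp hμ (z := (ε : ℂ) + ((2 * Real.pi * ξ : ℝ) : ℂ) * Complex.I)
    (by simpa using hε)
  rw [← integral_indicator measurableSet_Ioi] at h
  have hGc : (Real.Gamma μ : ℂ) ≠ 0 := by exact_mod_cast hG.ne'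
  rw [eq_div_of_mul_eq hGc h.symm, ← integral_div]
  congr 1
  ext t
  simp only [rlKernelDamped, rlKernel, indicator_apply, mem_Ioi]
  split_ifs with h0
  · push_cast
    rw [smul_eq_mul, div_mul_eq_mul_div, mul_div_assoc', mul_left_comm, ← Complex.exp_add]
    congr 3
    ring
  · simp

namespace BddSupp

variable {a b : ℝ} {f g : ℝ → ℝ}

theorem nonneg_bound (hg : BddSupp a b g) : ∃ C, 0 ≤ C ∧ ∀ x, |g x| ≤ C := by
  obtain ⟨C, hC⟩ := hg.bdd
  exact ⟨C, (abs_nonneg _).trans (hC 0), hC⟩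

theorem add (hf : BddSupp a b f) (hg : BddSupp a b g) : BddSupp a b (fun x => f x + g x) := by
  obtain ⟨C, hC⟩ := hf.bdd
  obtain ⟨D, hD⟩ := hg.bdd
  refine ⟨hf.meas.add hg.meas, ⟨C + D, fun x => ?_⟩, fun x hx => ?_⟩
  · exact (abs_add_le _ _).trans (add_le_add (hC x) (hD x))
  · simp [hf.supp x hx, hg.supp x hx]

theorem integrable_of_bound {F : ℝ → ℂ} (hF : AEStronglyMeasurable F volume) {C : ℝ}
    (hC : ∀ x, ‖F x‖ ≤ C) (hs : ∀ x, x ∉ Icc a b → F x = 0) : Integrable F := by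
  refine IntegrableOn.integrable_of_forall_notMem_eq_zero (s := Icc a b) ?_ hs
  exact Measure.integrableOn_of_bounded (M := C) (by simp) hF
    (Filter.Eventually.of_forall fun x => hC x)

theorem measurable_ofReal (hg : BddSupp a b g) : Measurable (fun x => (g x : ℂ)) :=
  Complex.measurable_ofReal.comp hg.meas

theorem integrable_ofReal (hg : BddSupp a b g) : Integrable (fun x => (g x : ℂ)) := by
  obtain ⟨C, hC⟩ := hg.bdd
  exact integrable_of_bound (a := a) (b := b) hg.measurable_ofReal.aestronglyMeasurable (C := C)
    (fun x => by simpa using hC x) (fun x hx => by simp [hg.supp x hx])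

theorem integrable (hg : BddSupp a b g) : Integrable g := by
  simpa using hg.integrable_ofReal.re

theorem mul (hf : BddSupp a b f) (hg : BddSupp a b g) : BddSupp a b (fun x => f x * g x) := by
  obtain ⟨C, hC0, hC⟩ := hf.nonneg_bound
  obtain ⟨D, hD⟩ := hg.bdd
  refine ⟨hf.meas.mul hg.meas, ⟨C * D, fun x => ?_⟩, fun x hx => ?_⟩
  · rw [abs_mul]
    exact mul_le_mul (hC x) (hD x) (abs_nonneg _) hC0
  · simp [hf.supp x hx]

theorem integrable_sq (hg : BddSupp a b g) : Integrable (fun x => g x ^ 2) := by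
  simpa [sq] using (hg.mul hg).integrable

theorem memLp_ofReal (hg : BddSupp a b g) : MemLp (fun x => (g x : ℂ)) 2 := by
  rw [memLp_two_iff_integrable_sq_norm hg.measurable_ofReal.aestronglyMeasurable]
  simpa using hg.integrable_sq

theorem comp_sub (hg : BddSupp a b g) (x : ℝ) : BddSupp (x - b) (x - a) (fun t => g (x - t)) := by
  refine ⟨hg.meas.comp (measurable_const.sub measurable_id), ?_, fun t ht => hg.supp _ ?_⟩
  · obtain ⟨C, hC⟩ := hg.bdd
    exact ⟨C, fun t => hC _⟩
  · contrapose! ht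
    exact ⟨by linarith [ht.2], by linarith [ht.1]⟩

theorem integrable_rlKernel_mul (hg : BddSupp a b g) {μ : ℝ} (hμ : 0 < μ) (x : ℝ) :
    Integrable (fun t => rlKernel μ t * g (x - t)) := by
  obtain ⟨C, hC⟩ := hg.bdd
  refine IntegrableOn.integrable_of_forall_notMem_eq_zero (s := Iic (x - a)) ?_ ?_
  · refine Integrable.mul_bdd (c := C) (integrableOn_rlKernel hμ (x - a))
      (hg.comp_sub x).meas.aestronglyMeasurable (Filter.Eventually.of_forall fun t => hC _)
  · intro t ht
    rw [hg.supp (x - t) ?_, mul_zero]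
    intro h
    exact ht (by have := h.1; simp only [mem_Iic]; linarith)

/-- A nonzero value of `g (x - t)` forces `t ≤ x - a ≤ b - a`, so only the locally integrable part
of the kernel is seen. The bound is uniform in `x ≤ b` and serves as a dominating constant. -/
theorem integral_abs_rlKernel_mul_le {C : ℝ} (hg : BddSupp a b g) (hC : ∀ x, |g x| ≤ C) {μ : ℝ}
    (hμ : 0 < μ) {x : ℝ} (hx : x ≤ b) : ∫ t, |rlKernel μ t * g (x - t)| ≤
      C * ∫ t in Iic (b - a), rlKernel μ t := by
  rw [← integral_const_mul, ← integral_indicator measurableSet_Iic]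
  refine integral_mono (hg.integrable_rlKernel_mul hμ x).abs ?_ fun t => ?_
  · exact (integrable_indicator_iff measurableSet_Iic).2
      ((integrableOn_rlKernel hμ _).const_mul _)
  · have hk := rlKernel_nonneg hμ t
    simp only [indicator_apply, mem_Iic, abs_mul, abs_of_nonneg hk]
    split_ifs with h
    · rw [mul_comm C]
      gcongr
      exact hC _
    · rw [hg.supp, abs_zero, mul_zero]
      intro h'
      exact h (by linarith [h'.1])

/-- On the interval, the Riemann–Liouville integral is a convolution. -/
theorem rlIntegral_eq (hg : BddSupp a b g) {μ : ℝ} {x : ℝ} (hx : a ≤ x) :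
    rlIntegral a μ g x = rlConv μ g x := by
  unfold rlIntegral rlConv
  have e : (∫ s in a..x, g s / (x - s) ^ (1 - μ)) =
      ∫ t in (0 : ℝ)..(x - a), g (x - t) / t ^ (1 - μ) := by
    have := intervalIntegral.integral_comp_sub_left (a := a) (b := x)
      (fun t => g (x - t) / t ^ (1 - μ)) x
    simpa using this
  rw [e, intervalIntegral.integral_of_le (by linarith), ← integral_const_mul,
    ← integral_indicator measurableSet_Ioc]
  congr 1
  ext t
  simp only [indicator_apply, mem_Ioc, rlKernel]
  by_cases h0 : 0 < t
  · by_cases h1 : t ≤ x - a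
    · rw [if_pos ⟨h0, h1⟩, if_pos h0, show μ - 1 = -(1 - μ) by ring, Real.rpow_neg h0.le]
      ring
    · rw [if_neg (fun h => h1 h.2), hg.supp (x - t), mul_zero]
      intro h
      exact h1 (by linarith [h.1])
  · rw [if_neg (fun h => h0 h.1), if_neg h0, zero_mul]

theorem tendsto_damped (hg : BddSupp a b g) {μ : ℝ} (hμ : 0 < μ) (x : ℝ) :
    Filter.Tendsto (fun n : ℕ => ∫ t, rlKernelDamped μ (1 / ((n : ℝ) + 1)) t * g (x - t))
      Filter.atTop (nhds (rlConv μ g x)) := by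
  refine tendsto_integral_of_dominated_convergence (fun t => |rlKernel μ t * g (x - t)|) ?_
    (hg.integrable_rlKernel_mul hμ x).abs ?_ ?_
  · intro n
    have h1 := measurable_rlKernel μ
    have h2 := (hg.comp_sub x).meas
    unfold rlKernelDamped
    exact ((h1.mul (by fun_prop)).mul h2).aestronglyMeasurable
  · intro n
    refine Filter.Eventually.of_forall fun t => ?_
    rw [Real.norm_eq_abs, abs_mul, abs_mul]
    refine mul_le_mul_of_nonneg_right ?_ (abs_nonneg _)
    exact abs_rlKernelDamped_le (by positivity) t
  · refine Filter.Eventually.of_forall fun t => ?_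
    have h0 := tendsto_one_div_add_atTop_nhds_zero_nat (𝕜 := ℝ)
    have h1 : Filter.Tendsto (fun n : ℕ => Real.exp (-(1 / ((n : ℝ) + 1) * t))) Filter.atTop
        (nhds (Real.exp (-(0 * t)))) :=
      (Real.continuous_exp.tendsto _).comp (h0.mul_const t).neg
    have h2 := (h1.const_mul (rlKernel μ t)).mul_const (g (x - t))
    simpa [rlKernelDamped] using h2

-- This is Parseval for `f` and the convolution of `g` with the damped kernel; the convolution is
-- integrable and bounded, hence square integrable.
open FourierTransform in
theorem integral_mul_damped (hf : BddSupp a b f) (hg : BddSupp a b g) {μ ε : ℝ} (hμ : 0 < μ)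
    (hε : 0 < ε) :
    ((∫ x, f x * ∫ t, rlKernelDamped μ ε t * g (x - t) : ℝ) : ℂ) =
      ∫ ξ, (starRingEnd ℂ) (𝓕 (fun x : ℝ => (f x : ℂ)) ξ) *
        (((ε : ℂ) + ((2 * Real.pi * ξ : ℝ) : ℂ) * Complex.I) ^ (-(μ : ℂ)) *
          𝓕 (fun x : ℝ => (g x : ℂ)) ξ) := by
  have hk : Integrable (fun t : ℝ => (rlKernelDamped μ ε t : ℂ)) :=
    (integrable_rlKernelDamped hμ hε).ofReal
  set w : ℝ → ℂ := convolution (fun t : ℝ => (rlKernelDamped μ ε t : ℂ)) (fun x : ℝ => (g x : ℂ))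
    (ContinuousLinearMap.mul ℂ ℂ) volume with hw
  have hwe : ∀ x, w x = ((∫ t, rlKernelDamped μ ε t * g (x - t) : ℝ) : ℂ) := by
    intro x
    rw [hw, convolution_def, ← integral_complex_ofReal]
    simp
  have hwi : Integrable w := hk.integrable_convolution _ hg.integrable_ofReal
  obtain ⟨C, hC0, hC⟩ := hg.nonneg_bound
  have hwb : ∀ x, ‖w x‖ ≤ C * ∫ t, |rlKernelDamped μ ε t| := by
    intro x
    rw [hwe, Complex.norm_real, ← integral_const_mul]
    refine norm_integral_le_of_norm_le ((integrable_rlKernelDamped hμ hε).abs.const_mul _)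
      (Filter.Eventually.of_forall fun t => ?_)
    rw [Real.norm_eq_abs, abs_mul, mul_comm C]
    gcongr
    exact hC _
  have hw2 : MemLp w 2 := by
    rw [memLp_two_iff_integrable_sq_norm hwi.1]
    refine (hwi.norm.const_mul (C * ∫ t, |rlKernelDamped μ ε t|)).mono' (hwi.1.norm.pow 2)
      (Filter.Eventually.of_forall fun x => ?_)
    rw [Real.norm_of_nonneg (by positivity), sq]
    exact mul_le_mul_of_nonneg_right (hwb x) (norm_nonneg _)
  have h := integral_conj_fourier_mul hf.integrable_ofReal hf.memLp_ofReal hwi hw2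
  rw [← integral_complex_ofReal]
  simp only [Complex.conj_ofReal] at h
  have e : ∀ ξ, 𝓕 w ξ = ((ε : ℂ) + ((2 * Real.pi * ξ : ℝ) : ℂ) * Complex.I) ^ (-(μ : ℂ)) *
      𝓕 (fun x : ℝ => (g x : ℂ)) ξ := by
    intro ξ
    rw [hw, Real.fourier_mul_convolution_eq hk hg.integrable_ofReal,
      fourier_rlKernelDamped hμ hε]
  simp only [e] at h
  rw [h]
  congr 1
  ext x
  rw [hwe]
  push_cast
  rfl

end BddSupp

/-! ### The Fourier symbol and the norms of negative order -/

section Symbol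

open FourierTransform

/-- The constant in the embedding of `L²(a, b)` in the negative order space. -/
def embConst (a b μ : ℝ) : ℝ :=
  (b - a) * (∫ ξ in Icc (-1 : ℝ) 1, |2 * Real.pi * ξ| ^ (-μ)) + 1

theorem integrableOn_abs_rpow {μ : ℝ} (hμ1 : μ < 1) :
    IntegrableOn (fun ξ : ℝ => |2 * Real.pi * ξ| ^ (-μ)) (Icc (-1) 1) := by
  have h1 : IntegrableOn (fun ξ : ℝ => |ξ| ^ (-μ)) (Icc (-1) 1) := by
    have := (intervalIntegral.intervalIntegrable_rpow' (a := 0) (b := 1) (r := -μ)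
      (by linarith)).1
    have hpos : IntegrableOn (fun ξ : ℝ => |ξ| ^ (-μ)) (Ioc 0 1) :=
      this.congr_fun (fun x hx => by simp [abs_of_pos hx.1]) measurableSet_Ioc
    have hpos' : IntegrableOn (fun ξ : ℝ => |ξ| ^ (-μ)) (Icc 0 1) :=
      (integrableOn_Icc_iff_integrableOn_Ioc (by simp)).2 hpos
    have hneg : IntegrableOn (fun ξ : ℝ => |ξ| ^ (-μ)) (Icc (-1) 0) := by
      have := hpos'.comp_neg
      simpa using this
    rw [← Icc_union_Icc_eq_Icc (b := (0 : ℝ)) (by norm_num) (by norm_num)]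
    exact hneg.union hpos'
  have h2 : (fun ξ : ℝ => |2 * Real.pi * ξ| ^ (-μ)) =
      fun ξ : ℝ => |2 * Real.pi| ^ (-μ) * |ξ| ^ (-μ) := by
    ext ξ
    rw [abs_mul, Real.mul_rpow (abs_nonneg _) (abs_nonneg _)]
  rw [h2]
  exact h1.const_mul _

theorem one_le_embConst {a b μ : ℝ} (hab : a < b) : 1 ≤ embConst a b μ := by
  have : 0 ≤ ∫ ξ in Icc (-1 : ℝ) 1, |2 * Real.pi * ξ| ^ (-μ) :=
    integral_nonneg fun ξ => by positivity
  unfold embConst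
  nlinarith

/-- The square root of the integrand of the negative order norm. -/
def sobolevRoot (μ : ℝ) (g : ℝ → ℝ) (ξ : ℝ) : ℝ :=
  |2 * Real.pi * ξ| ^ (-(μ / 2)) * ‖𝓕 (fun x : ℝ => (g x : ℂ)) ξ‖

theorem rpow_half_sq {x : ℝ} (hx : 0 ≤ x) (μ : ℝ) : (x ^ (-(μ / 2))) ^ 2 = x ^ (-μ) := by
  rw [← Real.rpow_natCast, ← Real.rpow_mul hx]
  congr 1
  push_cast
  ring

theorem sobolevRoot_sq (μ : ℝ) (g : ℝ → ℝ) (ξ : ℝ) :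
    sobolevRoot μ g ξ ^ 2 = |2 * Real.pi * ξ| ^ (-μ) * ‖𝓕 (fun x : ℝ => (g x : ℂ)) ξ‖ ^ 2 := by
  rw [sobolevRoot, mul_pow, rpow_half_sq (abs_nonneg _)]

theorem negSobolevSq_eq (μ : ℝ) (g : ℝ → ℝ) :
    negSobolevSq (μ / 2) g = ∫ ξ, sobolevRoot μ g ξ ^ 2 := by
  simp only [sobolevRoot_sq, negSobolevSq, show 2 * (μ / 2) = μ by ring]

theorem negSobolevSq_nonneg (μ : ℝ) (g : ℝ → ℝ) : 0 ≤ negSobolevSq (μ / 2) g := by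
  rw [negSobolevSq_eq]
  exact integral_nonneg fun ξ => sq_nonneg _

namespace BddSupp

variable {a b : ℝ} {f g : ℝ → ℝ}

theorem continuous_fourier (hg : BddSupp a b g) : Continuous (𝓕 (fun x : ℝ => (g x : ℂ))) :=
  VectorFourier.fourierIntegral_continuous Real.continuous_fourierChar
      (by exact continuous_inner) hg.integrable_ofReal

theorem measurable_sobolevRoot (hg : BddSupp a b g) (μ : ℝ) : Measurable (sobolevRoot μ g) := by
  unfold sobolevRoot
  have := hg.continuous_fourier.measurable.norm
  exact Measurable.mul (by fun_prop) this

theorem integral_fourier_sq (hg : BddSupp a b g) :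
    Integrable (fun ξ => ‖𝓕 (fun x : ℝ => (g x : ℂ)) ξ‖ ^ 2) ∧
      ∫ ξ, ‖𝓕 (fun x : ℝ => (g x : ℂ)) ξ‖ ^ 2 = ∫ x, g x ^ 2 := by
  have h := integral_conj_fourier_mul hg.integrable_ofReal hg.memLp_ofReal
    hg.integrable_ofReal hg.memLp_ofReal
  -- The Parseval identity alone does not give integrability; this comes from the `L²` transform,
  -- which agrees almost everywhere.
  have hm : MemLp (𝓕 (fun x : ℝ => (g x : ℂ))) 2 :=
    (memLp_congr_ae (coeFn_fourier_toLp hg.integrable_ofReal hg.memLp_ofReal)).1 (Lp.memLp _)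
  refine ⟨(memLp_two_iff_integrable_sq_norm hm.1).1 hm, ?_⟩
  apply Complex.ofReal_injective
  rw [← integral_complex_ofReal, ← integral_complex_ofReal]
  convert! h using 3 with x x
  · rw [← Complex.normSq_eq_conj_mul_self, Complex.normSq_eq_norm_sq]
  · rw [Complex.conj_ofReal]; push_cast; ring

/-- The transform is bounded by the `L¹` norm, and Cauchy–Schwarz against the indicator of `[a, b]`
turns this into the `L²` norm. -/
theorem norm_fourier_sq_le (hab : a < b) (hg : BddSupp a b g) (ξ : ℝ) :
    ‖𝓕 (fun x : ℝ => (g x : ℂ)) ξ‖ ^ 2 ≤ (b - a) * ∫ x, g x ^ 2 := by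
  have h1 : ‖𝓕 (fun x : ℝ => (g x : ℂ)) ξ‖ ≤ ∫ x, |g x| := by
    refine (VectorFourier.norm_fourierIntegral_le_integral_norm _ _ _ _ _).trans (le_of_eq ?_)
    simp
  have h2 : ∫ x, |g x| = ∫ x, (Icc a b).indicator 1 x * |g x| := by
    congr 1; ext x
    by_cases hx : x ∈ Icc a b
    · simp [hx]
    · simp [hx, hg.supp x hx]
  have hsq : (fun x => (Icc a b).indicator (1 : ℝ → ℝ) x ^ 2) = (Icc a b).indicator 1 := by
    ext x; by_cases hx : x ∈ Icc a b <;> simp [hx]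
  have h3 := abs_integral_mul_le_sqrt (μ := volume) (u := (Icc a b).indicator 1)
    (v := fun x => |g x|)
    ((measurable_one.indicator measurableSet_Icc).aestronglyMeasurable)
    hg.meas.abs.aestronglyMeasurable
    (by
      rw [hsq, integrable_indicator_iff measurableSet_Icc]
      exact integrableOn_const (by simp) (by simp))
    (by simpa using hg.integrable_sq)
  rw [hsq, ← h2, integral_indicator_one measurableSet_Icc] at h3
  simp only [sq_abs, measureReal_def, Real.volume_Icc] at h3
  rw [ENNReal.toReal_ofReal (by linarith)] at h3
  have h4 := h1.trans ((le_abs_self _).trans h3)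
  have h5 := pow_le_pow_left₀ (norm_nonneg _) h4 2
  rwa [mul_pow, Real.sq_sqrt (by linarith), Real.sq_sqrt (integral_nonneg fun x => sq_nonneg _)]
    at h5

/-- The frequencies are split at `|ξ| = 1`. For low ones the transform is bounded and the weight is
integrable because `μ < 1`; for high ones the weight is at most `1` and Plancherel applies. The two
contributions are the two summands of `embConst`. -/
theorem integrable_sobolevRoot_sq (hab : a < b) (hg : BddSupp a b g) {μ : ℝ} (hμ0 : 0 < μ)
    (hμ1 : μ < 1) : Integrable (fun ξ => sobolevRoot μ g ξ ^ 2) ∧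
      ∫ ξ, sobolevRoot μ g ξ ^ 2 ≤ embConst a b μ * ∫ x, g x ^ 2 := by
  obtain ⟨hi, he⟩ := hg.integral_fourier_sq
  set I := ∫ x, g x ^ 2
  let bnd : ℝ → ℝ := fun ξ => (Icc (-1 : ℝ) 1).indicator
    (fun ξ => |2 * Real.pi * ξ| ^ (-μ) * ((b - a) * I)) ξ +
      ‖𝓕 (fun x : ℝ => (g x : ℂ)) ξ‖ ^ 2
  have hI : Integrable ((Icc (-1 : ℝ) 1).indicator
      (fun ξ => |2 * Real.pi * ξ| ^ (-μ) * ((b - a) * I))) :=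
    (integrable_indicator_iff measurableSet_Icc).2 ((integrableOn_abs_rpow hμ1).mul_const _)
  have hb : Integrable bnd := hI.add hi
  have hle : ∀ ξ, sobolevRoot μ g ξ ^ 2 ≤ bnd ξ := by
    intro ξ
    rw [sobolevRoot_sq]
    simp only [bnd, indicator_apply]
    split_ifs with h
    · have := mul_le_mul_of_nonneg_left (hg.norm_fourier_sq_le hab ξ)
        (show 0 ≤ |2 * Real.pi * ξ| ^ (-μ) by positivity)
      have h2 := sq_nonneg ‖𝓕 (fun x : ℝ => (g x : ℂ)) ξ‖
      linarith
    · rw [zero_add]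
      refine mul_le_of_le_one_left (sq_nonneg _) ?_
      refine Real.rpow_le_one_of_one_le_of_nonpos ?_ (by linarith)
      have h1 : 1 < |ξ| := by
        by_contra! hh
        exact h (abs_le.1 hh)
      rw [abs_mul, abs_of_pos (by positivity : (0 : ℝ) < 2 * Real.pi)]
      nlinarith [Real.pi_gt_three]
  have hint : Integrable (fun ξ => sobolevRoot μ g ξ ^ 2) := by
    refine hb.mono' ((hg.measurable_sobolevRoot μ).pow_const 2).aestronglyMeasurable
      (Filter.Eventually.of_forall fun ξ => ?_)
    rw [Real.norm_of_nonneg (sq_nonneg _)]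
    exact hle ξ
  refine ⟨hint, (integral_mono hint hb hle).trans (le_of_eq ?_)⟩
  simp only [bnd]
  rw [integral_add hI hi, integral_indicator measurableSet_Icc, integral_mul_const, he, embConst]
  ring

theorem norm_symbol (μ ε ξ : ℝ) :
    ‖((ε : ℂ) + ((2 * Real.pi * ξ : ℝ) : ℂ) * Complex.I) ^ (-(μ : ℂ))‖ =
      ‖(ε : ℂ) + ((2 * Real.pi * ξ : ℝ) : ℂ) * Complex.I‖ ^ (-μ) := by
  rw [← Complex.norm_cpow_real]
  push_cast
  rfl

/-- The modulus of `ε + iω` is at least `|ω|` and the exponent is negative. The bound does not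
depend on `ε`, so it dominates the passage `ε → 0` and also covers `ε = 0`. -/
theorem norm_symbol_le {μ : ℝ} (hμ : 0 < μ) (ε : ℝ) {ξ : ℝ} (hξ : ξ ≠ 0) :
    ‖((ε : ℂ) + ((2 * Real.pi * ξ : ℝ) : ℂ) * Complex.I) ^ (-(μ : ℂ))‖ ≤
      |2 * Real.pi * ξ| ^ (-μ) := by
  rw [norm_symbol]
  have h0 : 0 < |2 * Real.pi * ξ| := abs_pos.2 (by
    have := Real.pi_pos
    positivity)
  refine Real.rpow_le_rpow_of_nonpos h0 ?_ (by linarith)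
  have := Complex.abs_im_le_norm ((ε : ℂ) + ((2 * Real.pi * ξ : ℝ) : ℂ) * Complex.I)
  simpa using this

theorem norm_integrand_le {μ : ℝ} (hμ : 0 < μ) (ε : ℝ) {ξ : ℝ} (hξ : ξ ≠ 0) :
    ‖(starRingEnd ℂ) (𝓕 (fun x : ℝ => (f x : ℂ)) ξ) *
        (((ε : ℂ) + ((2 * Real.pi * ξ : ℝ) : ℂ) * Complex.I) ^ (-(μ : ℂ)) *
          𝓕 (fun x : ℝ => (g x : ℂ)) ξ)‖ ≤ sobolevRoot μ f ξ * sobolevRoot μ g ξ := by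
  rw [norm_mul, norm_mul, RCLike.norm_conj]
  calc _ ≤ ‖𝓕 (fun x : ℝ => (f x : ℂ)) ξ‖ * (|2 * Real.pi * ξ| ^ (-μ) *
        ‖𝓕 (fun x : ℝ => (g x : ℂ)) ξ‖) := by
        gcongr
        exact norm_symbol_le hμ ε hξ
    _ = _ := by
        rw [← rpow_half_sq (abs_nonneg _), sobolevRoot, sobolevRoot]
        ring

theorem integrable_sobolevRoot_mul (hab : a < b) (hf : BddSupp a b f) (hg : BddSupp a b g) {μ : ℝ}
    (hμ0 : 0 < μ) (hμ1 : μ < 1) :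
    Integrable (fun ξ => sobolevRoot μ f ξ * sobolevRoot μ g ξ) :=
  ((memLp_two_iff_integrable_sq (hf.measurable_sobolevRoot μ).aestronglyMeasurable).2
    (hf.integrable_sobolevRoot_sq hab hμ0 hμ1).1).integrable_mul
  ((memLp_two_iff_integrable_sq (hg.measurable_sobolevRoot μ).aestronglyMeasurable).2
    (hg.integrable_sobolevRoot_sq hab hμ0 hμ1).1)

/-- The Fourier symbol of the Riemann–Liouville form. -/
theorem integral_mul_rlConv (hab : a < b) (hf : BddSupp a b f) (hg : BddSupp a b g) {μ : ℝ}
    (hμ0 : 0 < μ) (hμ1 : μ < 1) :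
    ((∫ x, f x * rlConv μ g x : ℝ) : ℂ) =
      ∫ ξ, (starRingEnd ℂ) (𝓕 (fun x : ℝ => (f x : ℂ)) ξ) *
        ((((0 : ℝ) : ℂ) + ((2 * Real.pi * ξ : ℝ) : ℂ) * Complex.I) ^ (-(μ : ℂ)) *
          𝓕 (fun x : ℝ => (g x : ℂ)) ξ) := by
  have hne : ∀ᵐ ξ : ℝ, ξ ≠ 0 := by simp [ae_iff]
  obtain ⟨C, hC0, hC⟩ := hg.nonneg_bound
  obtain ⟨D, hD0, hD⟩ := hf.nonneg_bound
  have hR : Filter.Tendsto (fun n : ℕ => ∫ ξ, (starRingEnd ℂ) (𝓕 (fun x : ℝ => (f x : ℂ)) ξ) *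
        ((((1 / ((n : ℝ) + 1) : ℝ) : ℂ) + ((2 * Real.pi * ξ : ℝ) : ℂ) * Complex.I) ^ (-(μ : ℂ)) *
          𝓕 (fun x : ℝ => (g x : ℂ)) ξ)) Filter.atTop
      (nhds (∫ ξ, (starRingEnd ℂ) (𝓕 (fun x : ℝ => (f x : ℂ)) ξ) *
        ((((0 : ℝ) : ℂ) + ((2 * Real.pi * ξ : ℝ) : ℂ) * Complex.I) ^ (-(μ : ℂ)) *
          𝓕 (fun x : ℝ => (g x : ℂ)) ξ))) := by
    refine tendsto_integral_of_dominated_convergence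
      (fun ξ => sobolevRoot μ f ξ * sobolevRoot μ g ξ) (fun n => ?_)
      (hf.integrable_sobolevRoot_mul hab hg hμ0 hμ1) (fun n => ?_) ?_
    · have h1 := hf.continuous_fourier.measurable
      have h2 := hg.continuous_fourier.measurable
      exact ((Complex.continuous_conj.measurable.comp h1).mul
        (Measurable.mul (by fun_prop) h2)).aestronglyMeasurable
    · filter_upwards [hne] with ξ hξ
      exact norm_integrand_le hμ0 _ hξ
    · filter_upwards [hne] with ξ hξ
      refine Filter.Tendsto.const_mul _ (Filter.Tendsto.mul_const _ ?_)
      have h0 : Filter.Tendsto (fun n : ℕ => ((1 / ((n : ℝ) + 1) : ℝ) : ℂ) +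
          ((2 * Real.pi * ξ : ℝ) : ℂ) * Complex.I) Filter.atTop
          (nhds (((0 : ℝ) : ℂ) + ((2 * Real.pi * ξ : ℝ) : ℂ) * Complex.I)) :=
        ((Complex.continuous_ofReal.tendsto 0).comp
          (tendsto_one_div_add_atTop_nhds_zero_nat (𝕜 := ℝ))).add_const _
      -- For `ξ ≠ 0` the limit point `2πiξ` lies off the branch cut of the complex power.
      refine (continuousAt_cpow_const (Or.inr ?_)).tendsto.comp h0
      simp [hξ, Real.pi_ne_zero]
  -- On the physical side the inner integrals are bounded uniformly where `f` does not vanish, so a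
  -- multiple of `|f|` dominates.
  have hL : Filter.Tendsto (fun n : ℕ => ∫ x, f x * ∫ t, rlKernelDamped μ (1 / ((n : ℝ) + 1)) t *
      g (x - t)) Filter.atTop (nhds (∫ x, f x * rlConv μ g x)) := by
    refine tendsto_integral_of_dominated_convergence
      (fun x => |f x| * (C * ∫ t in Iic (b - a), rlKernel μ t)) (fun n => ?_)
      (hf.integrable.abs.mul_const _) (fun n => ?_) ?_
    · refine (hf.meas.stronglyMeasurable.mul ?_).aestronglyMeasurable
      refine StronglyMeasurable.integral_prod_right (f := fun x t =>
        rlKernelDamped μ (1 / ((n : ℝ) + 1)) t * g (x - t)) ?_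
      have h1 := measurable_rlKernel μ
      have h2 := hg.meas
      refine Measurable.stronglyMeasurable ?_
      unfold rlKernelDamped Function.uncurry
      exact ((h1.comp measurable_snd).mul (by fun_prop)).mul
        (h2.comp (measurable_fst.sub measurable_snd))
    · refine Filter.Eventually.of_forall fun x => ?_
      rw [norm_mul, Real.norm_eq_abs, Real.norm_eq_abs]
      by_cases hx : x ∈ Icc a b
      · refine mul_le_mul_of_nonneg_left ?_ (abs_nonneg _)
        refine le_trans ?_ (hg.integral_abs_rlKernel_mul_le hC hμ0 hx.2)
        rw [← Real.norm_eq_abs]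
        refine norm_integral_le_of_norm_le (hg.integrable_rlKernel_mul hμ0 x).abs
          (Filter.Eventually.of_forall fun t => ?_)
        rw [Real.norm_eq_abs, abs_mul, abs_mul]
        refine mul_le_mul_of_nonneg_right ?_ (abs_nonneg _)
        exact abs_rlKernelDamped_le (by positivity) t
      · simp [hf.supp x hx]
    · exact Filter.Eventually.of_forall fun x => (hg.tendsto_damped hμ0 x).const_mul _
  have hL' := (Complex.continuous_ofReal.tendsto _).comp hL
  refine tendsto_nhds_unique hL' (hR.congr fun n => ?_)
  exact (hf.integral_mul_damped hg hμ0 (by positivity)).symm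

theorem integral_mul_rlConv_le (hab : a < b) (hf : BddSupp a b f) (hg : BddSupp a b g) {μ : ℝ}
    (hμ0 : 0 < μ) (hμ1 : μ < 1) :
    |∫ x, f x * rlConv μ g x| ≤
      Real.sqrt (negSobolevSq (μ / 2) f) * Real.sqrt (negSobolevSq (μ / 2) g) := by
  have hne : ∀ᵐ ξ : ℝ, ξ ≠ 0 := by simp [ae_iff]
  rw [negSobolevSq_eq, negSobolevSq_eq, ← Real.norm_eq_abs, ← Complex.norm_real,
    hf.integral_mul_rlConv hab hg hμ0 hμ1]
  refine (norm_integral_le_of_norm_le (G := ℂ)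
    (hf.integrable_sobolevRoot_mul hab hg hμ0 hμ1) ?_).trans
    ((le_abs_self _).trans (abs_integral_mul_le_sqrt
      (hf.measurable_sobolevRoot μ).aestronglyMeasurable
      (hg.measurable_sobolevRoot μ).aestronglyMeasurable
      (hf.integrable_sobolevRoot_sq hab hμ0 hμ1).1 (hg.integrable_sobolevRoot_sq hab hμ0 hμ1).1))
  filter_upwards [hne] with ξ hξ
  exact norm_integrand_le hμ0 _ hξ

/-- On the diagonal the integrand is `(iω)^(-μ) |ĝ|²`. The argument of `iω` is `±π/2`, and as the
cosine is even, the real part of the symbol is `cos(πμ/2) |ω|^(-μ)` for both signs; the left side is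
real, so nothing else contributes. -/
theorem integral_mul_rlConv_self (hab : a < b) (hg : BddSupp a b g) {μ : ℝ}
    (hμ0 : 0 < μ) (hμ1 : μ < 1) :
    ∫ x, g x * rlConv μ g x = Real.cos (Real.pi * μ / 2) * negSobolevSq (μ / 2) g := by
  have hne : ∀ᵐ ξ : ℝ, ξ ≠ 0 := by simp [ae_iff]
  have h := hg.integral_mul_rlConv hab hg hμ0 hμ1
  have hint : Integrable (fun ξ => (starRingEnd ℂ) (𝓕 (fun x : ℝ => (g x : ℂ)) ξ) *
        ((((0 : ℝ) : ℂ) + ((2 * Real.pi * ξ : ℝ) : ℂ) * Complex.I) ^ (-(μ : ℂ)) *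
          𝓕 (fun x : ℝ => (g x : ℂ)) ξ)) := by
    refine (hg.integrable_sobolevRoot_mul hab hg hμ0 hμ1).mono' ?_ ?_
    · have h1 := hg.continuous_fourier.measurable
      exact ((Complex.continuous_conj.measurable.comp h1).mul
        (Measurable.mul (by fun_prop) h1)).aestronglyMeasurable
    · filter_upwards [hne] with ξ hξ
      exact norm_integrand_le hμ0 _ hξ
  have h2 := congrArg Complex.re h
  rw [Complex.ofReal_re] at h2
  have h3 := integral_re (𝕜 := ℂ) hint
  rw [h2, negSobolevSq_eq, ← integral_const_mul]
  refine Eq.trans h3.symm (integral_congr_ae ?_)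
  filter_upwards [hne] with ξ hξ
  rw [sobolevRoot_sq]
  set z := 𝓕 (fun x : ℝ => (g x : ℂ)) ξ
  have e : (starRingEnd ℂ) z * ((((0 : ℝ) : ℂ) + ((2 * Real.pi * ξ : ℝ) : ℂ) * Complex.I) ^
      (-(μ : ℂ)) * z) = ((‖z‖ ^ 2 : ℝ) : ℂ) *
        (((2 * Real.pi * ξ : ℝ) : ℂ) * Complex.I) ^ ((-μ : ℝ) : ℂ) := by
    rw [mul_left_comm, ← Complex.normSq_eq_conj_mul_self, Complex.normSq_eq_norm_sq, mul_comm]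
    simp
  rw [e]
  simp only [RCLike.re_to_complex]
  rw [Complex.re_ofReal_mul, Complex.cpow_ofReal_re]
  have h4 : Real.cos ((((2 * Real.pi * ξ : ℝ) : ℂ) * Complex.I).arg * -μ) =
      Real.cos (Real.pi * μ / 2) := by
    rcases lt_or_gt_of_ne hξ with hneg | hpos
    · have hn : 2 * Real.pi * ξ < 0 := mul_neg_of_pos_of_neg Real.two_pi_pos hneg
      rw [Complex.arg_eq_neg_pi_div_two_iff.2 ⟨by simp, by simpa using hn⟩]
      congr 1
      ring
    · have hn : 0 < 2 * Real.pi * ξ := mul_pos Real.two_pi_pos hpos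
      rw [Complex.arg_eq_pi_div_two_iff.2 ⟨by simp, by simpa using hn⟩, ← Real.cos_neg]
      congr 1
      ring
  rw [h4, norm_mul, Complex.norm_I, mul_one, Complex.norm_real, Real.norm_eq_abs]
  ring

theorem negSobolevSq_add_le (hab : a < b) (hf : BddSupp a b f) (hg : BddSupp a b g) {μ : ℝ}
    (hμ0 : 0 < μ) (hμ1 : μ < 1) : negSobolevSq (μ / 2) (fun x => f x + g x) ≤
      2 * negSobolevSq (μ / 2) f + 2 * negSobolevSq (μ / 2) g := by
  have h1 := hf.integrable_sobolevRoot_sq hab hμ0 hμ1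
  have h2 := hg.integrable_sobolevRoot_sq hab hμ0 hμ1
  simp only [negSobolevSq_eq]
  rw [← integral_const_mul, ← integral_const_mul, ← integral_add (h1.1.const_mul _)
    (h2.1.const_mul _)]
  refine integral_mono ((hf.add hg).integrable_sobolevRoot_sq hab hμ0 hμ1).1
    ((h1.1.const_mul _).add (h2.1.const_mul _)) fun ξ => ?_
  have e : 𝓕 (fun x : ℝ => ((f x + g x : ℝ) : ℂ)) ξ =
      𝓕 (fun x : ℝ => (f x : ℂ)) ξ + 𝓕 (fun x : ℝ => (g x : ℂ)) ξ := by
    have := VectorFourier.fourierIntegral_add Real.continuous_fourierChar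
      (by exact continuous_inner) hf.integrable_ofReal hg.integrable_ofReal (L := innerₗ ℝ)
    have := congrFun this ξ
    simpa using! this
  simp only [sobolevRoot_sq, e]
  have h3 : 0 ≤ |2 * Real.pi * ξ| ^ (-μ) := by positivity
  have h4 := norm_add_le (𝓕 (fun x : ℝ => (f x : ℂ)) ξ) (𝓕 (fun x : ℝ => (g x : ℂ)) ξ)
  have h5 := pow_le_pow_left₀ (norm_nonneg _) h4 2
  have h6 := mul_le_mul_of_nonneg_left (h5.trans add_sq_le) h3
  linarith

end BddSupp

end Symbol

/-! ### From the line to the rectangle, slice by slice -/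

/-- Bounded measurable functions on the plane that vanish outside a rectangle. -/
structure BddSupp₂ (a b c d : ℝ) (G : ℝ × ℝ → ℝ) : Prop where
  meas : Measurable G
  bdd : ∃ C, ∀ x, |G x| ≤ C
  supp : ∀ x, x ∉ Icc a b ×ˢ Icc c d → G x = 0

/-- The square of the norm of order `-μ / 2` in the first variable. -/
def slabSq (c d μ : ℝ) (G : ℝ × ℝ → ℝ) : ℝ :=
  ∫ y in c..d, negSobolevSq (μ / 2) (fun x => G (x, y))

theorem slabSq_eq {c d : ℝ} (hcd : c < d) (μ : ℝ) (G : ℝ × ℝ → ℝ) :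
    slabSq c d μ G = ∫ y in Ioo c d, negSobolevSq (μ / 2) (fun x => G (x, y)) := by
  rw [slabSq, intervalIntegral.integral_of_le hcd.le, integral_Ioc_eq_integral_Ioo]

theorem slabSq_nonneg {c d : ℝ} (hcd : c < d) (μ : ℝ) (G : ℝ × ℝ → ℝ) : 0 ≤ slabSq c d μ G := by
  rw [slabSq_eq hcd]
  exact integral_nonneg fun y => negSobolevSq_nonneg _ _

namespace BddSupp₂

variable {a b c d : ℝ} {F G H : ℝ × ℝ → ℝ}

theorem swap (hG : BddSupp₂ a b c d G) : BddSupp₂ c d a b (fun x => G x.swap) := by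
  obtain ⟨C, hC⟩ := hG.bdd
  exact ⟨hG.meas.comp measurable_swap, ⟨C, fun x => hC _⟩, fun x hx => hG.supp _
    (fun h => hx ⟨h.2, h.1⟩)⟩

theorem slice (hG : BddSupp₂ a b c d G) (y : ℝ) : BddSupp a b (fun x => G (x, y)) := by
  obtain ⟨C, hC⟩ := hG.bdd
  exact ⟨hG.meas.comp (measurable_id.prodMk measurable_const), ⟨C, fun x => hC _⟩,
    fun x hx => hG.supp _ (fun h => hx h.1)⟩

theorem add (hF : BddSupp₂ a b c d F) (hG : BddSupp₂ a b c d G) :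
    BddSupp₂ a b c d (fun x => F x + G x) := by
  obtain ⟨C, hC⟩ := hF.bdd
  obtain ⟨D, hD⟩ := hG.bdd
  refine ⟨hF.meas.add hG.meas, ⟨C + D, fun x => ?_⟩, fun x hx => ?_⟩
  · exact (abs_add_le _ _).trans (add_le_add (hC x) (hD x))
  · simp [hF.supp x hx, hG.supp x hx]

theorem integrable_sq (hG : BddSupp₂ a b c d G) : Integrable (fun x => G x ^ 2) := by
  obtain ⟨C, hC⟩ := hG.bdd
  refine IntegrableOn.integrable_of_forall_notMem_eq_zero (s := Icc a b ×ˢ Icc c d) ?_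
    (fun x hx => by simp [hG.supp x hx])
  refine Measure.integrableOn_of_bounded (M := C ^ 2) ?_
    (hG.meas.pow_const 2).aestronglyMeasurable (Filter.Eventually.of_forall fun x => ?_)
  · exact (isCompact_Icc.prod isCompact_Icc).measure_lt_top.ne
  · rw [norm_pow, Real.norm_eq_abs]
    exact pow_le_pow_left₀ (abs_nonneg _) (hC x) 2

open FourierTransform in
theorem measurable_negSobolevSq (hG : BddSupp₂ a b c d G) (μ : ℝ) :
    Measurable (fun y => negSobolevSq (μ / 2) (fun x => G (x, y))) := by
  unfold negSobolevSq
  refine (StronglyMeasurable.integral_prod_right (f := fun y ξ =>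
    |2 * Real.pi * ξ| ^ (-(2 * (μ / 2))) * ‖𝓕 (fun x : ℝ => (G (x, y) : ℂ)) ξ‖ ^ 2)
    ?_).measurable
  have h1 : StronglyMeasurable (fun p : ℝ × ℝ =>
      𝓕 (fun x : ℝ => (G (x, p.1) : ℂ)) p.2) := by
    simp only [Real.fourier_real_eq_integral_exp_smul]
    refine StronglyMeasurable.integral_prod_right (f := fun (p : ℝ × ℝ) (x : ℝ) =>
      Complex.exp (((-2 * Real.pi * x * p.2 : ℝ) : ℂ) * Complex.I) • (G (x, p.1) : ℂ)) ?_
    refine Measurable.stronglyMeasurable ?_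
    unfold Function.uncurry
    have h2 : Measurable (fun p : (ℝ × ℝ) × ℝ =>
      Complex.exp (((-2 * Real.pi * p.2 * p.1.2 : ℝ) : ℂ) * Complex.I)) := by fun_prop
    have h3 : Measurable (fun p : (ℝ × ℝ) × ℝ => (p.2, p.1.1)) := by fun_prop
    exact h2.smul (Complex.measurable_ofReal.comp (hG.meas.comp h3))
  refine Measurable.stronglyMeasurable ?_
  unfold Function.uncurry
  exact Measurable.mul (by fun_prop) (h1.measurable.norm.pow_const 2)

theorem negSobolevSq_slice_le (hab : a < b) (hG : BddSupp₂ a b c d G) {μ : ℝ} (hμ0 : 0 < μ)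
    (hμ1 : μ < 1) (y : ℝ) : negSobolevSq (μ / 2) (fun x => G (x, y)) ≤
      embConst a b μ * ∫ x, G (x, y) ^ 2 := by
  rw [negSobolevSq_eq]
  exact ((hG.slice y).integrable_sobolevRoot_sq hab hμ0 hμ1).2

theorem integrable_negSobolevSq (hab : a < b) (hG : BddSupp₂ a b c d G) {μ : ℝ} (hμ0 : 0 < μ)
    (hμ1 : μ < 1) : Integrable (fun y => negSobolevSq (μ / 2) (fun x => G (x, y))) := by
  have h := hG.integrable_sq
  refine (h.integral_prod_right.const_mul (embConst a b μ)).mono'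
    (hG.measurable_negSobolevSq μ).aestronglyMeasurable (Filter.Eventually.of_forall fun y => ?_)
  rw [Real.norm_of_nonneg (negSobolevSq_nonneg _ _)]
  exact hG.negSobolevSq_slice_le hab hμ0 hμ1 y

theorem slabSq_le (hab : a < b) (hcd : c < d) (hG : BddSupp₂ a b c d G) {μ : ℝ} (hμ0 : 0 < μ)
    (hμ1 : μ < 1) : slabSq c d μ G ≤ embConst a b μ * ∫ x, G x ^ 2 := by
  have h := hG.integrable_sq
  have e : ∫ x, G x ^ 2 = ∫ y, ∫ x, G (x, y) ^ 2 := integral_prod_symm _ h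
  rw [slabSq_eq hcd, e, ← integral_const_mul]
  have hi := h.integral_prod_right.const_mul (embConst a b μ)
  refine (integral_mono (hG.integrable_negSobolevSq hab hμ0 hμ1).integrableOn hi.integrableOn
    (fun y => hG.negSobolevSq_slice_le hab hμ0 hμ1 y)).trans ?_
  refine setIntegral_le_integral hi (Filter.Eventually.of_forall fun y => ?_)
  have := one_le_embConst (μ := μ) hab
  exact mul_nonneg (by linarith) (integral_nonneg fun x => sq_nonneg _)

theorem slabSq_add_le (hab : a < b) (hcd : c < d) (hF : BddSupp₂ a b c d F)
    (hG : BddSupp₂ a b c d G) {μ : ℝ} (hμ0 : 0 < μ) (hμ1 : μ < 1) :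
    slabSq c d μ (fun x => F x + G x) ≤ 2 * slabSq c d μ F + 2 * slabSq c d μ G := by
  have h1 := (hF.integrable_negSobolevSq hab hμ0 hμ1).integrableOn (s := Ioo c d)
  have h2 := (hG.integrable_negSobolevSq hab hμ0 hμ1).integrableOn (s := Ioo c d)
  simp only [slabSq_eq hcd]
  rw [← integral_const_mul, ← integral_const_mul, ← integral_add (h1.const_mul _)
    (h2.const_mul _)]
  exact integral_mono ((hF.add hG).integrable_negSobolevSq hab hμ0 hμ1).integrableOn
    ((h1.const_mul _).add (h2.const_mul _))
    fun y => (hF.slice y).negSobolevSq_add_le hab (hG.slice y) hμ0 hμ1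

theorem fracX_eq (hG : BddSupp₂ a b c d G) (μ : ℝ) {z : ℝ × ℝ} (hz : a ≤ z.1) :
    fracX a μ G z = rlConv μ (fun x => G (x, z.2)) z.1 :=
  (hG.slice z.2).rlIntegral_eq hz

theorem fracX_add (hF : BddSupp₂ a b c d F) (hG : BddSupp₂ a b c d G) {μ : ℝ} (hμ : 0 < μ)
    {z : ℝ × ℝ} (hz : a ≤ z.1) :
    fracX a μ (fun x => F x + G x) z = fracX a μ F z + fracX a μ G z := by
  rw [hF.fracX_eq μ hz, hG.fracX_eq μ hz, (hF.add hG).fracX_eq μ hz]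
  unfold rlConv
  rw [← integral_add ((hF.slice _).integrable_rlKernel_mul hμ _)
    ((hG.slice _).integrable_rlKernel_mul hμ _)]
  simp only [mul_add]

theorem measurable_rlConv (hG : BddSupp₂ a b c d G) (μ : ℝ) :
    Measurable (fun z : ℝ × ℝ => rlConv μ (fun x => G (x, z.2)) z.1) := by
  refine (StronglyMeasurable.integral_prod_right (f := fun (z : ℝ × ℝ) (t : ℝ) =>
    rlKernel μ t * G (z.1 - t, z.2)) ?_).measurable
  refine Measurable.stronglyMeasurable ?_
  unfold Function.uncurry
  exact ((measurable_rlKernel μ).comp measurable_snd).mul (hG.meas.comp (by fun_prop))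

/-- The convolution is bounded on the rectangle, although not compactly supported in the plane. This
justifies Fubini and the splitting of the form. -/
theorem integrableOn_rlConv_mul (hF : BddSupp₂ a b c d F) (hG : BddSupp₂ a b c d G)
    {μ : ℝ} (hμ : 0 < μ) :
    IntegrableOn (fun z : ℝ × ℝ => rlConv μ (fun x => G (x, z.2)) z.1 * F z)
      (Ioo a b ×ˢ Ioo c d) := by
  obtain ⟨C, hC⟩ := hG.bdd
  obtain ⟨D, hD⟩ := hF.bdd
  refine IntegrableOn.of_bound (C := (C * ∫ t in Iic (b - a), rlKernel μ t) * D) ?_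
    ((hG.measurable_rlConv μ).mul hF.meas).aestronglyMeasurable ?_
  · refine lt_of_le_of_lt (measure_mono (prod_mono Ioo_subset_Icc_self Ioo_subset_Icc_self)) ?_
    exact (isCompact_Icc.prod isCompact_Icc).measure_lt_top
  · refine (ae_restrict_iff' (measurableSet_Ioo.prod measurableSet_Ioo)).2
      (Filter.Eventually.of_forall fun z hz => ?_)
    have h1 := (hG.slice z.2).integral_abs_rlKernel_mul_le (fun x => hC _) hμ hz.1.2.le
    have h2 := (abs_integral_le_integral_abs (f := fun t => rlKernel μ t * G (z.1 - t, z.2))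
      (μ := volume)).trans h1
    rw [norm_mul, Real.norm_eq_abs, Real.norm_eq_abs]
    exact mul_le_mul h2 (hD _) (abs_nonneg _) ((abs_nonneg _).trans h2)

theorem integrableOn_fracX_mul (hF : BddSupp₂ a b c d F) (hG : BddSupp₂ a b c d G)
    {μ : ℝ} (hμ : 0 < μ) :
    IntegrableOn (fun z : ℝ × ℝ => fracX a μ G z * F z) (Ioo a b ×ˢ Ioo c d) :=
  (hF.integrableOn_rlConv_mul hG hμ).congr_fun
    (fun z hz => by simp only [hG.fracX_eq μ hz.1.1.le])
    (measurableSet_Ioo.prod measurableSet_Ioo)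

/-- Fubini, with `x` innermost. The inner integral may be extended to the whole line, where the
Fourier argument lives, because `F` vanishes outside the rectangle even though the convolution does
not. -/
theorem integral_fracX_mul (hF : BddSupp₂ a b c d F) (hG : BddSupp₂ a b c d G)
    {μ : ℝ} (hμ : 0 < μ) :
    ∫ z in Ioo a b ×ˢ Ioo c d, fracX a μ G z * F z =
      ∫ y in Ioo c d, ∫ x, F (x, y) * rlConv μ (fun x => G (x, y)) x := by
  have h1 := hF.integrableOn_rlConv_mul hG hμ
  have e : ∫ z in Ioo a b ×ˢ Ioo c d, fracX a μ G z * F z =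
      ∫ z in Ioo a b ×ˢ Ioo c d, rlConv μ (fun x => G (x, z.2)) z.1 * F z :=
    setIntegral_congr_fun (measurableSet_Ioo.prod measurableSet_Ioo)
      (fun z hz => by simp only [hG.fracX_eq μ hz.1.1.le])
  rw [IntegrableOn, Measure.volume_eq_prod, ← Measure.prod_restrict] at h1
  rw [e, Measure.volume_eq_prod, ← Measure.prod_restrict, integral_prod_symm _ h1]
  refine integral_congr_ae (Filter.Eventually.of_forall fun y => ?_)
  simp only
  rw [← integral_Icc_eq_integral_Ioo, setIntegral_eq_integral_of_forall_compl_eq_zero]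
  · simp only [mul_comm]
  · intro x hx
    rw [(hF.slice y).supp x hx, mul_zero]

/-- Cauchy–Schwarz is used twice: in frequency on each slice, then in `y` on the square roots of the
slice norms. -/
theorem abs_integral_fracX_mul_le (hab : a < b) (hcd : c < d) (hF : BddSupp₂ a b c d F)
    (hG : BddSupp₂ a b c d G) {μ : ℝ} (hμ0 : 0 < μ) (hμ1 : μ < 1) :
    |∫ z in Ioo a b ×ˢ Ioo c d, fracX a μ G z * F z| ≤
      Real.sqrt (slabSq c d μ G) * Real.sqrt (slabSq c d μ F) := by
  rw [hF.integral_fracX_mul hG hμ0, slabSq_eq hcd, slabSq_eq hcd, mul_comm]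
  have key : ∀ K : ℝ × ℝ → ℝ, BddSupp₂ a b c d K →
      AEStronglyMeasurable (fun y => Real.sqrt (negSobolevSq (μ / 2) (fun x => K (x, y))))
        (volume.restrict (Ioo c d)) ∧
      Integrable (fun y => Real.sqrt (negSobolevSq (μ / 2) (fun x => K (x, y))) ^ 2)
        (volume.restrict (Ioo c d)) ∧
      ∫ y in Ioo c d, Real.sqrt (negSobolevSq (μ / 2) (fun x => K (x, y))) ^ 2 =
        ∫ y in Ioo c d, negSobolevSq (μ / 2) (fun x => K (x, y)) := by
    intro K hK
    have e : ∀ y, Real.sqrt (negSobolevSq (μ / 2) (fun x => K (x, y))) ^ 2 =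
        negSobolevSq (μ / 2) (fun x => K (x, y)) :=
      fun y => Real.sq_sqrt (negSobolevSq_nonneg _ _)
    simp only [e, and_true]
    exact ⟨(hK.measurable_negSobolevSq μ).sqrt.aestronglyMeasurable,
      (hK.integrable_negSobolevSq hab hμ0 hμ1).integrableOn⟩
  obtain ⟨f1, f2, f3⟩ := key F hF
  obtain ⟨g1, g2, g3⟩ := key G hG
  have h := abs_integral_mul_le_sqrt f1 g1 f2 g2
  rw [f3, g3] at h
  refine le_trans ?_ ((le_abs_self _).trans h)
  rw [← Real.norm_eq_abs]
  refine norm_integral_le_of_norm_le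
    (((memLp_two_iff_integrable_sq f1).2 f2).integrable_mul
      ((memLp_two_iff_integrable_sq g1).2 g2)) (Filter.Eventually.of_forall fun y => ?_)
  exact (hF.slice y).integral_mul_rlConv_le hab (hG.slice y) hμ0 hμ1

theorem integral_fracX_mul_self (hab : a < b) (hcd : c < d)
    (hG : BddSupp₂ a b c d G) {μ : ℝ} (hμ0 : 0 < μ) (hμ1 : μ < 1) :
    ∫ z in Ioo a b ×ˢ Ioo c d, fracX a μ G z * G z =
      Real.cos (Real.pi * μ / 2) * slabSq c d μ G := by
  rw [hG.integral_fracX_mul hG hμ0, slabSq_eq hcd, ← integral_const_mul]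
  refine integral_congr_ae (Filter.Eventually.of_forall fun y => ?_)
  exact (hG.slice y).integral_mul_rlConv_self hab hμ0 hμ1

end BddSupp₂

/-- The form in the second variable is the form in the first variable on the reflected
rectangle. -/
theorem integral_fracY_mul (a b c d μ : ℝ) (F G : ℝ × ℝ → ℝ) :
    ∫ z in Ioo a b ×ˢ Ioo c d, fracY c μ G z * F z =
      ∫ z in Ioo c d ×ˢ Ioo a b, fracX c μ (fun x => G x.swap) z * F z.swap := by
  rw [Measure.volume_eq_prod, ← setIntegral_prod_swap]
  rfl

theorem integrableOn_fracY_mul {a b c d μ : ℝ} {F G : ℝ × ℝ → ℝ} (hF : BddSupp₂ a b c d F)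
    (hG : BddSupp₂ a b c d G) (hμ : 0 < μ) :
    IntegrableOn (fun z : ℝ × ℝ => fracY c μ G z * F z) (Ioo a b ×ˢ Ioo c d) := by
  have h := hF.swap.integrableOn_fracX_mul hG.swap hμ
  rw [IntegrableOn, Measure.volume_eq_prod, ← Measure.prod_restrict] at h ⊢
  exact h.swap

/-! ### Polynomial trace inequality on a reference domain and its scaling -/

/-- On a finite-dimensional space every quadratic form is dominated by every positive definite
one. -/
theorem exists_quadratic_domination {W : Type*} [AddCommGroup W] [Module ℝ W] [Module.Finite ℝ W]
    (A B : W →ₗ[ℝ] W →ₗ[ℝ] ℝ) (hB : ∀ v, v ≠ 0 → 0 < B v v) :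
    ∃ C : ℝ, 0 < C ∧ ∀ v, A v v ≤ C * B v v := by
  let b := Module.finBasis ℝ W
  let e := b.equivFun
  have hexp : ∀ (F : W →ₗ[ℝ] W →ₗ[ℝ] ℝ) x, F (e.symm x) (e.symm x) =
      ∑ i, ∑ j, x i * (x j * F (b i) (b j)) := by
    intro F x
    simp only [e, Module.Basis.equivFun_symm_apply, map_sum, LinearMap.sum_apply, map_smul,
      LinearMap.smul_apply, smul_eq_mul, Finset.mul_sum]
    rw [Finset.sum_comm]
    refine Finset.sum_congr rfl fun i _ => Finset.sum_congr rfl fun j _ => ?_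
    ring
  have hcont : ∀ (F : W →ₗ[ℝ] W →ₗ[ℝ] ℝ), Continuous (fun x => F (e.symm x) (e.symm x)) := by
    intro F
    simp only [hexp]
    fun_prop
  have hpos : ∀ x ∈ Metric.sphere (0 : Fin (Module.finrank ℝ W) → ℝ) 1,
      0 < B (e.symm x) (e.symm x) := by
    intro x hx
    refine hB _ fun h => ?_
    have hx0 : x = 0 := by simpa using h
    rw [hx0] at hx
    simp at hx
  -- The quotient of the two forms is continuous on the compact unit sphere of coordinates, hence
  -- bounded there; homogeneity does the rest.
  obtain ⟨C, hC⟩ := (isCompact_sphere (0 : Fin (Module.finrank ℝ W) → ℝ)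
    1).exists_bound_of_continuousOn (f := fun x => A (e.symm x) (e.symm x) / B (e.symm x) (e.symm x))
    ((hcont A).continuousOn.div (hcont B).continuousOn fun x hx => (hpos x hx).ne')
  refine ⟨|C| + 1, by positivity, fun v => ?_⟩
  by_cases hv : v = 0
  · simp [hv]
  have hx : e v ≠ 0 := by simpa using hv
  have hn : 0 < ‖e v‖ := norm_pos_iff.2 hx
  set u := ‖e v‖⁻¹ • e v with hu
  have hus : u ∈ Metric.sphere (0 : Fin (Module.finrank ℝ W) → ℝ) 1 := by
    simp [hu, norm_smul, hn.ne']
  have h1 := hC u hus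
  rw [Real.norm_eq_abs] at h1
  have h2 := (div_le_iff₀ (hpos u hus)).1 ((le_abs_self _).trans
    (h1.trans ((le_abs_self C).trans (by linarith : |C| ≤ |C| + 1))))
  have h3 : e.symm u = ‖e v‖⁻¹ • v := by simp [hu]
  rw [h3] at h2
  simp only [map_smul, LinearMap.smul_apply, smul_eq_mul] at h2
  have h4 : 0 < ‖e v‖⁻¹ * ‖e v‖⁻¹ := by positivity
  refine le_of_mul_le_mul_left ?_ h4
  linarith

/-- The form `∫ p q` on polynomials, for a measure carried to the plane by `φ`. -/
def polyForm {X : Type*} [MeasurableSpace X] (N : ℕ) (ν : Measure X) (φ : X → ℝ × ℝ)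
    (h : ∀ p, Integrable (fun x => ev p (φ x)) ν) :
    MvPolynomial.restrictTotalDegree (Fin 2) ℝ N →ₗ[ℝ]
      MvPolynomial.restrictTotalDegree (Fin 2) ℝ N →ₗ[ℝ] ℝ :=
  have hm : ∀ p q, Integrable (fun x => ev p (φ x) * ev q (φ x)) ν := fun p q => by
    simpa [ev] using h (p * q)
  LinearMap.mk₂ ℝ (fun p q => ∫ x, ev p.1 (φ x) * ev q.1 (φ x) ∂ν)
    (fun p p' q => by
      rw [← integral_add (hm _ _) (hm _ _)]
      simp [ev, add_mul])
    (fun s p q => by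
      rw [smul_eq_mul, ← integral_const_mul]
      simp [ev, mul_assoc])
    (fun p q q' => by
      rw [← integral_add (hm _ _) (hm _ _)]
      simp [ev, mul_add])
    (fun s p q => by
      rw [smul_eq_mul, ← integral_const_mul]
      simp [ev, mul_left_comm])

/-- The reference box. -/
def refBox : Set (ℝ × ℝ) := Ioo 0 (1 / 2) ×ˢ Ioo 0 (1 / 2)

theorem integrableOn_refBox {f : ℝ × ℝ → ℝ} (hf : Continuous f) : IntegrableOn f refBox :=
  (hf.continuousOn.integrableOn_compact (isCompact_Icc.prod isCompact_Icc)).mono_set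
    (prod_mono Ioo_subset_Icc_self Ioo_subset_Icc_self)

theorem eq_zero_of_integral_refBox (p : MvPolynomial (Fin 2) ℝ)
    (h : ∫ x in refBox, ev p x * ev p x = 0) : p = 0 := by
  have hc := (Triangulation.continuous_ev p).mul (Triangulation.continuous_ev p)
  rw [setIntegral_eq_zero_iff_of_nonneg_ae (Filter.Eventually.of_forall fun x => mul_self_nonneg _)
    (integrableOn_refBox hc)] at h
  have h2 := Measure.eqOn_open_of_ae_eq h (isOpen_Ioo.prod isOpen_Ioo)
    hc.continuousOn continuousOn_const
  refine MvPolynomial.funext_set ![Ioo 0 (1 / 2), Ioo 0 (1 / 2)] ?_ ?_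
  · intro i
    fin_cases i <;> exact Ioo_infinite (by norm_num)
  · intro y hy
    have := h2 (show ((y 0, y 1) : ℝ × ℝ) ∈ refBox from ⟨hy 0 (mem_univ _), hy 1 (mem_univ _)⟩)
    have e : (![y 0, y 1] : Fin 2 → ℝ) = y := by
      ext i; fin_cases i <;> rfl
    simpa [ev, e] using this

/-- The box lies in the reference triangle with vertices `(0,0)`, `(1,0)`, `(0,1)`, and a polynomial
vanishing on it is zero, so its `L²` form is positive definite. The segment is a full side of that
triangle; that it leaves the box is harmless in finite dimension. -/
theorem exists_trace_refBox (N : ℕ) : ∃ C : ℝ, 0 < C ∧ ∀ p : MvPolynomial (Fin 2) ℝ,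
    p.totalDegree ≤ N →
    ∫ t in (0 : ℝ)..1, ev p (0, t) ^ 2 ≤ C * ∫ x in refBox, ev p x ^ 2 := by
  have hi1 : ∀ p, Integrable (fun t : ℝ => ev p (0, t)) (volume.restrict (Ioc 0 1)) := by
    intro p
    have : Continuous (fun t : ℝ => ev p (0, t)) := (Triangulation.continuous_ev p).comp (by fun_prop)
    exact (this.continuousOn.integrableOn_compact isCompact_Icc).mono_set Ioc_subset_Icc_self
  have hi2 : ∀ p, Integrable (fun x => ev p (id x)) (volume.restrict refBox) :=
    fun p => integrableOn_refBox (Triangulation.continuous_ev p)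
  obtain ⟨C, hC0, hC⟩ := exists_quadratic_domination
    (polyForm N (volume.restrict (Ioc (0 : ℝ) 1)) (fun t => (0, t)) hi1)
    (polyForm N (volume.restrict refBox) id hi2) (fun v hv => by
      refine lt_of_le_of_ne (integral_nonneg fun x => mul_self_nonneg _) fun h => hv ?_
      exact Subtype.ext (eq_zero_of_integral_refBox v.1 h.symm))
  refine ⟨C, hC0, fun p hp => ?_⟩
  have := hC ⟨p, (MvPolynomial.mem_restrictTotalDegree _ _ _).2 hp⟩
  simp only [polyForm, LinearMap.mk₂_apply, id] at this
  rw [intervalIntegral.integral_of_le zero_le_one]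
  simpa only [sq] using this

/-- The affine map of the plane with `(0, 0) ↦ P`, `(1, 0) ↦ P + u`, `(0, 1) ↦ P + v`. -/
def affMap (P u v : ℝ × ℝ) (x : ℝ × ℝ) : ℝ × ℝ := P + x.1 • u + x.2 • v

/-- Substituting polynomials of degree at most one does not raise the total degree, so the reference
constant for degree `N` serves every affine image. -/
theorem exists_comp_affMap (P u v : ℝ × ℝ) (p : MvPolynomial (Fin 2) ℝ) :
    ∃ q : MvPolynomial (Fin 2) ℝ, q.totalDegree ≤ p.totalDegree ∧
      ∀ x, ev q x = ev p (affMap P u v x) := by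
  let L : Fin 2 → MvPolynomial (Fin 2) ℝ :=
    ![MvPolynomial.C P.1 + MvPolynomial.C u.1 * MvPolynomial.X 0 +
        MvPolynomial.C v.1 * MvPolynomial.X 1,
      MvPolynomial.C P.2 + MvPolynomial.C u.2 * MvPolynomial.X 0 +
        MvPolynomial.C v.2 * MvPolynomial.X 1]
  have hlin : ∀ r s t : ℝ, (MvPolynomial.C r + MvPolynomial.C s * MvPolynomial.X 0 +
      MvPolynomial.C t * MvPolynomial.X 1 : MvPolynomial (Fin 2) ℝ).totalDegree ≤ 1 := by
    intro r s t
    have hm : ∀ (z : ℝ) (i : Fin 2), (MvPolynomial.C z * MvPolynomial.X i :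
        MvPolynomial (Fin 2) ℝ).totalDegree ≤ 1 := by
      intro z i
      refine (MvPolynomial.totalDegree_mul _ _).trans ?_
      simp
    refine (MvPolynomial.totalDegree_add _ _).trans (max_le ?_ (hm _ _))
    refine (MvPolynomial.totalDegree_add _ _).trans (max_le ?_ (hm _ _))
    simp
  have hL : ∀ i, (L i).totalDegree ≤ 1 := by
    intro i
    fin_cases i
    · exact hlin _ _ _
    · exact hlin _ _ _
  refine ⟨∑ m ∈ p.support, MvPolynomial.C (p.coeff m) * ∏ i, L i ^ m i, ?_, ?_⟩
  · refine MvPolynomial.totalDegree_finsetSum_le fun m hm => ?_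
    refine (MvPolynomial.totalDegree_mul _ _).trans ?_
    rw [MvPolynomial.totalDegree_C, zero_add]
    refine (MvPolynomial.totalDegree_finsetProd _ _).trans ?_
    refine le_trans (Finset.sum_le_sum fun i _ => (MvPolynomial.totalDegree_pow _ _).trans
      (Nat.mul_le_mul_left _ (hL i))) ?_
    have := MvPolynomial.le_totalDegree hm
    rw [Finsupp.sum_fintype _ _ (fun _ => rfl)] at this
    simpa using this
  · intro x
    have h0 : MvPolynomial.eval ![x.1, x.2] (L 0) = (affMap P u v x).1 := by
      simp [L, affMap, mul_comm]
    have h1 : MvPolynomial.eval ![x.1, x.2] (L 1) = (affMap P u v x).2 := by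
      simp [L, affMap, mul_comm]
    simp only [ev]
    rw [MvPolynomial.eval_eq' ![(affMap P u v x).1, (affMap P u v x).2]]
    simp [Fin.prod_univ_two, h0, h1]

/-- The linear part of an affine map of the plane. -/
def affDeriv (u v : ℝ × ℝ) : ℝ × ℝ →L[ℝ] ℝ × ℝ :=
  (ContinuousLinearMap.fst ℝ ℝ ℝ).smulRight u + (ContinuousLinearMap.snd ℝ ℝ ℝ).smulRight v

theorem det_affDeriv (u v : ℝ × ℝ) : (affDeriv u v).det = cross u v := by
  rw [ContinuousLinearMap.det, ← LinearMap.det_toMatrix (Module.Basis.finTwoProd ℝ),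
    Matrix.det_fin_two]
  simp [LinearMap.toMatrix_apply, affDeriv, cross, mul_comm]

theorem hasFDerivAt_affMap (P u v x : ℝ × ℝ) :
    HasFDerivAt (affMap P u v) (affDeriv u v) x := by
  have h : affMap P u v = fun x => P + affDeriv u v x := by
    ext x <;> simp [affMap, affDeriv, add_assoc]
  rw [h]
  exact (affDeriv u v).hasFDerivAt.const_add P

theorem injective_affMap (P : ℝ × ℝ) {u v : ℝ × ℝ} (h : cross u v ≠ 0) :
    Function.Injective (affMap P u v) := by
  intro x y hxy
  have h1 := congrArg Prod.fst hxy
  have h2 := congrArg Prod.snd hxy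
  simp only [affMap, Prod.fst_add, Prod.snd_add, Prod.smul_fst, Prod.smul_snd, smul_eq_mul] at h1 h2
  unfold cross at h
  ext
  · refine mul_left_cancel₀ h ?_
    linear_combination v.2 * h1 - v.1 * h2
  · refine mul_left_cancel₀ h ?_
    linear_combination u.1 * h2 - u.2 * h1

/-- A trace inequality on a side of a triangle, with the dependence on the area made explicit. -/
theorem exists_trace_ineq (N : ℕ) : ∃ C : ℝ, 0 < C ∧ ∀ (p : MvPolynomial (Fin 2) ℝ),
    p.totalDegree ≤ N → ∀ (S : Set (ℝ × ℝ)) (P Q R : ℝ × ℝ), Convex ℝ S → IsCompact S →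
      P ∈ S → Q ∈ S → R ∈ S → cross (R - P) (Q - P) ≠ 0 →
      |cross (R - P) (Q - P)| * ∫ t in (0 : ℝ)..1, ev p (P + t • (Q - P)) ^ 2 ≤
        C * ∫ x in S, ev p x ^ 2 := by
  obtain ⟨C, hC0, hC⟩ := exists_trace_refBox N
  refine ⟨C, hC0, fun p hp S P Q R hS hSc hP hQ hR hne => ?_⟩
  obtain ⟨q, hqd, hq⟩ := exists_comp_affMap P (R - P) (Q - P) p
  have h1 := hC q (hqd.trans hp)
  have hms : MeasurableSet refBox := (isOpen_Ioo.prod isOpen_Ioo).measurableSet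
  have h2 := integral_image_eq_integral_abs_det_fderiv_smul volume hms
    (fun x _ => (hasFDerivAt_affMap P (R - P) (Q - P) x).hasFDerivWithinAt)
    (injective_affMap P hne).injOn (fun x => ev p x ^ 2)
  simp only [det_affDeriv, smul_eq_mul, ← hq] at h2
  rw [integral_const_mul] at h2
  -- Points of the box have positive barycentric weights `1 - x - y`, `x`, `y`, as both coordinates
  -- are below `1/2`; convexity puts the image in `S`.
  have h3 : affMap P (R - P) (Q - P) '' refBox ⊆ S := by
    rintro _ ⟨x, hx, rfl⟩
    have h0 := hx.1.1
    have h0' := hx.2.1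
    have h4 := hx.1.2
    have h5 := hx.2.2
    have := hS.sum_mem (t := Finset.univ) (w := ![1 - x.1 - x.2, x.1, x.2]) (z := ![P, R, Q])
      (by intro i _; fin_cases i <;> simp <;> linarith)
      (by simp [Fin.sum_univ_three]; ring)
      (by intro i _; fin_cases i <;> simp [hP, hQ, hR])
    convert this using 1
    simp only [Fin.sum_univ_three, affMap, Matrix.cons_val_zero, Matrix.cons_val_one,
      Matrix.cons_val_two, Matrix.head_cons, Matrix.tail_cons]
    ext <;> simp <;> ring
  have h4 : ∫ x in affMap P (R - P) (Q - P) '' refBox, ev p x ^ 2 ≤ ∫ x in S, ev p x ^ 2 :=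
    setIntegral_mono_set (((Triangulation.continuous_ev p).pow 2).continuousOn.integrableOn_compact hSc)
      (Filter.Eventually.of_forall fun x => sq_nonneg _) h3.eventuallyLE
  have e : ∀ t : ℝ, ev p (P + t • (Q - P)) = ev q (0, t) := by
    intro t
    rw [hq]
    simp [affMap]
  simp only [e]
  calc _ ≤ |cross (R - P) (Q - P)| * (C * ∫ x in refBox, ev q x ^ 2) :=
        mul_le_mul_of_nonneg_left h1 (abs_nonneg _)
    _ = C * ∫ x in affMap P (R - P) (Q - P) '' refBox, ev p x ^ 2 := by rw [h2]; ring
    _ ≤ _ := mul_le_mul_of_nonneg_left h4 hC0.le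

/-! ### Triangles -/

theorem dot_self_nonneg (p : ℝ × ℝ) : 0 ≤ dot p p :=
  add_nonneg (mul_self_nonneg _) (mul_self_nonneg _)

theorem len_nonneg (p : ℝ × ℝ) : 0 ≤ len p := Real.sqrt_nonneg _

theorem dot_self_eq_len_sq (p : ℝ × ℝ) : dot p p = len p ^ 2 :=
  (Real.sq_sqrt (dot_self_nonneg p)).symm

theorem len_neg (p : ℝ × ℝ) : len (-p) = len p := by simp [len, dot]

theorem len_pos {p : ℝ × ℝ} (hp : p ≠ 0) : 0 < len p := by
  refine Real.sqrt_pos.2 ?_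
  unfold dot
  by_contra! h
  refine hp (Prod.ext ?_ ?_)
  · change p.1 = 0
    nlinarith [sq_nonneg p.1, sq_nonneg p.2]
  · change p.2 = 0
    nlinarith [sq_nonneg p.1, sq_nonneg p.2]

theorem dot_sq_le (p q : ℝ × ℝ) : dot p q ^ 2 ≤ dot p p * dot q q := by
  unfold dot
  nlinarith [sq_nonneg (p.1 * q.2 - p.2 * q.1)]

theorem sideLen_pos (t : Affine.Triangle ℝ (ℝ × ℝ)) (i : Fin 3) : 0 < sideLen t i := by
  refine len_pos (sub_ne_zero.2 fun h => ?_)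
  have := t.independent.injective h
  fin_cases i <;> simp at this

theorem sideLen_le_diam (t : Affine.Triangle ℝ (ℝ × ℝ)) (i : Fin 3) : sideLen t i ≤ diam t := by
  unfold diam
  fin_cases i <;> simp

theorem diam_pos (t : Affine.Triangle ℝ (ℝ × ℝ)) : 0 < diam t :=
  (sideLen_pos t 0).trans_le (sideLen_le_diam t 0)

theorem diam_le_perimeter (t : Affine.Triangle ℝ (ℝ × ℝ)) :
    diam t ≤ sideLen t 0 + sideLen t 1 + sideLen t 2 := by
  have h0 := sideLen_pos t 0
  have h1 := sideLen_pos t 1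
  have h2 := sideLen_pos t 2
  unfold diam
  refine max_le (by linarith) (max_le (by linarith) (by linarith))

theorem dot_normal_le (t : Affine.Triangle ℝ (ℝ × ℝ)) (i : Fin 3) :
    dot (normal t i) (normal t i) ≤ 1 := by
  have hl := sideLen_pos t i
  set e := t.points (i + 2) - t.points (i + 1) with he
  have hs : sideLen t i = len e := rfl
  have h : dot (normal t i) (normal t i) =
      Real.sign (cross e (t.points i - t.points (i + 1))) ^ 2 / sideLen t i ^ 2 * dot e e := by
    simp only [normal, dot, he, Prod.smul_fst, Prod.smul_snd, smul_eq_mul]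
    ring
  rw [h, dot_self_eq_len_sq, ← hs, div_mul_cancel₀ _ (by positivity)]
  rcases Real.sign_apply_eq (cross e (t.points i - t.points (i + 1))) with h | h | h <;>
    rw [h] <;> norm_num

theorem abs_cross_eq (t : Affine.Triangle ℝ (ℝ × ℝ)) (i : Fin 3) :
    |cross (t.points i - t.points (i + 1)) (t.points (i + 2) - t.points (i + 1))| =
      |cross (t.points 1 - t.points 0) (t.points 2 - t.points 0)| := by
  rw [abs_eq_abs]
  fin_cases i <;> [right; right; right] <;> simp [cross] <;> ring

/-- This is where shape regularity acts: the perimeter is at least the diameter, so a bound on the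
diameter by `inDiam` bounds the squared diameter by the area. -/
theorem diam_sq_le {t : Affine.Triangle ℝ (ℝ × ℝ)} {σ : ℝ} (h : diam t ≤ σ * inDiam t) :
    diam t ^ 2 ≤ 2 * σ * |cross (t.points 1 - t.points 0) (t.points 2 - t.points 0)| := by
  have h1 := diam_le_perimeter t
  have h0 := diam_pos t
  unfold inDiam at h
  rw [mul_div_assoc', le_div_iff₀ (by linarith)] at h
  nlinarith

/-- A vanishing area would force a vanishing diameter. -/
theorem cross_ne_zero {t : Affine.Triangle ℝ (ℝ × ℝ)} {σ : ℝ} (h : diam t ≤ σ * inDiam t)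
    (i : Fin 3) :
    cross (t.points i - t.points (i + 1)) (t.points (i + 2) - t.points (i + 1)) ≠ 0 := by
  intro h'
  have h1 := diam_sq_le h
  rw [← abs_cross_eq t i, h', abs_zero, mul_zero] at h1
  have := diam_pos t
  nlinarith

theorem convex_cellOf (t : Affine.Triangle ℝ (ℝ × ℝ)) : Convex ℝ (cellOf t) := convex_convexHull _ _

theorem points_mem_cellOf (t : Affine.Triangle ℝ (ℝ × ℝ)) (i : Fin 3) : t.points i ∈ cellOf t :=
  subset_convexHull _ _ (mem_range_self i)

theorem integral_side_nonneg (p : MvPolynomial (Fin 2) ℝ) (P Q : ℝ × ℝ) :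
    0 ≤ ∫ s in (0 : ℝ)..1, ev p (P + s • (Q - P)) ^ 2 :=
  intervalIntegral.integral_nonneg zero_le_one fun _ _ => sq_nonneg _

/-- The trace inequality on a shape regular triangle. -/
theorem exists_trace_cellOf (N : ℕ) (σ : ℝ) : ∃ C : ℝ, 0 < C ∧
    ∀ (t : Affine.Triangle ℝ (ℝ × ℝ)), diam t ≤ σ * inDiam t → ∀ (i : Fin 3)
      (p : MvPolynomial (Fin 2) ℝ), p.totalDegree ≤ N →
      diam t * (sideLen t i * ∫ s in (0 : ℝ)..1,
        ev p (t.points (i + 1) + s • (t.points (i + 2) - t.points (i + 1))) ^ 2) ≤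
        C * ∫ x in cellOf t, ev p x ^ 2 := by
  obtain ⟨C, hC0, hC⟩ := exists_trace_ineq N
  refine ⟨2 * |σ| * C + 1, by positivity, fun t ht i p hp => ?_⟩
  have h1 := hC p hp (cellOf t) (t.points (i + 1)) (t.points (i + 2)) (t.points i)
    (convex_cellOf t) (Triangulation.isCompact_cellOf t) (points_mem_cellOf t _)
    (points_mem_cellOf t _) (points_mem_cellOf t _) (cross_ne_zero ht i)
  rw [abs_cross_eq] at h1
  set I := ∫ s in (0 : ℝ)..1,
    ev p (t.points (i + 1) + s • (t.points (i + 2) - t.points (i + 1))) ^ 2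
  have hI : 0 ≤ I := integral_side_nonneg p _ _
  set A := |cross (t.points 1 - t.points 0) (t.points 2 - t.points 0)|
  have hA : 0 ≤ A := abs_nonneg _
  have hS : 0 ≤ ∫ x in cellOf t, ev p x ^ 2 := integral_nonneg fun x => sq_nonneg _
  -- The weight on the side is at most the squared diameter, hence at most a multiple of the area
  -- factor in the scaled trace inequality.
  have h2 : diam t * sideLen t i ≤ 2 * |σ| * A := by
    have h3 := diam_sq_le ht
    have h4 := mul_le_mul_of_nonneg_left (sideLen_le_diam t i) (diam_pos t).le
    have h5 := mul_le_mul_of_nonneg_right (le_abs_self σ) hA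
    nlinarith
  calc _ = diam t * sideLen t i * I := by ring
    _ ≤ 2 * |σ| * A * I := mul_le_mul_of_nonneg_right h2 hI
    _ = 2 * |σ| * (A * I) := by ring
    _ ≤ 2 * |σ| * (C * ∫ x in cellOf t, ev p x ^ 2) := mul_le_mul_of_nonneg_left h1 (by positivity)
    _ ≤ _ := by linarith

theorem mem_interior_cellOf (t : Affine.Triangle ℝ (ℝ × ℝ)) (w : Fin 3 → ℝ) (h : ∀ i, 0 < w i)
    (h1 : ∑ i, w i = 1) : ∑ i, w i • t.points i ∈ interior (cellOf t) := by
  let B : AffineBasis (Fin 3) ℝ (ℝ × ℝ) := ⟨t.points, t.independent, by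
    rw [t.independent.affineSpan_eq_top_iff_card_eq_finrank_add_one]; simp⟩
  have hB : (B : Fin 3 → ℝ × ℝ) = t.points := rfl
  rw [cellOf, ← hB, AffineBasis.interior_convexHull]
  intro i
  rw [← Finset.affineCombination_eq_linear_combination _ _ _ h1,
    B.coord_apply_combination_of_mem (Finset.mem_univ i) h1]
  exact h i

theorem mem_interior_cellOf_of_side (t : Affine.Triangle ℝ (ℝ × ℝ)) (i : Fin 3) {x y z : ℝ}
    (hx : 0 < x) (hy : 0 < y) (hz : 0 < z) (h : x + y + z = 1) :
    x • t.points (i + 1) + y • t.points (i + 2) + z • t.points i ∈ interior (cellOf t) := by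
  fin_cases i
  · convert mem_interior_cellOf t ![z, x, y] (by intro i; fin_cases i <;> simpa)
      (by simp [Fin.sum_univ_three]; linarith) using 1
    simp [Fin.sum_univ_three]; abel
  · convert mem_interior_cellOf t ![y, z, x] (by intro i; fin_cases i <;> simpa)
      (by simp [Fin.sum_univ_three]; linarith) using 1
    simp [Fin.sum_univ_three]; abel
  · convert mem_interior_cellOf t ![x, y, z] (by intro i; fin_cases i <;> simpa)
      (by simp [Fin.sum_univ_three]; linarith) using 1
    rw [Fin.sum_univ_three]
    rfl

theorem mem_interior_cellOf_of_edge (t : Affine.Triangle ℝ (ℝ × ℝ)) (i : Fin 3) {P Q : ℝ × ℝ}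
    (he : s(t.points (i + 1), t.points (i + 2)) = s(P, Q)) {x y z : ℝ}
    (hx : 0 < x) (hy : 0 < y) (hz : 0 < z) (h : x + y + z = 1) :
    x • P + y • Q + z • t.points i ∈ interior (cellOf t) := by
  rcases Sym2.eq_iff.1 he with ⟨h1, h2⟩ | ⟨h1, h2⟩
  · rw [← h1, ← h2]
    exact mem_interior_cellOf_of_side t i hx hy hz h
  · rw [← h1, ← h2, add_comm (x • _)]
    exact mem_interior_cellOf_of_side t i hy hx hz (by linarith)

/-- Two triangles on the same side of a common edge overlap. -/
theorem not_disjoint_interior_cellOf (t t' : Affine.Triangle ℝ (ℝ × ℝ)) (i j : Fin 3)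
    {P Q : ℝ × ℝ} (he : s(t.points (i + 1), t.points (i + 2)) = s(P, Q))
    (he' : s(t'.points (j + 1), t'.points (j + 2)) = s(P, Q))
    (h : 0 < cross (Q - P) (t.points i - P) * cross (Q - P) (t'.points j - P)) :
    ¬ Disjoint (interior (cellOf t)) (interior (cellOf t')) := by
  set R := t.points i with hR
  set R' := t'.points j with hR'
  have hne : cross (Q - P) (R' - P) ≠ 0 := by
    rintro h0
    simp [h0] at h
  -- The barycentric coordinates of `R` with respect to `P`, `Q`, `R'` are `x`, `y`, `w`. Only `w >
  -- 0` is known; it expresses that `R` and `R'` lie on the same side of the edge.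
  set w := cross (Q - P) (R - P) / cross (Q - P) (R' - P) with hw
  set y := cross (R - P) (R' - P) / cross (Q - P) (R' - P) with hy
  set x := 1 - y - w with hx
  have hw0 : 0 < w := by
    rw [hw, ← mul_div_mul_right _ _ hne]
    exact div_pos h (mul_self_pos.2 hne)
  have hRe : R = x • P + y • Q + w • R' := by
    have e1 : w * cross (Q - P) (R' - P) = cross (Q - P) (R - P) := div_mul_cancel₀ _ hne
    have e2 : y * cross (Q - P) (R' - P) = cross (R - P) (R' - P) := div_mul_cancel₀ _ hne
    have hc := hne
    simp only [cross, Prod.fst_sub, Prod.snd_sub] at e1 e2 hc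
    ext
    · refine mul_left_cancel₀ hc ?_
      simp only [Prod.fst_add, Prod.smul_fst, smul_eq_mul, hx]
      linear_combination (-(Q.1 - P.1)) * e2 - (R'.1 - P.1) * e1
    · refine mul_left_cancel₀ hc ?_
      simp only [Prod.snd_add, Prod.smul_snd, smul_eq_mul, hx]
      linear_combination (-(Q.2 - P.2)) * e2 - (R'.2 - P.2) * e1
  set D := 4 * (1 + |x| + |y|) with hD
  have hD0 : 4 ≤ D := by
    have := abs_nonneg x
    have := abs_nonneg y
    linarith
  set ε := 1 / D with hε
  have hε0 : 0 < ε := by positivity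
  have hεD : ε * D = 1 := by rw [hε]; field_simp
  have hε4 : ε ≤ 1 / 4 := by
    rw [hε]
    exact one_div_le_one_div_of_le (by norm_num) hD0
  have hεx : -(1 / 4) ≤ ε * x := by
    have := neg_abs_le x
    have := abs_nonneg y
    nlinarith
  have hεy : -(1 / 4) ≤ ε * y := by
    have := neg_abs_le y
    have := abs_nonneg x
    nlinarith
  have m1 := mem_interior_cellOf_of_edge t i he (x := (1 - ε) / 2) (y := (1 - ε) / 2) (z := ε)
    (by linarith) (by linarith) hε0 (by ring)
  have m2 := mem_interior_cellOf_of_edge t' j he' (x := (1 - ε) / 2 + ε * x)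
    (y := (1 - ε) / 2 + ε * y) (z := ε * w) (by linarith) (by linarith) (by positivity)
    (by rw [hx]; ring)
  rw [Set.not_disjoint_iff]
  refine ⟨_, m1, ?_⟩
  convert m2 using 1
  rw [← hR, ← hR', hRe]
  module

/-! ### Counting faces and comparing edge integrals -/

namespace Triangulation

variable {a b c d : ℝ}

/-- At most six faces occupy an edge. -/
theorem card_faces_le (T : Triangulation a b c d) {σ : ℝ} (hT : T.ShapeRegular σ) (f : T.Face) :
    (Finset.univ.filter (fun g => T.edge f = T.edge g)).card ≤ 6 := by
  set P := (T.elem f.1).points (f.2 + 1)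
  set Q := (T.elem f.1).points (f.2 + 2)
  have hne : ∀ g : T.Face, T.edge f = T.edge g →
      cross (Q - P) ((T.elem g.1).points g.2 - P) ≠ 0 := by
    intro g hg h0
    have h1 := cross_ne_zero (hT g.1) g.2
    rcases Sym2.eq_iff.1 hg with ⟨h2, h3⟩ | ⟨h2, h3⟩
    · rw [← h2, ← h3] at h1
      apply h1
      change cross (_ - P) (Q - P) = 0
      unfold cross at h0 ⊢
      linarith
    · rw [← h2, ← h3] at h1
      apply h1
      change cross (_ - Q) (P - Q) = 0
      unfold cross at h0 ⊢
      simp only [Prod.fst_sub, Prod.snd_sub] at h0 ⊢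
      linarith
  have hcard : (Finset.univ : Finset (Bool × Fin 3)).card = 6 := rfl
  rw [← hcard]
  -- A face on the given edge is determined by the side on which its element lies and its local
  -- index: distinct elements on one side would overlap. This gives `2 · 3 = 6`.
  refine Finset.card_le_card_of_injOn
    (fun g => (decide (0 < cross (Q - P) ((T.elem g.1).points g.2 - P)), g.2))
    (fun g _ => Finset.mem_coe.2 (Finset.mem_univ _)) ?_
  intro g hg g' hg' hgg
  simp only [Finset.coe_filter, Finset.mem_univ, true_and, mem_ofPred_eq] at hg hg'
  simp only [Prod.mk.injEq, decide_eq_decide] at hgg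
  refine Prod.ext ?_ hgg.2
  by_contra hk
  refine not_disjoint_interior_cellOf (T.elem g.1) (T.elem g'.1) g.2 g'.2 hg.symm hg'.symm ?_
    (T.nonoverlapping _ _ hk)
  change 0 < cross (Q - P) _ * cross (Q - P) _
  have n1 := hne g hg
  have n2 := hne g' hg'
  rcases lt_or_gt_of_ne n1 with h | h
  · have : ¬ 0 < cross (Q - P) ((T.elem g'.1).points g'.2 - P) := fun h' => by
      have := hgg.1.2 h'
      linarith
    exact mul_pos_of_neg_of_neg h (lt_of_le_of_ne (not_lt.1 this) n2)
  · exact mul_pos h (hgg.1.1 h)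

theorem sum_faces (T : Triangulation a b c d) (X : Fin T.K → ℝ) :
    ∑ f : T.Face, X f.1 = 3 * ∑ k, X k := by
  rw [Fintype.sum_prod_type]
  simp [Finset.mul_sum]

theorem sum_pairs_le (T : Triangulation a b c d) {σ : ℝ} (hT : T.ShapeRegular σ)
    {X : Fin T.K → ℝ} (hX : ∀ k, 0 ≤ X k) :
    ∑ f : T.Face, ∑ g : T.Face, (if T.edge f = T.edge g then X f.1 else 0) ≤ 18 * ∑ k, X k := by
  have : ∀ f : T.Face, ∑ g : T.Face, (if T.edge f = T.edge g then X f.1 else 0) ≤ 6 * X f.1 := by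
    intro f
    rw [← Finset.sum_filter, Finset.sum_const, nsmul_eq_mul]
    refine mul_le_mul_of_nonneg_right ?_ (hX _)
    exact_mod_cast T.card_faces_le hT f
  refine (Finset.sum_le_sum fun f _ => this f).trans (le_of_eq ?_)
  rw [← Finset.mul_sum, T.sum_faces]
  ring

/-- Each of the three faces of an element shares its edge with at most six faces, and the element
can be either member of the pair: `36 = 2 · 6 · 3`. -/
theorem sum_internal_le (T : Triangulation a b c d) {σ : ℝ} (hT : T.ShapeRegular σ)
    {X : Fin T.K → ℝ} (hX : ∀ k, 0 ≤ X k) :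
    ∑ e ∈ T.internal, (X e.1.1 + X e.2.1) ≤ 36 * ∑ k, X k := by
  have h1 : ∑ e ∈ T.internal, (X e.1.1 + X e.2.1) ≤
      ∑ e : T.Face × T.Face, ((if T.edge e.1 = T.edge e.2 then X e.1.1 else 0) +
        (if T.edge e.2 = T.edge e.1 then X e.2.1 else 0)) := by
    rw [internal, Finset.sum_filter]
    refine Finset.sum_le_sum fun e _ => ?_
    have := hX e.1.1
    have := hX e.2.1
    by_cases h : T.edge e.1 = T.edge e.2
    · rw [if_pos h, if_pos h.symm]
      split_ifs
      · exact le_rfl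
      · linarith
    · rw [if_neg (fun h' => h h'.2), if_neg h, if_neg (fun h' => h h'.symm), add_zero]
  refine h1.trans ?_
  have h2 := T.sum_pairs_le hT hX
  have h3 := Fintype.sum_prod_type (fun e : T.Face × T.Face =>
    if T.edge e.1 = T.edge e.2 then X e.1.1 else 0)
  have h4 := Fintype.sum_prod_type_right (fun e : T.Face × T.Face =>
    if T.edge e.2 = T.edge e.1 then X e.2.1 else 0)
  rw [Finset.sum_add_distrib, h3, h4]
  linarith

/-- The two faces may traverse the edge in opposite directions; the substitution `t ↦ 1 - t` removes
the difference. It lets the trace inequality of the second element be used on an edge integral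
parametrized by the first. -/
theorem faceInt_comm (T : Triangulation a b c d) {f g : T.Face} (h : T.edge f = T.edge g)
    (φ : ℝ × ℝ → ℝ) : T.faceInt f φ = T.faceInt g φ := by
  unfold faceInt sideLen
  rcases Sym2.eq_iff.1 h with ⟨h1, h2⟩ | ⟨h1, h2⟩
  · rw [h1, h2]
  · rw [h1, h2]
    set P := (T.elem g.1).points (g.2 + 1)
    set Q := (T.elem g.1).points (g.2 + 2)
    rw [← len_neg, neg_sub]
    congr 1
    have := intervalIntegral.integral_comp_sub_left (a := 0) (b := 1)
      (fun t : ℝ => φ (P + t • (Q - P))) 1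
    simp only [sub_self, sub_zero] at this
    rw [← this]
    congr 1
    ext t
    congr 1
    module

theorem faceInt_mono (T : Triangulation a b c d) (f : T.Face) {φ ψ : ℝ × ℝ → ℝ}
    (hφ : Continuous φ) (hψ : Continuous ψ) (h : ∀ x, φ x ≤ ψ x) :
    T.faceInt f φ ≤ T.faceInt f ψ := by
  unfold faceInt
  refine mul_le_mul_of_nonneg_left ?_ (sideLen_pos _ _).le
  exact intervalIntegral.integral_mono zero_le_one
    (Continuous.intervalIntegrable (by fun_prop) _ _)
    (Continuous.intervalIntegrable (by fun_prop) _ _) fun t => h _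

theorem faceInt_nonneg (T : Triangulation a b c d) (f : T.Face) {φ : ℝ × ℝ → ℝ}
    (h : ∀ x, 0 ≤ φ x) : 0 ≤ T.faceInt f φ :=
  mul_nonneg (sideLen_pos _ _).le
    (intervalIntegral.integral_nonneg zero_le_one fun _ _ => h _)

theorem faceInt_le_add (T : Triangulation a b c d) (f : T.Face) {g φ ψ : ℝ × ℝ → ℝ} (r s : ℝ)
    (hg : Continuous g) (hφ : Continuous φ) (hψ : Continuous ψ)
    (h : ∀ x, g x ≤ r * φ x + s * ψ x) :
    T.faceInt f g ≤ r * T.faceInt f φ + s * T.faceInt f ψ := by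
  rw [← faceInt_smul, ← faceInt_smul, ← faceInt_add _ _ (by fun_prop) (by fun_prop)]
  exact T.faceInt_mono f hg (by fun_prop) h

end Triangulation

/-! ### Young's inequality and stability of the lifting -/

theorem mul_le_young {δ : ℝ} (hδ : 0 < δ) (x y : ℝ) :
    x * y ≤ δ / 2 * x ^ 2 + 1 / (2 * δ) * y ^ 2 := by
  have h : δ / 2 * x ^ 2 + 1 / (2 * δ) * y ^ 2 - x * y = (δ * x - y) ^ 2 / (2 * δ) := by
    field_simp
    ring
  have h2 : 0 ≤ (δ * x - y) ^ 2 / (2 * δ) := by positivity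
  linarith

theorem dot_le_young {δ : ℝ} (hδ : 0 < δ) (p q : ℝ × ℝ) :
    dot p q ≤ δ / 2 * dot p p + 1 / (2 * δ) * dot q q := by
  have h1 := mul_le_young hδ p.1 q.1
  have h2 := mul_le_young hδ p.2 q.2
  unfold dot
  linarith

/-- The optimal parameter is `√y / √x`. This converts a family of Young bounds, which can be summed
over edges, into a product bound. -/
theorem le_two_mul_sqrt_mul_sqrt {x y z : ℝ} (hx : 0 ≤ x) (hy : 0 ≤ y)
    (h : ∀ s : ℝ, 0 < s → z ≤ s * x + y / s) : z ≤ 2 * (Real.sqrt x * Real.sqrt y) := by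
  refine le_of_forall_pos_le_add fun δ hδ => ?_
  set p := Real.sqrt x with hp
  set q := Real.sqrt y with hq
  have hp0 : 0 ≤ p := Real.sqrt_nonneg _
  have hq0 : 0 ≤ q := Real.sqrt_nonneg _
  have hx' : x = p ^ 2 := (Real.sq_sqrt hx).symm
  have hy' : y = q ^ 2 := (Real.sq_sqrt hy).symm
  -- The shift `τ` keeps the parameter `(q + τ)/(p + τ)` positive when a root vanishes, and costs
  -- only `τ (p + q) ≤ δ`.
  set τ := δ / (p + q + 1) with hτ
  have hτ0 : 0 < τ := by positivity
  have h1 := h ((q + τ) / (p + τ)) (by positivity)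
  have h2 : (q + τ) / (p + τ) * x ≤ (q + τ) * p := by
    rw [hx', div_mul_eq_mul_div, div_le_iff₀ (by positivity)]
    have : 0 ≤ (q + τ) * p * τ := by positivity
    nlinarith
  have h3 : y / ((q + τ) / (p + τ)) ≤ q * (p + τ) := by
    rw [hy', div_div_eq_mul_div, div_le_iff₀ (by positivity)]
    have : 0 ≤ q * τ * (p + τ) := by positivity
    nlinarith
  have h4 : τ * (p + q + 1) = δ := div_mul_cancel₀ _ (by positivity)
  nlinarith

namespace Triangulation

variable {a b c d : ℝ}

/-- The jump part of the square of the energy norm. -/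
def jumpSq (T : Triangulation a b c d) (v : T.PW) : ℝ :=
  ∑ e ∈ T.internal, T.faceInt e.1 (fun x => (T.hInt e)⁻¹ * dot (T.jump v e x) (T.jump v e x))
    + ∑ f ∈ T.external, T.faceInt f (fun x => (T.hExt f)⁻¹ * ev (v f.1) x ^ 2)

theorem hInt_pos (T : Triangulation a b c d) (e : T.Face × T.Face) : 0 < T.hInt e :=
  lt_min (diam_pos _) (diam_pos _)

theorem hExt_pos (T : Triangulation a b c d) (f : T.Face) : 0 < T.hExt f := diam_pos _

theorem jumpSq_nonneg (T : Triangulation a b c d) (v : T.PW) : 0 ≤ T.jumpSq v := by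
  refine add_nonneg (Finset.sum_nonneg fun e _ => T.faceInt_nonneg _ fun x => ?_)
    (Finset.sum_nonneg fun f _ => T.faceInt_nonneg _ fun x => ?_)
  · exact mul_nonneg (inv_nonneg.2 (T.hInt_pos e).le) (dot_self_nonneg _)
  · exact mul_nonneg (inv_nonneg.2 (T.hExt_pos f).le) (sq_nonneg _)

theorem dot_nrm_sq_le (T : Triangulation a b c d) (f : T.Face) (p : ℝ × ℝ) :
    dot (T.nrm f) p ^ 2 ≤ dot p p := by
  have h1 := dot_sq_le (T.nrm f) p
  have h2 := mul_le_mul_of_nonneg_right (dot_normal_le (T.elem f.1) f.2) (dot_self_nonneg p)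
  exact h1.trans (by simpa [nrm] using h2)

/-- Young's inequality with weight `h` on the test field, which the trace inequality absorbs, and
`1/h` on `θ`, which the energy norm contains. The slack `κ` allows one constant for external and
internal edges. -/
theorem external_le (T : Triangulation a b c d) (θ : T.PW) (π : T.PW × T.PW) {ε κ : ℝ}
    (hε : 0 < ε) (hκ : 1 / 2 ≤ κ) (f : T.Face) :
    T.faceInt f (fun x => dot (T.nrm f) (T.evV π f.1 x) * ev (θ f.1) x) ≤
      (ε / 2) * (T.hExt f * T.faceInt f (fun x => dot (T.evV π f.1 x) (T.evV π f.1 x))) +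
        κ / ε * T.faceInt f (fun x => (T.hExt f)⁻¹ * ev (θ f.1) x ^ 2) := by
  have hh := T.hExt_pos f
  have hc := continuous_ev (θ f.1)
  rw [← mul_assoc]
  refine T.faceInt_le_add f _ _
    ((continuous_dot continuous_const (T.continuous_evV π _)).mul hc)
    (continuous_dot (T.continuous_evV π _) (T.continuous_evV π _)) (by fun_prop) fun x => ?_
  have h1 := mul_le_young (mul_pos hε hh) (dot (T.nrm f) (T.evV π f.1 x)) (ev (θ f.1) x)
  have h2 := mul_le_mul_of_nonneg_left (T.dot_nrm_sq_le f (T.evV π f.1 x))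
    (show 0 ≤ ε * T.hExt f / 2 by positivity)
  have h3 : 1 / (2 * (ε * T.hExt f)) * ev (θ f.1) x ^ 2 ≤
      κ / ε * ((T.hExt f)⁻¹ * ev (θ f.1) x ^ 2) := by
    have : κ / ε * ((T.hExt f)⁻¹ * ev (θ f.1) x ^ 2) =
      κ * ((ε * T.hExt f)⁻¹ * ev (θ f.1) x ^ 2) := by field_simp
    rw [this, one_div, mul_inv, mul_assoc]
    exact mul_le_mul_of_nonneg_right (by linarith) (by positivity)
  linarith

theorem internal_avg_le (T : Triangulation a b c d) (θ : T.PW) (π : T.PW × T.PW) {ε : ℝ}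
    (hε : 0 < ε) (e : T.Face × T.Face) :
    T.faceInt e.1 (fun x => dot (T.avgV π e x) (T.jump θ e x)) ≤
      (ε / 4) * (T.hInt e * T.faceInt e.1 (fun x => dot (T.evV π e.1.1 x) (T.evV π e.1.1 x) +
        dot (T.evV π e.2.1 x) (T.evV π e.2.1 x))) +
        1 / (2 * ε) * T.faceInt e.1
          (fun x => (T.hInt e)⁻¹ * dot (T.jump θ e x) (T.jump θ e x)) := by
  have hh := T.hInt_pos e
  have hj := continuous_dot (T.continuous_jump θ e) (T.continuous_jump θ e)
  rw [← mul_assoc]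
  refine T.faceInt_le_add e.1 _ _
    (continuous_dot (T.continuous_avgV π e) (T.continuous_jump θ e))
    ((continuous_dot (T.continuous_evV π _) (T.continuous_evV π _)).add
      (continuous_dot (T.continuous_evV π _) (T.continuous_evV π _))) (by fun_prop) fun x => ?_
  have h1 := dot_le_young (mul_pos hε hh) (T.avgV π e x) (T.jump θ e x)
  have h2 : dot (T.avgV π e x) (T.avgV π e x) ≤ 1 / 2 * (dot (T.evV π e.1.1 x) (T.evV π e.1.1 x) +
        dot (T.evV π e.2.1 x) (T.evV π e.2.1 x)) := by
    simp only [avgV, dot, Prod.smul_fst, Prod.smul_snd, Prod.fst_add, Prod.snd_add, smul_eq_mul]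
    nlinarith [sq_nonneg ((T.evV π e.1.1 x).1 - (T.evV π e.2.1 x).1),
      sq_nonneg ((T.evV π e.1.1 x).2 - (T.evV π e.2.1 x).2)]
  have h3 := mul_le_mul_of_nonneg_left h2 (show 0 ≤ ε * T.hInt e / 2 by positivity)
  have h4 : 1 / (2 * (ε * T.hInt e)) * dot (T.jump θ e x) (T.jump θ e x) =
      1 / (2 * ε) * ((T.hInt e)⁻¹ * dot (T.jump θ e x) (T.jump θ e x)) := by field_simp
  linarith

theorem internal_jump_le (T : Triangulation a b c d) (θ : T.PW) (π : T.PW × T.PW) {ε M : ℝ}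
    (hε : 0 < ε) (e : T.Face × T.Face) {n : ℝ × ℝ} (hn : len n ≤ M) :
    -T.faceInt e.1 (fun x => dot n (T.jump θ e x) * T.jumpV π e x) ≤
      (ε / 4) * (T.hInt e * T.faceInt e.1 (fun x => dot (T.evV π e.1.1 x) (T.evV π e.1.1 x) +
        dot (T.evV π e.2.1 x) (T.evV π e.2.1 x))) +
        2 * M ^ 2 / ε * T.faceInt e.1
          (fun x => (T.hInt e)⁻¹ * dot (T.jump θ e x) (T.jump θ e x)) := by
  have hh := T.hInt_pos e
  have hj := continuous_dot (T.continuous_jump θ e) (T.continuous_jump θ e)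
  have hp := T.continuous_jumpV π e
  have hnj := continuous_dot (continuous_const (y := n)) (T.continuous_jump θ e)
  have hneg : -T.faceInt e.1 (fun x => dot n (T.jump θ e x) * T.jumpV π e x) =
      T.faceInt e.1 (fun x => (-T.jumpV π e x) * dot n (T.jump θ e x)) := by
    rw [← neg_one_mul, ← faceInt_smul]
    congr 1
    ext x
    ring
  rw [hneg, ← mul_assoc]
  refine T.faceInt_le_add e.1 _ _ (by fun_prop)
    ((continuous_dot (T.continuous_evV π _) (T.continuous_evV π _)).add
      (continuous_dot (T.continuous_evV π _) (T.continuous_evV π _))) (by fun_prop) fun x => ?_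
  -- The parameter `ε h / 4` compensates the factor `2` in the bound of the squared jump of `π` by
  -- the two traces, so the first coefficient matches the one for the average.
  have h1 := mul_le_young (show 0 < ε * T.hInt e / 4 by positivity) (-T.jumpV π e x)
    (dot n (T.jump θ e x))
  have h2 : (-T.jumpV π e x) ^ 2 ≤ 2 * (dot (T.evV π e.1.1 x) (T.evV π e.1.1 x) +
        dot (T.evV π e.2.1 x) (T.evV π e.2.1 x)) := by
    have p1 := T.dot_nrm_sq_le e.1 (T.evV π e.1.1 x)
    have p2 := T.dot_nrm_sq_le e.2 (T.evV π e.2.1 x)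
    have p3 := add_sq_le (a := dot (T.nrm e.1) (T.evV π e.1.1 x))
      (b := dot (T.nrm e.2) (T.evV π e.2.1 x))
    rw [neg_sq, jumpV]
    linarith
  have h3 : dot n (T.jump θ e x) ^ 2 ≤ M ^ 2 * dot (T.jump θ e x) (T.jump θ e x) := by
    refine (dot_sq_le _ _).trans (mul_le_mul_of_nonneg_right ?_ (dot_self_nonneg _))
    rw [dot_self_eq_len_sq]
    exact pow_le_pow_left₀ (len_nonneg _) hn 2
  have h4 := mul_le_mul_of_nonneg_left h2 (show 0 ≤ ε * T.hInt e / 4 / 2 by positivity)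
  have h5 := mul_le_mul_of_nonneg_left h3 (show 0 ≤ 1 / (2 * (ε * T.hInt e / 4)) by positivity)
  have h6 : 1 / (2 * (ε * T.hInt e / 4)) * (M ^ 2 * dot (T.jump θ e x) (T.jump θ e x)) =
      2 * M ^ 2 / ε * ((T.hInt e)⁻¹ * dot (T.jump θ e x) (T.jump θ e x)) := by
    field_simp
    ring
  linarith

/-- The square of the `L²` norm on one element. -/
def elemSq (T : Triangulation a b c d) (π : T.PW × T.PW) (k : Fin T.K) : ℝ :=
  ∫ x in cellOf (T.elem k), dot (T.evV π k x) (T.evV π k x)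

theorem elemSq_nonneg (T : Triangulation a b c d) (π : T.PW × T.PW) (k : Fin T.K) :
    0 ≤ T.elemSq π k := integral_nonneg fun _ => dot_self_nonneg _

theorem elemSq_eq (T : Triangulation a b c d) (π : T.PW × T.PW) (k : Fin T.K) :
    T.elemSq π k = (∫ x in cellOf (T.elem k), ev (π.1 k) x ^ 2) +
      ∫ x in cellOf (T.elem k), ev (π.2 k) x ^ 2 := by
  rw [← integral_add]
  · simp only [elemSq, dot, evV, sq]
  · exact ((continuous_ev _).pow 2).continuousOn.integrableOn_compact (isCompact_cellOf _)
  · exact ((continuous_ev _).pow 2).continuousOn.integrableOn_compact (isCompact_cellOf _)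

/-- The trace inequality for piecewise polynomial vector fields. -/
theorem exists_trace_face (N : ℕ) (σ : ℝ) : ∃ C : ℝ, 0 < C ∧
    ∀ T : Triangulation a b c d, T.ShapeRegular σ → ∀ π : T.PW × T.PW, π.1 ∈ T.V N → π.2 ∈ T.V N →
      ∀ f : T.Face, ∀ h : ℝ, h ≤ diam (T.elem f.1) →
        h * T.faceInt f (fun x => dot (T.evV π f.1 x) (T.evV π f.1 x)) ≤ C * T.elemSq π f.1 := by
  obtain ⟨C, hC0, hC⟩ := exists_trace_cellOf N σ
  refine ⟨C, hC0, fun T hT π h1 h2 f h hh => ?_⟩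
  have t1 := hC _ (hT f.1) f.2 (π.1 f.1)
    ((MvPolynomial.mem_restrictTotalDegree _ _ _).1 (h1 f.1 (mem_univ _)))
  have t2 := hC _ (hT f.1) f.2 (π.2 f.1)
    ((MvPolynomial.mem_restrictTotalDegree _ _ _).1 (h2 f.1 (mem_univ _)))
  have e : T.faceInt f (fun x => dot (T.evV π f.1 x) (T.evV π f.1 x)) =
      T.faceInt f (fun x => ev (π.1 f.1) x ^ 2) + T.faceInt f (fun x => ev (π.2 f.1) x ^ 2) := by
    rw [← faceInt_add (g := fun x => ev (π.1 f.1) x ^ 2) (h := fun x => ev (π.2 f.1) x ^ 2) _ _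
      ((continuous_ev _).pow 2) ((continuous_ev _).pow 2)]
    simp only [dot, evV, sq]
  have hn := T.faceInt_nonneg f (φ := fun x => dot (T.evV π f.1 x) (T.evV π f.1 x))
    fun _ => dot_self_nonneg _
  refine (mul_le_mul_of_nonneg_right hh hn).trans ?_
  rw [e, elemSq_eq, mul_add, mul_add]
  exact add_le_add t1 t2

/-- The coefficients of the traces add up to `(3 + 36)/2 < 20`, from the two counts of faces; those
of the jumps are `1/(2ε)` from the average and `2M²/ε` from the flux term. -/
theorem liftRhs_le (T : Triangulation a b c d) {σ C M : ℝ} (hC0 : 0 < C) (hT : T.ShapeRegular σ)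
    {η : Sym2 (ℝ × ℝ) → ℝ × ℝ} (hη : ∀ e ∈ T.internal, len (η (T.edge e.1)) ≤ M) (θ : T.PW)
    (π : T.PW × T.PW)
    (htr : ∀ f : T.Face, ∀ h : ℝ, h ≤ diam (T.elem f.1) →
        h * T.faceInt f (fun x => dot (T.evV π f.1 x) (T.evV π f.1 x)) ≤ C * T.elemSq π f.1)
    {ε : ℝ} (hε : 0 < ε) :
    T.liftRhs η θ π ≤ ε * (20 * C) * T.innerV π π +
      (2 * M ^ 2 + 1 / 2) / ε * T.jumpSq θ := by
  have hE := T.elemSq_nonneg π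
  have hext : ∑ f ∈ T.external,
      T.faceInt f (fun x => dot (T.nrm f) (T.evV π f.1 x) * ev (θ f.1) x) ≤
      ε / 2 * (C * (3 * ∑ k, T.elemSq π k)) + (2 * M ^ 2 + 1 / 2) / ε *
        ∑ f ∈ T.external, T.faceInt f (fun x => (T.hExt f)⁻¹ * ev (θ f.1) x ^ 2) := by
    have h1 := Finset.sum_le_sum fun f (_ : f ∈ T.external) =>
      T.external_le θ π (κ := 2 * M ^ 2 + 1 / 2) hε (by nlinarith [sq_nonneg M]) f
    refine h1.trans ?_
    rw [Finset.sum_add_distrib, ← Finset.mul_sum, ← Finset.mul_sum]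
    refine add_le_add ?_ le_rfl
    refine mul_le_mul_of_nonneg_left ?_ (by positivity)
    refine (Finset.sum_le_sum fun f _ => htr f _ le_rfl).trans ?_
    rw [← Finset.mul_sum, ← T.sum_faces]
    exact mul_le_mul_of_nonneg_left (Finset.sum_le_sum_of_subset_of_nonneg (Finset.subset_univ _)
      fun f _ _ => hE _) hC0.le
  have hint : ∑ e ∈ T.internal, T.faceInt e.1 (fun x => dot (T.avgV π e x) (T.jump θ e x)) -
      ∑ e ∈ T.internal, T.faceInt e.1
        (fun x => dot (η (T.edge e.1)) (T.jump θ e x) * T.jumpV π e x) ≤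
      ε / 2 * (C * (36 * ∑ k, T.elemSq π k)) + (2 * M ^ 2 + 1 / 2) / ε *
        ∑ e ∈ T.internal, T.faceInt e.1
          (fun x => (T.hInt e)⁻¹ * dot (T.jump θ e x) (T.jump θ e x)) := by
    rw [← Finset.sum_sub_distrib]
    have h1 : ∀ e ∈ T.internal,
        T.faceInt e.1 (fun x => dot (T.avgV π e x) (T.jump θ e x)) -
          T.faceInt e.1 (fun x => dot (η (T.edge e.1)) (T.jump θ e x) * T.jumpV π e x) ≤
        ε / 2 * (C * (T.elemSq π e.1.1 + T.elemSq π e.2.1)) + (2 * M ^ 2 + 1 / 2) / ε *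
          T.faceInt e.1 (fun x => (T.hInt e)⁻¹ * dot (T.jump θ e x) (T.jump θ e x)) := by
      intro e he
      have t1 := T.internal_avg_le θ π hε e
      have t2 := T.internal_jump_le θ π hε e (hη e he)
      have hedge : T.edge e.1 = T.edge e.2 := ((Finset.mem_filter.1 he).2).2
      rw [faceInt_add _ _ (continuous_dot (T.continuous_evV π _) (T.continuous_evV π _))
        (continuous_dot (T.continuous_evV π _) (T.continuous_evV π _)),
        T.faceInt_comm hedge (fun x => dot (T.evV π e.2.1 x) (T.evV π e.2.1 x))] at t1 t2
      have t3 := htr e.1 (T.hInt e) (min_le_left _ _)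
      have t4 := htr e.2 (T.hInt e) (min_le_right _ _)
      have t5 := mul_le_mul_of_nonneg_left (add_le_add t3 t4) (show 0 ≤ ε / 2 by positivity)
      have t6 : (2 * M ^ 2 + 1 / 2) / ε = 1 / (2 * ε) + 2 * M ^ 2 / ε := by
        field_simp
        ring
      rw [t6]
      linarith
    refine (Finset.sum_le_sum h1).trans ?_
    rw [Finset.sum_add_distrib, ← Finset.mul_sum, ← Finset.mul_sum, ← Finset.mul_sum]
    refine add_le_add ?_ le_rfl
    refine mul_le_mul_of_nonneg_left ?_ (by positivity)
    exact mul_le_mul_of_nonneg_left (T.sum_internal_le hT hE) hC0.le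
  have hS : 0 ≤ C * ∑ k, T.elemSq π k := mul_nonneg hC0.le (Finset.sum_nonneg fun k _ => hE k)
  have hI : T.innerV π π = ∑ k, T.elemSq π k := rfl
  rw [hI, jumpSq, liftRhs]
  nlinarith

/-- Stability of the lifting. -/
theorem exists_lifting_le (N : ℕ) (σ M : ℝ) : ∃ K : ℝ, 0 < K ∧
    ∀ T : Triangulation a b c d, T.ShapeRegular σ →
      ∀ η : Sym2 (ℝ × ℝ) → ℝ × ℝ, (∀ e ∈ T.internal, len (η (T.edge e.1)) ≤ M) → ∀ θ : T.PW,
        T.innerV (T.lifting N η θ) (T.lifting N η θ) ≤ K * T.jumpSq θ := by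
  obtain ⟨C, hC0, hC⟩ := exists_trace_face (a := a) (b := b) (c := c) (d := d) N σ
  refine ⟨80 * C * (2 * M ^ 2 + 1 / 2), by positivity, fun T hT η hη θ => ?_⟩
  obtain ⟨⟨h1, h2⟩, h3⟩ := (T.exists_unique_lifting N η θ).choose_spec.1
  change (T.lifting N η θ).1 ∈ _ at h1
  change (T.lifting N η θ).2 ∈ _ at h2
  have h4 := h3 (T.lifting N η θ) h1 h2
  change T.innerV (T.lifting N η θ) (T.lifting N η θ) = _ at h4
  -- The lifting is tested with itself; `ε = 1/(40C)` makes the coefficient on the right `1/2`, so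
  -- that term can be absorbed.
  have h5 := T.liftRhs_le hC0 hT hη θ (T.lifting N η θ) (hC T hT _ h1 h2)
    (show 0 < 1 / (40 * C) by positivity)
  rw [← h4] at h5
  have e1 : 1 / (40 * C) * (20 * C) = 1 / 2 := by field_simp; norm_num
  have e2 : (2 * M ^ 2 + 1 / 2) / (1 / (40 * C)) = (2 * M ^ 2 + 1 / 2) * (40 * C) := by
    rw [div_div_eq_mul_div, div_one]
  rw [e1, e2] at h5
  linarith

/-! ### Piecewise polynomials as functions on the plane -/

theorem fn_sub (T : Triangulation a b c d) (v w : T.PW) (x : ℝ × ℝ) :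
    T.fn (v - w) x = T.fn v x - T.fn w x := by
  unfold fn
  rw [← Finset.sum_sub_distrib]
  refine Finset.sum_congr rfl fun k _ => ?_
  by_cases h : x ∈ interior (cellOf (T.elem k)) <;> simp [h, ev]

theorem bddSupp_fn (T : Triangulation a b c d) (w : T.PW) : BddSupp₂ a b c d (T.fn w) := by
  refine ⟨?_, ?_, ?_⟩
  · exact Finset.measurable_sum _ fun k _ =>
      (continuous_ev _).measurable.indicator isOpen_interior.measurableSet
  · have : ∀ k, ∃ C : ℝ, ∀ x ∈ cellOf (T.elem k), |ev (w k) x| ≤ C := fun k =>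
      (isCompact_cellOf (T.elem k)).exists_bound_of_continuousOn (continuous_ev (w k)).continuousOn
    choose C hC using this
    refine ⟨∑ k, |C k|, fun x => (Finset.abs_sum_le_sum_abs _ _).trans
      (Finset.sum_le_sum fun k _ => ?_)⟩
    by_cases h : x ∈ interior (cellOf (T.elem k))
    · rw [indicator_of_mem h]
      exact (hC k x (interior_subset h)).trans (le_abs_self _)
    · rw [indicator_of_notMem h, abs_zero]
      positivity
  · intro x hx
    refine Finset.sum_eq_zero fun k _ => indicator_of_notMem (fun h => hx ?_) _
    rw [← T.cover]
    exact mem_iUnion.2 ⟨k, interior_subset h⟩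

/-- At most one summand is nonzero at a point, since the open elements are disjoint. -/
theorem fn_sq (T : Triangulation a b c d) (w : T.PW) (x : ℝ × ℝ) :
    T.fn w x ^ 2 = ∑ k, (interior (cellOf (T.elem k))).indicator (fun x => ev (w k) x ^ 2) x := by
  by_cases h : ∃ k, x ∈ interior (cellOf (T.elem k))
  · obtain ⟨k, hk⟩ := h
    have hne : ∀ l, l ≠ k → x ∉ interior (cellOf (T.elem l)) := fun l hl h' =>
      Set.disjoint_left.1 (T.nonoverlapping l k hl) h' hk
    rw [fn, Finset.sum_eq_single k (fun l _ hl => indicator_of_notMem (hne l hl) _) (by simp),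
      Finset.sum_eq_single k (fun l _ hl => indicator_of_notMem (hne l hl) _) (by simp),
      indicator_of_mem hk, indicator_of_mem hk]
  · push Not at h
    rw [fn, Finset.sum_eq_zero fun k _ => indicator_of_notMem (h k) _,
      Finset.sum_eq_zero fun k _ => indicator_of_notMem (h k) _]
    norm_num

theorem integral_fn_sq_le (T : Triangulation a b c d) (w : T.PW) :
    ∫ x, T.fn w x ^ 2 ≤ ∑ k, ∫ x in cellOf (T.elem k), ev (w k) x ^ 2 := by
  have hi : ∀ k, IntegrableOn (fun x => ev (w k) x ^ 2) (cellOf (T.elem k)) := fun k =>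
    ((continuous_ev _).pow 2).continuousOn.integrableOn_compact (isCompact_cellOf _)
  simp only [fn_sq]
  rw [integral_finsetSum]
  · refine Finset.sum_le_sum fun k _ => ?_
    rw [integral_indicator isOpen_interior.measurableSet]
    exact setIntegral_mono_set (hi k) (Filter.Eventually.of_forall fun x => sq_nonneg _)
      interior_subset.eventuallyLE
  · intro k _
    rw [integrable_indicator_iff isOpen_interior.measurableSet]
    exact (hi k).mono_set interior_subset

/-- The square of the negative order norm of a piecewise polynomial vector field. -/
def fieldSq (T : Triangulation a b c d) (α₁ α₂ : ℝ) (W : T.PW × T.PW) : ℝ :=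
  slabSq c d α₁ (T.fn W.1) + slabSq a b α₂ (fun x => T.fn W.2 x.swap)

theorem fieldSq_le (T : Triangulation a b c d) (hab : a < b) (hcd : c < d) {α₁ α₂ : ℝ}
    (h1 : 0 < α₁ ∧ α₁ < 1) (h2 : 0 < α₂ ∧ α₂ < 1) (W : T.PW × T.PW) :
    T.fieldSq α₁ α₂ W ≤ (embConst a b α₁ + embConst c d α₂) * T.innerV W W := by
  have e1 := (T.bddSupp_fn W.1).slabSq_le hab hcd h1.1 h1.2
  have e2 := (T.bddSupp_fn W.2).swap.slabSq_le hcd hab h2.1 h2.2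
  have e3 : ∫ x : ℝ × ℝ, T.fn W.2 x.swap ^ 2 = ∫ x, T.fn W.2 x ^ 2 :=
    integral_prod_swap (fun x : ℝ × ℝ => T.fn W.2 x ^ 2)
  have i1 := T.integral_fn_sq_le W.1
  have i2 := T.integral_fn_sq_le W.2
  have hI : T.innerV W W = ∑ k, T.elemSq W k := rfl
  simp only [elemSq_eq, Finset.sum_add_distrib] at hI
  have n1 : 0 ≤ ∑ k, ∫ x in cellOf (T.elem k), ev (W.1 k) x ^ 2 :=
    Finset.sum_nonneg fun k _ => integral_nonneg fun x => sq_nonneg _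
  have n2 : 0 ≤ ∑ k, ∫ x in cellOf (T.elem k), ev (W.2 k) x ^ 2 :=
    Finset.sum_nonneg fun k _ => integral_nonneg fun x => sq_nonneg _
  have c1 := one_le_embConst (μ := α₁) hab
  have c2 := one_le_embConst (μ := α₂) hcd
  rw [e3] at e2
  rw [hI, fieldSq]
  nlinarith [mul_le_mul_of_nonneg_left i1 (zero_le_one.trans c1),
    mul_le_mul_of_nonneg_left i2 (zero_le_one.trans c2),
    mul_nonneg (zero_le_one.trans c1) n2, mul_nonneg (zero_le_one.trans c2) n1]

/-- Used with `Z = L(v)` to recover the gradient from the corrected gradient, and with `W` the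
corrected gradient and `Z = -L(v)` for the converse. -/
theorem fieldSq_le_sub (T : Triangulation a b c d) (hab : a < b) (hcd : c < d) {α₁ α₂ : ℝ}
    (h1 : 0 < α₁ ∧ α₁ < 1) (h2 : 0 < α₂ ∧ α₂ < 1) (W Z : T.PW × T.PW) :
    T.fieldSq α₁ α₂ W ≤ 2 * T.fieldSq α₁ α₂ (W - Z) + 2 * T.fieldSq α₁ α₂ Z := by
  have e1 := (T.bddSupp_fn (W - Z).1).slabSq_add_le hab hcd (T.bddSupp_fn Z.1) h1.1 h1.2
  have e2 := (T.bddSupp_fn (W - Z).2).swap.slabSq_add_le hcd hab (T.bddSupp_fn Z.2).swap h2.1 h2.2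
  simp only [Prod.fst_sub, Prod.snd_sub, fn_sub, sub_add_cancel] at e1 e2
  simp only [fieldSq, Prod.fst_sub, Prod.snd_sub, fn_sub]
  linarith

theorem innerV_neg (T : Triangulation a b c d) (W : T.PW × T.PW) :
    T.innerV (-W) (-W) = T.innerV W W := by
  rw [← neg_one_smul ℝ W, innerV_smul, innerV_comm, innerV_smul]
  ring

/-! ### The bilinear form -/

/-- The penalty part of the bilinear form. -/
def penalty (T : Triangulation a b c d) (lam : Sym2 (ℝ × ℝ) → ℝ) (u v : T.PW) : ℝ :=
  ∑ e ∈ T.internal, T.faceInt e.1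
      (fun x => lam (T.edge e.1) / T.hInt e * dot (T.jump u e x) (T.jump v e x))
  + ∑ f ∈ T.external, T.faceInt f
      (fun x => lam (T.edge f) / T.hExt f * (ev (u f.1) x * ev (v f.1) x))

/-- Young's inequality with a single parameter `s` for all edges can be summed first and optimized
afterwards, which gives Cauchy–Schwarz for the whole penalty. -/
theorem penalty_le (T : Triangulation a b c d) {lam : Sym2 (ℝ × ℝ) → ℝ} {l L : ℝ} (hl : 0 < l)
    (h : ∀ f : T.Face, l ≤ lam (T.edge f) ∧ lam (T.edge f) ≤ L) (u v : T.PW) :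
    T.penalty lam u v ≤ |L| * (2 * (Real.sqrt (T.jumpSq u) * Real.sqrt (T.jumpSq v))) := by
  have key : ∀ (f : T.Face) (h x y z s : ℝ), 0 < h → 0 < s → 0 ≤ x → 0 ≤ y →
      z ≤ s / 2 * x + 1 / (2 * s) * y →
      lam (T.edge f) / h * z ≤ |L| * s * (h⁻¹ * x) + |L| / s * (h⁻¹ * y) := by
    intro f k x y z s hk hs hx hy hz
    have p0 := h f
    have p1 : 0 < lam (T.edge f) := by linarith
    have p2 : lam (T.edge f) ≤ |L| := p0.2.trans (le_abs_self _)
    have p3 : s / 2 * x + 1 / (2 * s) * y ≤ s * x + y / s := by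
      have : 1 / (2 * s) * y = y / s / 2 := by field_simp
      rw [this]
      have : 0 ≤ s * x := by positivity
      have : 0 ≤ y / s := by positivity
      linarith
    calc lam (T.edge f) / k * z ≤ lam (T.edge f) / k * (s * x + y / s) :=
          mul_le_mul_of_nonneg_left (hz.trans p3) (by positivity)
      _ ≤ |L| / k * (s * x + y / s) := by gcongr
      _ = _ := by ring
  -- If `|L| = 0`, the bounds `0 < l ≤ lam ≤ L` leave no face at all, and both sums are empty.
  rcases (abs_nonneg L).eq_or_lt with h0 | h0
  · rw [← h0, zero_mul]
    have hf : ∀ f : T.Face, False := fun f => by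
      have := h f
      have := le_abs_self L
      linarith
    rw [penalty, Finset.sum_eq_zero fun e _ => (hf e.1).elim,
      Finset.sum_eq_zero fun f _ => (hf f).elim, add_zero]
  rw [← div_le_iff₀' h0]
  refine le_two_mul_sqrt_mul_sqrt (T.jumpSq_nonneg u) (T.jumpSq_nonneg v) fun s hs => ?_
  rw [div_le_iff₀' h0]
  have e : |L| * (s * T.jumpSq u + T.jumpSq v / s) =
      |L| * s * T.jumpSq u + |L| / s * T.jumpSq v := by ring
  rw [e, jumpSq, jumpSq, mul_add, mul_add, add_add_add_comm]
  simp only [Finset.mul_sum]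
  rw [← Finset.sum_add_distrib, ← Finset.sum_add_distrib]
  refine add_le_add (Finset.sum_le_sum fun e _ => ?_) (Finset.sum_le_sum fun f _ => ?_)
  · have c1 := continuous_dot (T.continuous_jump u e) (T.continuous_jump v e)
    have c2 := continuous_dot (T.continuous_jump u e) (T.continuous_jump u e)
    have c3 := continuous_dot (T.continuous_jump v e) (T.continuous_jump v e)
    refine T.faceInt_le_add e.1 _ _ (by fun_prop) (by fun_prop) (by fun_prop) fun x => ?_
    exact key e.1 _ _ _ _ s (T.hInt_pos e) hs (dot_self_nonneg _) (dot_self_nonneg _)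
      (dot_le_young hs _ _)
  · have c1 := continuous_ev (u f.1)
    have c2 := continuous_ev (v f.1)
    refine T.faceInt_le_add f _ _ (by fun_prop) (by fun_prop) (by fun_prop) fun x => ?_
    exact key f _ _ _ _ s (T.hExt_pos f) hs (sq_nonneg _) (sq_nonneg _) (mul_le_young hs _ _)

theorem le_penalty (T : Triangulation a b c d) {lam : Sym2 (ℝ × ℝ) → ℝ} {l : ℝ}
    (h : ∀ f : T.Face, l ≤ lam (T.edge f)) (v : T.PW) :
    l * T.jumpSq v ≤ T.penalty lam v v := by
  rw [jumpSq, mul_add, Finset.mul_sum, Finset.mul_sum]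
  refine add_le_add (Finset.sum_le_sum fun e _ => ?_) (Finset.sum_le_sum fun f _ => ?_)
  · have c1 := continuous_dot (T.continuous_jump v e) (T.continuous_jump v e)
    rw [← faceInt_smul]
    refine T.faceInt_mono _ (by fun_prop) (by fun_prop) fun x => ?_
    rw [← mul_assoc, ← div_eq_mul_inv]
    exact mul_le_mul_of_nonneg_right (div_le_div_of_nonneg_right (h e.1) (T.hInt_pos e).le)
      (dot_self_nonneg _)
  · have c1 := continuous_ev (v f.1)
    rw [← faceInt_smul]
    refine T.faceInt_mono _ (by fun_prop) (by fun_prop) fun x => ?_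
    rw [← mul_assoc, ← div_eq_mul_inv, ← sq]
    exact mul_le_mul_of_nonneg_right (div_le_div_of_nonneg_right (h f) (T.hExt_pos f).le)
      (sq_nonneg _)

theorem energyNorm_sq (T : Triangulation a b c d) (hab : a < b) (hcd : c < d) (α₁ α₂ : ℝ)
    (v : T.PW) :
    T.energyNorm α₁ α₂ v ^ 2 = T.fieldSq α₁ α₂ (T.grad v) + T.jumpSq v := by
  have h : T.energyNorm α₁ α₂ v =
      Real.sqrt (T.fieldSq α₁ α₂ (T.grad v) + T.jumpSq v) := by
    unfold energyNorm fieldSq jumpSq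
    rw [← add_assoc]
    rfl
  rw [h, Real.sq_sqrt]
  exact add_nonneg (add_nonneg (slabSq_nonneg hcd _ _) (slabSq_nonneg hab _ _))
    (T.jumpSq_nonneg v)

theorem fracX_fn_sub (T : Triangulation a b c d) {μ : ℝ} (hμ : 0 < μ) (v w : T.PW) {z : ℝ × ℝ}
    (hz : a ≤ z.1) :
    fracX a μ (T.fn (v - w)) z = fracX a μ (T.fn v) z - fracX a μ (T.fn w) z := by
  have h := (T.bddSupp_fn (v - w)).fracX_add (T.bddSupp_fn w) hμ hz
  simp only [fn_sub, sub_add_cancel] at h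
  exact eq_sub_of_add_eq h.symm

theorem fracY_fn_sub (T : Triangulation a b c d) {μ : ℝ} (hμ : 0 < μ) (v w : T.PW) {z : ℝ × ℝ}
    (hz : c ≤ z.2) :
    fracY c μ (T.fn (v - w)) z = fracY c μ (T.fn v) z - fracY c μ (T.fn w) z := by
  have h := (T.bddSupp_fn (v - w)).swap.fracX_add (T.bddSupp_fn w).swap hμ (z := z.swap) hz
  simp only [fn_sub, sub_add_cancel] at h
  have e : T.fn (v - w) = fun x => T.fn v x - T.fn w x := funext (T.fn_sub v w)
  change fracX c μ (fun x => T.fn (v - w) x.swap) z.swap =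
    fracX c μ (fun x => T.fn v x.swap) z.swap - fracX c μ (fun x => T.fn w x.swap) z.swap
  rw [e]
  linarith

/-- The bilinear form in terms of the corrected gradient `∇v - L(v)`. -/
theorem B_eq (T : Triangulation a b c d) (N : ℕ) {α₁ α₂ : ℝ} (h1 : 0 < α₁) (h2 : 0 < α₂)
    (η : Sym2 (ℝ × ℝ) → ℝ × ℝ) (lam : Sym2 (ℝ × ℝ) → ℝ) (u v : T.PW) :
    T.B N α₁ α₂ η lam u v =
      (∫ z in Ioo a b ×ˢ Ioo c d, fracX a α₁ (T.fn (T.grad u - T.lifting N η u).1) z *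
        T.fn (T.grad v - T.lifting N η v).1 z) +
      (∫ z in Ioo c d ×ˢ Ioo a b,
        fracX c α₂ (fun x => T.fn (T.grad u - T.lifting N η u).2 x.swap) z *
          T.fn (T.grad v - T.lifting N η v).2 z.swap) + T.penalty lam u v := by
  rw [← integral_fracY_mul, ← integral_add
    ((T.bddSupp_fn _).integrableOn_fracX_mul (T.bddSupp_fn _) h1)
    (integrableOn_fracY_mul (T.bddSupp_fn _) (T.bddSupp_fn _) h2), B, add_assoc]
  congr 1
  refine setIntegral_congr_fun (measurableSet_Ioo.prod measurableSet_Ioo) fun z hz => ?_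
  simp only [Prod.fst_sub, Prod.snd_sub]
  rw [T.fracX_fn_sub h1 _ _ hz.1.1.le, T.fracY_fn_sub h2 _ _ hz.2.1.le, fn_sub, fn_sub]

theorem B_le (T : Triangulation a b c d) (hab : a < b) (hcd : c < d) {α₁ α₂ : ℝ}
    (h1 : 0 < α₁ ∧ α₁ < 1) (h2 : 0 < α₂ ∧ α₂ < 1) (N : ℕ) {η : Sym2 (ℝ × ℝ) → ℝ × ℝ}
    {lam : Sym2 (ℝ × ℝ) → ℝ} {l L K : ℝ} (hl : 0 < l)
    (hlam : ∀ f : T.Face, l ≤ lam (T.edge f) ∧ lam (T.edge f) ≤ L) (hK : 0 ≤ K)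
    (h : ∀ w, T.fieldSq α₁ α₂ (T.grad w - T.lifting N η w) ≤ K * T.energyNorm α₁ α₂ w ^ 2)
    (u v : T.PW) :
    T.B N α₁ α₂ η lam u v ≤
      (2 * K + 2 * |L|) * T.energyNorm α₁ α₂ u * T.energyNorm α₁ α₂ v := by
  have hE : ∀ w, 0 ≤ T.energyNorm α₁ α₂ w := fun w => Real.sqrt_nonneg _
  have nX := fun w => slabSq_nonneg hcd α₁ (T.fn (T.grad w - T.lifting N η w).1)
  have nY := fun w => slabSq_nonneg hab α₂ (fun x => T.fn (T.grad w - T.lifting N η w).2 x.swap)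
  have nG := fun w => add_nonneg (slabSq_nonneg hcd α₁ (T.fn (T.grad w).1))
    (slabSq_nonneg hab α₂ (fun x => T.fn (T.grad w).2 x.swap))
  have root : ∀ w (x : ℝ), x ≤ K * T.energyNorm α₁ α₂ w ^ 2 →
      Real.sqrt x ≤ Real.sqrt K * T.energyNorm α₁ α₂ w := by
    intro w x hx
    refine (Real.sqrt_le_sqrt hx).trans (le_of_eq ?_)
    rw [Real.sqrt_mul hK, Real.sqrt_sq (hE w)]
  have prod : ∀ x y : ℝ, x ≤ K * T.energyNorm α₁ α₂ u ^ 2 → y ≤ K * T.energyNorm α₁ α₂ v ^ 2 →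
      Real.sqrt x * Real.sqrt y ≤ K * (T.energyNorm α₁ α₂ u * T.energyNorm α₁ α₂ v) := by
    intro x y hx hy
    refine (mul_le_mul (root u x hx) (root v y hy) (Real.sqrt_nonneg _)
      (mul_nonneg (Real.sqrt_nonneg _) (hE u))).trans (le_of_eq ?_)
    rw [mul_mul_mul_comm, Real.mul_self_sqrt hK]
  have eX := (le_abs_self _).trans ((T.bddSupp_fn (T.grad v - T.lifting N η v).1)
    |>.abs_integral_fracX_mul_le hab hcd (T.bddSupp_fn (T.grad u - T.lifting N η u).1) h1.1 h1.2)
  have eY := (le_abs_self _).trans ((T.bddSupp_fn (T.grad v - T.lifting N η v).2).swap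
    |>.abs_integral_fracX_mul_le hcd hab (T.bddSupp_fn (T.grad u - T.lifting N η u).2).swap
      h2.1 h2.2)
  have pX := prod _ _ ((le_add_of_nonneg_right (nY u)).trans (h u))
    ((le_add_of_nonneg_right (nY v)).trans (h v))
  have pY := prod _ _ ((le_add_of_nonneg_left (nX u)).trans (h u))
    ((le_add_of_nonneg_left (nX v)).trans (h v))
  have hJ : ∀ w, Real.sqrt (T.jumpSq w) ≤ T.energyNorm α₁ α₂ w := by
    intro w
    refine Real.sqrt_le_iff.2 ⟨hE w, ?_⟩
    rw [T.energyNorm_sq hab hcd]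
    exact le_add_of_nonneg_left (nG w)
  have pJ := mul_le_mul (hJ u) (hJ v) (Real.sqrt_nonneg _) (hE u)
  have eJ := T.penalty_le hl hlam u v
  have pJ' := mul_le_mul_of_nonneg_left pJ (abs_nonneg L)
  rw [T.B_eq N h1.1 h2.1]
  linarith

/-- The fractional part is an exact multiple of the squared norm of the corrected gradient in each
direction, so the penalty is kept in full and no threshold on it arises. -/
theorem le_B (T : Triangulation a b c d) (hab : a < b) (hcd : c < d) {α₁ α₂ : ℝ}
    (h1 : 0 < α₁ ∧ α₁ < 1) (h2 : 0 < α₂ ∧ α₂ < 1) (N : ℕ) {η : Sym2 (ℝ × ℝ) → ℝ × ℝ}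
    {lam : Sym2 (ℝ × ℝ) → ℝ} {l m : ℝ} (hlam : ∀ f : T.Face, l ≤ lam (T.edge f))
    (hm1 : m ≤ Real.cos (Real.pi * α₁ / 2)) (hm2 : m ≤ Real.cos (Real.pi * α₂ / 2)) (v : T.PW) :
    m * T.fieldSq α₁ α₂ (T.grad v - T.lifting N η v) + l * T.jumpSq v ≤
      T.B N α₁ α₂ η lam v v := by
  have eX := (T.bddSupp_fn (T.grad v - T.lifting N η v).1).integral_fracX_mul_self hab hcd h1.1 h1.2
  have eY := (T.bddSupp_fn (T.grad v - T.lifting N η v).2).swap.integral_fracX_mul_self hcd hab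
    h2.1 h2.2
  have eJ := T.le_penalty hlam v
  have nX := mul_le_mul_of_nonneg_right hm1
    (slabSq_nonneg hcd α₁ (T.fn (T.grad v - T.lifting N η v).1))
  have nY := mul_le_mul_of_nonneg_right hm2
    (slabSq_nonneg hab α₂ (fun x => T.fn (T.grad v - T.lifting N η v).2 x.swap))
  rw [T.B_eq N h1.1 h2.1, eX, eY, fieldSq]
  linarith

end Triangulation

theorem cos_half_pi_mul_pos {μ : ℝ} (h0 : 0 < μ) (h1 : μ < 1) :
    0 < Real.cos (Real.pi * μ / 2) := by
  have := Real.pi_pos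
  refine Real.cos_pos_of_mem_Ioo ⟨?_, ?_⟩
  · have : 0 < Real.pi * μ := by positivity
    linarith
  · nlinarith

end FracDG

end

/-! ### The constants of the theorem -/

theorem theorem4p1 (a b c d : ℝ) (hab : a < b) (hcd : c < d)
    (α β : ℝ) (hα : 1 < α ∧ α < 2) (hβ : 1 < β ∧ β < 2) (N : ℕ)
    (σ M lam₀ lam₁ : ℝ) (hlam₀ : 0 < lam₀) :
    ∃ Ck Cs : ℝ, 0 < Ck ∧ 0 < Cs ∧
      ∀ T : FracDG.Triangulation a b c d, T.ShapeRegular σ →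
      ∀ η : Sym2 (ℝ × ℝ) → ℝ × ℝ, (∀ e ∈ T.internal, FracDG.len (η (T.edge e.1)) ≤ M) →
      ∀ lam : Sym2 (ℝ × ℝ) → ℝ,
        (∀ f : T.Face, lam₀ ≤ lam (T.edge f) ∧ lam (T.edge f) ≤ lam₁) →
      (∀ u ∈ T.V N, ∀ v ∈ T.V N,
        T.B N (2 - α) (2 - β) η lam u v ≤
          Ck * T.energyNorm (2 - α) (2 - β) u * T.energyNorm (2 - α) (2 - β) v) ∧
      (∀ v ∈ T.V N,
        Cs * T.energyNorm (2 - α) (2 - β) v ^ 2 ≤ T.B N (2 - α) (2 - β) η lam v v) := by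
  have h1 : 0 < 2 - α ∧ 2 - α < 1 := ⟨by linarith [hα.2], by linarith [hα.1]⟩
  have h2 : 0 < 2 - β ∧ 2 - β < 1 := ⟨by linarith [hβ.2], by linarith [hβ.1]⟩
  obtain ⟨KL, hKL0, hKL⟩ := FracDG.Triangulation.exists_lifting_le (a := a) (b := b) (c := c)
    (d := d) N σ M
  set KE := FracDG.embConst a b (2 - α) + FracDG.embConst c d (2 - β) with hKE
  have hKE0 : 0 < KE := by
    have e1 := FracDG.one_le_embConst (μ := 2 - α) hab
    have e2 := FracDG.one_le_embConst (μ := 2 - β) hcd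
    linarith
  -- The factors `2` come from splitting a sum under a squared norm, and `KE * KL` bounds the
  -- squared negative norm of the lifting by the jumps.
  set K := 2 + 2 * (KE * KL) with hK
  have hK0 : 0 < K := by positivity
  set m := min (Real.cos (Real.pi * (2 - α) / 2)) (Real.cos (Real.pi * (2 - β) / 2)) with hm
  have hm0 : 0 < m := lt_min (FracDG.cos_half_pi_mul_pos h1.1 h1.2) (FracDG.cos_half_pi_mul_pos h2.1 h2.2)
  -- Each of the two directions contributes `K` to the first constant and the penalty `2 |lam₁|`.
  -- The second constant `Cs` satisfies both `2 Cs ≤ m` and `K Cs ≤ lam₀`, which is what comparing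
  -- `2 X + K J` with `m X + lam₀ J` requires.
  refine ⟨2 * K + 2 * |lam₁|, m * lam₀ / (2 * lam₀ + K * m), by positivity, by positivity, ?_⟩
  intro T hT η hη lam hlam
  have lift : ∀ w, T.fieldSq (2 - α) (2 - β) (T.lifting N η w) ≤ KE * KL * T.jumpSq w := by
    intro w
    refine (T.fieldSq_le hab hcd h1 h2 _).trans ?_
    rw [mul_assoc]
    exact mul_le_mul_of_nonneg_left (hKL T hT η hη w) hKE0.le
  have liftNeg : ∀ w, T.fieldSq (2 - α) (2 - β) (-T.lifting N η w) ≤ KE * KL * T.jumpSq w := by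
    intro w
    refine (T.fieldSq_le hab hcd h1 h2 _).trans ?_
    rw [mul_assoc, T.innerV_neg]
    exact mul_le_mul_of_nonneg_left (hKL T hT η hη w) hKE0.le
  have hJ := T.jumpSq_nonneg
  refine ⟨fun u _ v _ => ?_, fun v _ => ?_⟩
  · refine T.B_le hab hcd h1 h2 N hlam₀ hlam hK0.le (fun w => ?_) u v
    have e := T.fieldSq_le_sub hab hcd h1 h2 (T.grad w - T.lifting N η w) (-T.lifting N η w)
    rw [sub_neg_eq_add, sub_add_cancel] at e
    rw [T.energyNorm_sq hab hcd, hK]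
    have e2 := liftNeg w
    have e3 : 0 ≤ T.fieldSq (2 - α) (2 - β) (T.grad w) :=
      add_nonneg (FracDG.slabSq_nonneg hcd _ _) (FracDG.slabSq_nonneg hab _ _)
    have e4 : 0 ≤ KE * KL * T.fieldSq (2 - α) (2 - β) (T.grad w) := by positivity
    have e5 := hJ w
    linarith
  · have e := T.le_B hab hcd h1 h2 N (η := η) (fun f => (hlam f).1) (min_le_left _ _)
      (min_le_right _ _) v
    refine le_trans ?_ e
    rw [T.energyNorm_sq hab hcd, div_mul_eq_mul_div, div_le_iff₀ (by positivity)]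
    have e1 := T.fieldSq_le_sub hab hcd h1 h2 (T.grad v) (T.lifting N η v)
    have e2 := lift v
    have e3 : 0 ≤ T.fieldSq (2 - α) (2 - β) (T.grad v - T.lifting N η v) :=
      add_nonneg (FracDG.slabSq_nonneg hcd _ _) (FracDG.slabSq_nonneg hab _ _)
    have e4 := hJ v
    set X := T.fieldSq (2 - α) (2 - β) (T.grad v - T.lifting N η v)
    set J := T.jumpSq v
    have e5 : T.fieldSq (2 - α) (2 - β) (T.grad v) + J ≤ 2 * X + K * J := by
      rw [hK]
      linarith
    have e6 := mul_le_mul_of_nonneg_left e5 (show 0 ≤ m * lam₀ by positivity)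
    -- After clearing the denominator, the two sides of that comparison differ by `m² K X + 2 lam₀²
    -- J`.
    have e7 : 0 ≤ m * m * K * X := by positivity
    have e8 : 0 ≤ lam₀ * lam₀ * J := by positivity
    change m * lam₀ * _ ≤ (m * X + lam₀ * J) * (2 * lam₀ + K * m)
    linarith
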